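/- **Setting.** Let $s_0\in\mathbb R$ and let $\{Q^s\mid s>s_0\}$ be a chain of smooth (Hausdorff) Banach manifolds: for all $r>s>s_0$ there is a smooth injective inclusion $j_{(r,s)}:Q^r\hookrightarrow Q^s$ with dense range, with $j_{(s,t)}\circ j_{(r,s)}=j_{(r,t)}$; for each $q\in Q^r$ the tangent map $T_qj_{(r,s)}$ has dense range in $T_qQ^s$; and at each $q\in Q^r$ there is a chart $\varphi:U\to T_qQ^s$ of $Q^s$ with $\varphi(q)=0$, $T_q\varphi=\mathrm{id}$, whose restriction to $U\cap Q^r$ takes values in $T_qQ^r$ and is a chart of $Q^r$. Each $Q^s$ is modelled on one Banach space $E^s$ and carries a weak Riemannian metric $\gamma$ with $j_{(r,s)}^*\gamma=\gamma$. Let $G$ be a finite-dimensional (Hausdorff) Lie group acting on all the $Q^s$ by an action $\Phi$ which is continuous on each $Q^s$, is proper (if $q_n$ and $\Phi_{g_n}(q_n)$ converge in $Q^s$, then $g_n$ has a convergent subsequence), commutes with the inclusions, and is such that $\Phi_g:Q^s\to Q^s$ is smooth for all $g\in G$ and $s>s_0$, and $\Phi^q:G\to Q^{s-1}$, $g\mapsto\Phi_g(q)$,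 is $C^1$ for all $s>s_0+1$ and $q\in Q^s$. Fix $s>s_0+1$. For $q\in Q^s$ and $\xi\in\mathfrak g=T_eG$ put $\xi_{Q^s}(q)=T_e\Phi^q(\xi)\in T_qQ^{s-1}$, and $$N^s_q:=\{v\in T_qQ^s\mid \gamma(q)(v,\xi_{Q^s}(q))=0\ \text{for all }\xi\in\mathfrak g\}.$$ Let $G_q$ be the isotropy group of $q$, and $\pi:Q^s\to Q^s/G$ the projection onto the orbit space with the quotient topology. **Theorem.** Suppose that the isotropy groups $G_q$, $q\in Q^s$, are all conjugate to one subgroup $H$ of $G$. (1) Let $\omega\in Q^s/G$ and $q\in\pi^{-1}(\omega)$. Let $\psi$ be a chart of $Q^s$ at $q$ with $\psi(q)=0$ and $T_q\psi=\mathrm{id}$ that is the restriction to an open subset of $Q^s$ of a chart $\varphi$ of $Q^{s-1}$ at $q$ with $\varphi(q)=0$ and $T_q\varphi=\mathrm{id}$. Let $\chi:V_0\to G$ be a smooth local section of $G\to G/G_q$ on an open neighbourhood $V_0$ of $[e]$. Then there are open neighbourhoods $V\subseteq V_0$ of $[e]$ and $U$ of $q$ in $Q^s$ and a $C^1$ map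 $\beta_q:U\to V$ such that for all $x\in V$ and $r\in U$ the point $\Phi_{\chi(x)}(r)$ lies in the domain of $\psi$ and $$\psi(\Phi_{\chi(x)}(r))\in N^s_q\iff x=\beta_q(r).$$ For all $V,U,\beta_q$ with these properties there is an open neighbourhood $U'\subseteq U$ of $q$ such that $B_q(r)=\psi(\Phi_{\chi(\beta_q(r))}(r))$, $r\in U'$, depends only on $\pi(r)$, and the induced map $\mathcal B_q:\pi(U')\to N^s_q$, $\mathcal B_q(\pi(r))=B_q(r)$, is a homeomorphism from the open neighbourhood $\pi(U')$ of $\omega$ onto an open subset of $N^s_q$ contained in the image of $\psi$, with inverse $\pi\circ\psi^{-1}$. (2) Hence $Q^s/G$ is a topological Banach manifold: it is Hausdorff and, for every $q\in Q^s$, the subspace $N^s_q$ is closed in $T_qQ^s$ and $Q^s/G$ is locally homeomorphic to open subsets of $N^s_q$ (it has an atlas of charts with values in $N^s_q$). -/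

import Mathlib

open Set Filter Topology
open scoped Manifold ContDiff

namespace BanachChains

universe u v w w'

/-- The index `s - 1`, for an index `s > s₀ + 1`. -/
def pred {s₀ : ℝ} (s : Ioi s₀) (hs : s₀ + 1 < (s : ℝ)) : Ioi s₀ :=
  ⟨(s : ℝ) - 1, by rw [mem_Ioi]; linarith⟩

theorem pred_lt {s₀ : ℝ} (s : Ioi s₀) (hs : s₀ + 1 < (s : ℝ)) : pred s hs < s := by
  rw [← Subtype.coe_lt_coe]
  simp [pred]

section Chart

variable {E : Type u} [NormedAddCommGroup E] [NormedSpace ℝ E]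
  {M : Type v} [TopologicalSpace M] [ChartedSpace E M]

/-- `φ` is a smooth chart of the Banach manifold `M` at `q` with values in the tangent space
`T_q M` (which in Mathlib is a copy of the model space `E`), normalized by `φ(q) = 0` and
`T_q φ = id`. -/
structure IsChartAt (q : M) (φ : OpenPartialHomeomorph M E) : Prop where
  mem_maximalAtlas : φ ∈ IsManifold.maximalAtlas 𝓘(ℝ, E) ∞ M
  mem_source : q ∈ φ.source
  map_eq_zero : φ q = 0
  mfderiv_eq : ∀ v : TangentSpace 𝓘(ℝ, E) q,
    (mfderiv 𝓘(ℝ, E) 𝓘(ℝ, E) φ q v : E) = (v : E)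

end Chart

section Chain

variable {s₀ : ℝ} (E : Ioi s₀ → Type u) [∀ s, NormedAddCommGroup (E s)]
  [∀ s, NormedSpace ℝ (E s)] (Q : Ioi s₀ → Type v) [∀ s, TopologicalSpace (Q s)]
  [∀ s, ChartedSpace (E s) (Q s)]

/-- A chain of Banach manifolds `{Q^s | s > s₀}` (the manifold `Q^s` being modelled on `E^s`):
smooth injective inclusions `j_{(r,s)} : Q^r → Q^s` for `s < r`, compatible with each other, with
dense range and whose tangent maps have dense range, such that at each point `q` of `Q^r` there is
a chart `φ` of `Q^s` whose restriction to `U ∩ Q^r` (`U` the domain of `φ`) takes its values in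
`T_q Q^r ⊆ T_q Q^s` and is a chart `ψ` of `Q^r`. -/
structure Chain where
  /-- the inclusion `j_{(r,s)}` -/
  incl : ∀ {r s : Ioi s₀}, s < r → Q r → Q s
  incl_injective : ∀ {r s : Ioi s₀} (h : s < r), Function.Injective (incl h)
  incl_incl : ∀ {r s t : Ioi s₀} (h : s < r) (h' : t < s) (q : Q r),
    incl h' (incl h q) = incl (h'.trans h) q
  contMDiff_incl : ∀ {r s : Ioi s₀} (h : s < r),
    ContMDiff 𝓘(ℝ, E r) 𝓘(ℝ, E s) ∞ (incl h)
  denseRange_incl : ∀ {r s : Ioi s₀} (h : s < r), DenseRange (incl h)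
  denseRange_mfderiv : ∀ {r s : Ioi s₀} (h : s < r) (q : Q r),
    DenseRange (mfderiv 𝓘(ℝ, E r) 𝓘(ℝ, E s) (incl h) q)
  exists_chart : ∀ {r s : Ioi s₀} (h : s < r) (q : Q r),
    ∃ (φ : OpenPartialHomeomorph (Q s) (E s)) (ψ : OpenPartialHomeomorph (Q r) (E r)),
      IsChartAt (incl h q) φ ∧ IsChartAt q ψ ∧ ψ.source = incl h ⁻¹' φ.source ∧
      ∀ x ∈ ψ.source,
        (mfderiv 𝓘(ℝ, E r) 𝓘(ℝ, E s) (incl h) q (ψ x : TangentSpace 𝓘(ℝ, E r) q) : E s)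
          = φ (incl h x)

variable {E Q}

/-- `ψ` is a chart of `Q^r` at `q` which is the restriction to (an open subset of) `U ∩ Q^r` of
a chart of `Q^s` at `q` with domain `U`, where `s < r`. -/
def IsRestrictedChart (C : Chain E Q) {r s : Ioi s₀} (h : s < r) (q : Q r)
    (ψ : OpenPartialHomeomorph (Q r) (E r)) : Prop :=
  IsChartAt q ψ ∧ ∃ φ : OpenPartialHomeomorph (Q s) (E s), IsChartAt (C.incl h q) φ ∧
    ψ.source ⊆ C.incl h ⁻¹' φ.source ∧
    ∀ x ∈ ψ.source,
      (mfderiv 𝓘(ℝ, E r) 𝓘(ℝ, E s) (C.incl h) q (ψ x : TangentSpace 𝓘(ℝ, E r) q) : E s)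
        = φ (C.incl h x)

/-- A weak Riemannian metric on the chain, independent of the index: on each `Q^s` a smooth
field of continuous positive definite symmetric bilinear forms on the tangent spaces (which need
not induce the topology of the tangent spaces), with `j_{(r,s)}^* γ_s = γ_r`. -/
structure WeakMetric [∀ s, IsManifold 𝓘(ℝ, E s) ∞ (Q s)] (C : Chain E Q) where
  /-- the bilinear form on `T_q Q^s` -/
  form : ∀ (s : Ioi s₀) (q : Q s),
    TangentSpace 𝓘(ℝ, E s) q →L[ℝ] TangentSpace 𝓘(ℝ, E s) q →L[ℝ] ℝ
  symm : ∀ (s : Ioi s₀) (q : Q s) (v w : TangentSpace 𝓘(ℝ, E s) q),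
    form s q v w = form s q w v
  pos : ∀ (s : Ioi s₀) (q : Q s) (v : TangentSpace 𝓘(ℝ, E s) q), v ≠ 0 → 0 < form s q v v
  contMDiff : ∀ s : Ioi s₀,
    ContMDiff 𝓘(ℝ, E s) (𝓘(ℝ, E s).prod 𝓘(ℝ, E s →L[ℝ] E s →L[ℝ] ℝ)) ∞
      (fun q : Q s ↦ Bundle.TotalSpace.mk' (E s →L[ℝ] E s →L[ℝ] ℝ)
        (E := fun q : Q s ↦
          TangentSpace 𝓘(ℝ, E s) q →L[ℝ] TangentSpace 𝓘(ℝ, E s) q →L[ℝ] ℝ) q (form s q))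
  pullback : ∀ {r s : Ioi s₀} (h : s < r) (q : Q r) (v w : TangentSpace 𝓘(ℝ, E r) q),
    form s (C.incl h q) (mfderiv 𝓘(ℝ, E r) 𝓘(ℝ, E s) (C.incl h) q v)
      (mfderiv 𝓘(ℝ, E r) 𝓘(ℝ, E s) (C.incl h) q w) = form r q v w

variable {EG : Type w} [NormedAddCommGroup EG] [NormedSpace ℝ EG]
  (G : Type w') [TopologicalSpace G] [ChartedSpace EG G] [Group G]

variable (EG) in
/-- The standing assumptions on the (in general non-smooth) action of the Lie group `G` on the
chain: it is continuous and (sequentially) proper on each `Q^s`, commutes with the inclusions,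
each `Φ_g` is smooth, and for `s > s₀ + 1` and `q ∈ Q^s` the orbit map
`g ↦ Φ_g(q)` is `C¹` as a map into `Q^{s-1}`. -/
structure IsChainAction [∀ s, MulAction G (Q s)] (C : Chain E Q) : Prop where
  continuous_smul : ∀ s : Ioi s₀, Continuous (fun p : G × Q s ↦ p.1 • p.2)
  proper : ∀ (s : Ioi s₀) (g : ℕ → G) (q : ℕ → Q s) (a b : Q s),
    Tendsto q atTop (𝓝 a) → Tendsto (fun n ↦ g n • q n) atTop (𝓝 b) →
    ∃ (c : G) (k : ℕ → ℕ), StrictMono k ∧ Tendsto (g ∘ k) atTop (𝓝 c)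
  incl_smul : ∀ {r s : Ioi s₀} (h : s < r) (g : G) (q : Q r),
    C.incl h (g • q) = g • C.incl h q
  contMDiff_smul : ∀ (s : Ioi s₀) (g : G),
    ContMDiff 𝓘(ℝ, E s) 𝓘(ℝ, E s) ∞ (fun q : Q s ↦ g • q)
  contMDiff_orbit : ∀ (s : Ioi s₀) (hs : s₀ + 1 < (s : ℝ)) (q : Q s),
    ContMDiff 𝓘(ℝ, EG) 𝓘(ℝ, E (pred s hs)) 1 (fun g : G ↦ C.incl (pred_lt s hs) (g • q))

variable {G}

variable (EG G) in
/-- For `q ∈ Q^s`, `s > s₀ + 1`, the infinitesimal generator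
`ξ_{Q^s}(q) = T_e Φ^q (ξ) ∈ T_q Q^{s-1}` of `ξ ∈ 𝔤 = T_e G`. -/
noncomputable def generator [∀ s, MulAction G (Q s)] (C : Chain E Q) (s : Ioi s₀)
    (hs : s₀ + 1 < (s : ℝ)) (q : Q s) (ξ : TangentSpace 𝓘(ℝ, EG) (1 : G)) :
    TangentSpace 𝓘(ℝ, E (pred s hs)) (C.incl (pred_lt s hs) q) :=
  (mfderiv 𝓘(ℝ, EG) 𝓘(ℝ, E (pred s hs))
    (fun g : G ↦ C.incl (pred_lt s hs) (g • q)) 1 ξ : E (pred s hs))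

variable (EG G) in
/-- The subspace `N^s_q` of the vectors of `T_q Q^s` that are `γ(q)`-orthogonal (in `T_q Q^{s-1}`)
to all infinitesimal generators at `q`. The generators of the elements of the Lie algebra of the
isotropy group `G_q` vanish at `q`, so it is the same to take orthogonality to the generators of a
basis of a complement of that Lie algebra. -/
noncomputable def normalSpace [∀ s, IsManifold 𝓘(ℝ, E s) ∞ (Q s)] [∀ s, MulAction G (Q s)]
    (C : Chain E Q) (γ : WeakMetric C) (s : Ioi s₀) (hs : s₀ + 1 < (s : ℝ)) (q : Q s) :
    Submodule ℝ (TangentSpace 𝓘(ℝ, E s) q) where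
  carrier := {v | ∀ ξ : TangentSpace 𝓘(ℝ, EG) (1 : G),
    γ.form (pred s hs) (C.incl (pred_lt s hs) q)
      (mfderiv 𝓘(ℝ, E s) 𝓘(ℝ, E (pred s hs)) (C.incl (pred_lt s hs)) q v)
      (generator EG G C s hs q ξ) = 0}
  zero_mem' := by intro ξ; simp
  add_mem' := by
    intro a b ha hb ξ
    rw [map_add, map_add, add_apply, ha ξ, hb ξ, add_zero]
  smul_mem' := by
    intro c a ha ξ
    rw [map_smul, map_smul, smul_apply, ha ξ, smul_zero]

/-- `χ` is a smooth local section of `G → G/H`, defined on the open neighbourhood `V₀` of `[e]`.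
Its smoothness with respect to the manifold structure of `G/H` is expressed through the surjective
submersion `G → G/H`. -/
structure IsLocalSection (EG : Type w) [NormedAddCommGroup EG] [NormedSpace ℝ EG]
    {G : Type w'} [TopologicalSpace G] [ChartedSpace EG G] [Group G]
    (H : Subgroup G) (V₀ : Set (G ⧸ H)) (χ : G ⧸ H → G) : Prop where
  isOpen : IsOpen V₀
  one_mem : ((1 : G) : G ⧸ H) ∈ V₀
  mk_section : ∀ x ∈ V₀, ((χ x : G) : G ⧸ H) = x
  contMDiffOn : ContMDiffOn 𝓘(ℝ, EG) 𝓘(ℝ, EG) ∞ (fun g : G ↦ χ (g : G ⧸ H))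
    ((fun g : G ↦ (g : G ⧸ H)) ⁻¹' V₀)

variable (EG) in
/-- `β : U → V` is a `C¹` map, from a neighbourhood `U` of `q` in `Q^s` to a neighbourhood `V` of
`[e]` in `G/G_q`, such that for all `x ∈ V` and `r ∈ U`
`ψ(Φ_{χ(x)}(r)) ∈ N ↔ x = β(r)`. Here `χ` is a smooth section over `V₀ ⊇ V`, so that `β` is `C¹`
if and only if `χ ∘ β` is. -/
structure IsSlicingMap [∀ s, MulAction G (Q s)] {s : Ioi s₀} {q : Q s}
    (N : Submodule ℝ (TangentSpace 𝓘(ℝ, E s) q)) (ψ : OpenPartialHomeomorph (Q s) (E s))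
    (V₀ : Set (G ⧸ MulAction.stabilizer G q)) (χ : G ⧸ MulAction.stabilizer G q → G)
    (V : Set (G ⧸ MulAction.stabilizer G q)) (U : Set (Q s))
    (β : Q s → G ⧸ MulAction.stabilizer G q) : Prop where
  isOpen_V : IsOpen V
  one_mem : ((1 : G) : G ⧸ MulAction.stabilizer G q) ∈ V
  V_subset : V ⊆ V₀
  isOpen_U : IsOpen U
  mem_U : q ∈ U
  mapsTo : MapsTo β U V
  smul_mem_source : ∀ x ∈ V, ∀ r ∈ U, χ x • r ∈ ψ.source
  contMDiffOn : ContMDiffOn 𝓘(ℝ, E s) 𝓘(ℝ, EG) 1 (fun r ↦ χ (β r)) U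
  mem_iff : ∀ x ∈ V, ∀ r ∈ U, (ψ (χ x • r) : TangentSpace 𝓘(ℝ, E s) q) ∈ N ↔ x = β r

end Chain

/-- The projection `π : X → X/G` onto the orbit space; the orbit space carries the quotient
topology. -/
def orbitProj (G : Type w) {X : Type v} [Group G] [MulAction G X] (x : X) :
    MulAction.orbitRel.Quotient G X :=
  Quotient.mk (MulAction.orbitRel G X) x

end BanachChains

/-! In restricted charts the inclusion of `Q^s` into `Q^{s-1}` is the linear map `ι`, its tangent
map at `q`. The theorem would be a routine use of the inverse function theorem and the constant rank
argument if `(g, z) ↦ ι (g • z)` were jointly `C^1`. The hypotheses give only separate regularity: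
joint continuity, smoothness of each `Φ_g`, and `C^1` orbit maps into `Q^{s-1}`. The first half of
the proof derives joint regularity (`LocalAction.contDiffAt_orbit`).

A Baire argument over the locally compact group bounds the maps `T g`, for `g` near `1`, uniformly
in `C^{1,1}` (`LocalAction.exists_uniform`). Averaging `T k⁻¹ z`, transported back by derivatives,
over a small bump function on `G` gives maps `a` on `E` and `b` on `F` close to the identity, with
`ι ∘ a = b ∘ ι`. In these coordinates `T u` is its own derivative at one point `q`, up to an error
of the size of `u` (`exists_average_remainder`). Here `q` is taken in the image of `Q^{s+1}`, so
that its orbit is Lipschitz even in `E`. Since the image of `a` contains an open set,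
differentiability of single orbits bounds `ι ∘ (fderiv ℝ (T u) q - 1)` at every vector;
Banach–Steinhaus makes the bound uniform. Undoing the averages bounds `ι (T u z) - ι z`, together
with its increments in `z`, by the size of `u` (`exists_lipschitz_orbits`). Continuity of both
partial derivatives follows.

The second half is geometric. Integrating left-invariant fields identifies the kernel of the tangent
of an orbit map with the Lie algebra of the isotropy group. Conjugate isotropy groups have
isomorphic Lie algebras, so the orbit maps have constant rank. Let `l` be the orthogonal
pseudoinverse of the tangent `D` of the orbit map at `q`; then the normal space is the kernel of `l
∘ ι`. Constant rank makes `l` detect all motion along nearby orbits (`exists_straightening`), so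
this kernel is a slice for small group elements (`IsOrbitChart.isSlice`).

For large group elements properness is used. If `p` and `g • p` are slice points near `q`, then `g`
accumulates at an element of `G_q`. That element is a limit of isotropy elements of the points `p`
(`eventually_exists_stabilizer`), which reduces to small elements. The limit statement is a
pigeonhole argument on the finite quotient of `G_q` by its `germ`, and uses conjugacy of the whole
groups, not only of their Lie algebras. Distinct slice points near `q` thus lie on distinct orbits,
and the slice is a chart of the orbit space. The slicing map comes from a separate application of
the inverse function theorem; all normal spaces have the same finite codimension and are therefore
homeomorphic. -/

namespace BanachChains

/-! ### `C^{1,1}` bounds and finite differences -/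

section Calculus

variable {E F : Type*} [NormedAddCommGroup E] [NormedSpace ℝ E]
  [NormedAddCommGroup F] [NormedSpace ℝ F]

/-- `f` is differentiable at the points of `s`, with derivative bounded by `K` and
`K`-Lipschitz on `s`. -/
structure IsC11On (K : ℝ) (f : E → F) (s : Set E) : Prop where
  diff : ∀ x ∈ s, DifferentiableAt ℝ f x
  bound : ∀ x ∈ s, ‖fderiv ℝ f x‖ ≤ K
  lip : ∀ x ∈ s, ∀ y ∈ s, ‖fderiv ℝ f x - fderiv ℝ f y‖ ≤ K * ‖x - y‖

namespace IsC11On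

variable {K : ℝ} {f : E → F} {s : Set E}

theorem mono {t : Set E} (h : IsC11On K f s) (hts : t ⊆ s) : IsC11On K f t :=
  ⟨fun x hx ↦ h.diff x (hts hx), fun x hx ↦ h.bound x (hts hx),
    fun x hx y hy ↦ h.lip x (hts hx) y (hts hy)⟩

theorem weaken {L : ℝ} (h : IsC11On K f s) (hKL : K ≤ L) : IsC11On L f s :=
  ⟨h.diff, fun x hx ↦ (h.bound x hx).trans hKL, fun x hx y hy ↦
    (h.lip x hx y hy).trans (by gcongr)⟩

theorem norm_sub_le (h : IsC11On K f s) (hs : Convex ℝ s) {x y : E} (hx : x ∈ s) (hy : y ∈ s) :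
    ‖f x - f y‖ ≤ K * ‖x - y‖ :=
  hs.norm_image_sub_le_of_norm_fderiv_le h.diff h.bound hy hx

/-- The increment `f (z + v) - f z`, as a function of `z`, has derivative bounded by `K * ‖v‖`; the
mean value inequality applies on `s ∩ (s - v)`, which is again convex. -/
theorem four_point (h : IsC11On K f s) (hs : Convex ℝ s) {x y v : E} (hx : x ∈ s) (hy : y ∈ s)
    (hxv : x + v ∈ s) (hyv : y + v ∈ s) :
    ‖f (x + v) - f x - (f (y + v) - f y)‖ ≤ K * ‖v‖ * ‖x - y‖ := by
  have hconv : Convex ℝ (s ∩ (fun z ↦ z + v) ⁻¹' s) := hs.inter (hs.translate_preimage_left v)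
  refine hconv.norm_image_sub_le_of_norm_hasFDerivWithin_le (f := fun z ↦ f (z + v) - f z)
    (f' := fun z ↦ fderiv ℝ f (z + v) - fderiv ℝ f z) (fun z hz ↦ ?_) (fun z hz ↦ ?_)
    ⟨hy, hyv⟩ ⟨hx, hxv⟩
  · exact (((hasFDerivAt_comp_add_right v).2 (h.diff _ hz.2).hasFDerivAt).sub
      (h.diff _ hz.1).hasFDerivAt).hasFDerivWithinAt
  · simpa using h.lip _ hz.2 _ hz.1

/-- Mean value inequality against the derivative frozen at `z`: on `s` the derivative deviates from
it by at most `K * C`. -/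
theorem norm_sub_sub_le (h : IsC11On K f s) (hs : Convex ℝ s) {x y z : E} {C : ℝ}
    (hK : 0 ≤ K) (hx : x ∈ s) (hy : y ∈ s) (hz : z ∈ s) (hC : ∀ w ∈ s, ‖w - z‖ ≤ C) :
    ‖f x - f y - fderiv ℝ f z (x - y)‖ ≤ K * C * ‖x - y‖ := by
  refine hs.norm_image_sub_le_of_norm_fderiv_le' h.diff (fun w hw ↦ ?_) hy hx
  exact (h.lip w hw z hz).trans (by gcongr; exact hC w hw)

theorem comp {H : Type*} [NormedAddCommGroup H] [NormedSpace ℝ H] {L : ℝ} {g : F → H} {t : Set F}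
    (hg : IsC11On L g t) (hf : IsC11On K f s) (hs : Convex ℝ s) (hK : 0 ≤ K) (hL : 0 ≤ L)
    (hst : MapsTo f s t) : IsC11On (L * K + L * K * K) (g ∘ f) s := by
  have hd : ∀ x ∈ s, fderiv ℝ (g ∘ f) x = (fderiv ℝ g (f x)).comp (fderiv ℝ f x) := fun x hx ↦
    fderiv_comp x (hg.diff _ (hst hx)) (hf.diff x hx)
  refine ⟨fun x hx ↦ (hg.diff _ (hst hx)).comp x (hf.diff x hx), fun x hx ↦ ?_,
    fun x hx y hy ↦ ?_⟩
  · rw [hd x hx]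
    refine (ContinuousLinearMap.opNorm_comp_le _ _).trans ?_
    have := mul_le_mul (hg.bound _ (hst hx)) (hf.bound x hx) (norm_nonneg _) hL
    nlinarith [mul_nonneg (mul_nonneg hL hK) hK]
  · rw [hd x hx, hd y hy]
    have h1 : (fderiv ℝ g (f x)).comp (fderiv ℝ f x) - (fderiv ℝ g (f y)).comp (fderiv ℝ f y)
        = (fderiv ℝ g (f x)).comp (fderiv ℝ f x - fderiv ℝ f y)
          + (fderiv ℝ g (f x) - fderiv ℝ g (f y)).comp (fderiv ℝ f y) := by
      ext v; simp
    rw [h1]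
    refine (norm_add_le _ _).trans ?_
    have h2 := (ContinuousLinearMap.opNorm_comp_le (fderiv ℝ g (f x))
      (fderiv ℝ f x - fderiv ℝ f y)).trans
      (mul_le_mul (hg.bound _ (hst hx)) (hf.lip x hx y hy) (norm_nonneg _) hL)
    have h3 := (ContinuousLinearMap.opNorm_comp_le (fderiv ℝ g (f x) - fderiv ℝ g (f y))
      (fderiv ℝ f y)).trans
      (mul_le_mul ((hg.lip _ (hst hx) _ (hst hy)).trans
        (mul_le_mul_of_nonneg_left (hf.norm_sub_le hs hx hy) hL)) (hf.bound y hy) (norm_nonneg _)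
        (by positivity))
    calc _ ≤ _ := add_le_add h2 h3
      _ = _ := by ring

end IsC11On

/-- The derivative of a `C^2` map is `C^1`, hence locally bounded and locally Lipschitz; no
compactness is involved. -/
theorem exists_isC11On_ball {f : E → F} {x : E} (h : ContDiffAt ℝ 2 f x) :
    ∃ K > 0, ∃ r > 0, IsC11On K f (Metric.ball x r) := by
  obtain ⟨L, t, ht, hL⟩ := (h.fderiv_right (m := 1) (by norm_num)).exists_lipschitzOnWith
  have hd : ∀ᶠ y in 𝓝 x, DifferentiableAt ℝ f y :=
    (h.eventually (by simp)).mono fun y hy ↦ hy.differentiableAt (by simp)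
  have hb : ∀ᶠ y in 𝓝 x, ‖fderiv ℝ f y‖ < ‖fderiv ℝ f x‖ + 1 :=
    (h.fderiv_right (m := 1) (by norm_num)).continuousAt.norm.eventually_lt_const (by simp)
  obtain ⟨r, hr, hball⟩ := Metric.eventually_nhds_iff_ball.1 (hd.and (hb.and ht))
  refine ⟨L + ‖fderiv ℝ f x‖ + 1, by positivity, r, hr, fun y hy ↦ (hball y hy).1,
    fun y hy ↦ (hball y hy).2.1.le.trans (by linarith [L.2]), fun y hy z hz ↦ ?_⟩
  have := hL.norm_sub_le (hball y hy).2.2 (hball z hz).2.2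
  refine this.trans ?_
  gcongr
  linarith [norm_nonneg (fderiv ℝ f x)]

/-- Finite difference bounds for a differentiable function give `C^{1,1}` bounds. -/
theorem isC11On_of_differences {f : E → F} {s : Set E} (hs : IsOpen s) {K : ℝ} (hK : 0 ≤ K)
    (hd : ∀ x ∈ s, DifferentiableAt ℝ f x)
    (h1 : ∀ x ∈ s, ∀ y ∈ s, ‖f x - f y‖ ≤ K * ‖x - y‖)
    (h2 : ∀ x ∈ s, ∀ y ∈ s, ∀ v, x + v ∈ s → y + v ∈ s →
      ‖f (x + v) - f x - (f (y + v) - f y)‖ ≤ K * ‖v‖ * ‖x - y‖) : IsC11On K f s := by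
  refine ⟨hd, fun x hx ↦ ?_, fun x hx y hy ↦ ?_⟩
  · refine (hd x hx).hasFDerivAt.le_of_lip' hK ?_
    filter_upwards [hs.mem_nhds hx] with y hy using h1 y hy x hx
  -- A difference of two derivatives is itself the derivative at `0` of one difference function, so
  -- it inherits the four-point bound.
  · have hf : HasFDerivAt (fun v ↦ f (x + v) - f (y + v)) (fderiv ℝ f x - fderiv ℝ f y) 0 := by
      have hx' : HasFDerivAt f (fderiv ℝ f x) (x + 0) := by simpa using (hd x hx).hasFDerivAt
      have hy' : HasFDerivAt f (fderiv ℝ f y) (y + 0) := by simpa using (hd y hy).hasFDerivAt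
      exact ((hasFDerivAt_comp_add_left x).2 hx').sub ((hasFDerivAt_comp_add_left y).2 hy')
    refine hf.le_of_lip' (by positivity) ?_
    have e1 : ∀ᶠ v in 𝓝 (0 : E), x + v ∈ s :=
      (continuous_const.add continuous_id).tendsto' _ _ (by simp) |>.eventually (hs.mem_nhds hx)
    have e2 : ∀ᶠ v in 𝓝 (0 : E), y + v ∈ s :=
      (continuous_const.add continuous_id).tendsto' _ _ (by simp) |>.eventually (hs.mem_nhds hy)
    filter_upwards [e1, e2] with v hv hv'
    have := h2 x hx y hy v hv hv'
    calc _ = ‖f (x + v) - f x - (f (y + v) - f y)‖ := by congr 1; simp; abel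
      _ ≤ _ := this
      _ = _ := by rw [sub_zero]; ring

end Calculus

/-! ### Local actions and uniform bounds by Baire category -/

/-- A germ at `(1, x₀)` of a jointly continuous action of `G` on `E` by maps of class `C²`. -/
structure LocalAction {G : Type*} [Group G] [TopologicalSpace G] {E : Type*}
    [NormedAddCommGroup E] [NormedSpace ℝ E] (T : G → E → E) (x₀ : E) : Prop where
  one : ∀ᶠ z in 𝓝 x₀, T 1 z = z
  mul : ∀ᶠ p : (G × G) × E in 𝓝 ((1, 1), x₀), T (p.1.1 * p.1.2) p.2 = T p.1.1 (T p.1.2 p.2)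
  cont : ∀ᶠ p : G × E in 𝓝 (1, x₀), ContinuousAt (fun p : G × E ↦ T p.1 p.2) p
  smooth : ∀ᶠ p : G × E in 𝓝 (1, x₀), ContDiffAt ℝ 2 (T p.1) p.2

namespace LocalAction

variable {G : Type*} [Group G] [TopologicalSpace G]
  {E : Type*} [NormedAddCommGroup E] [NormedSpace ℝ E] {T : G → E → E} {x₀ : E}

theorem one_apply (h : LocalAction T x₀) : T 1 x₀ = x₀ := h.one.self_of_nhds

theorem tendsto (h : LocalAction T x₀) :
    Tendsto (fun p : G × E ↦ T p.1 p.2) (𝓝 (1, x₀)) (𝓝 x₀) := by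
  simpa [ContinuousAt, h.one_apply] using h.cont.self_of_nhds

/-- The maps `T g` with `g` close to `1` are uniformly of class `C^{1,1}` near `x₀`: a Baire
category argument. -/
theorem exists_uniform [IsTopologicalGroup G] [LocallyCompactSpace G] [T2Space G] (h : LocalAction T x₀) :
    ∃ K > 0, ∃ r > 0, ∀ᶠ g in 𝓝 (1 : G), IsC11On K (T g) (Metric.ball x₀ r) ∧
      ∀ z ∈ Metric.ball x₀ r, ContinuousAt (fun p : G × E ↦ T p.1 p.2) (g, z) := by
  -- a neighbourhood where everything holds
  have hall : ∀ᶠ p : G × E in 𝓝 (1, x₀), ContinuousAt (fun p : G × E ↦ T p.1 p.2) p ∧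
      ContDiffAt ℝ 2 (T p.1) p.2 := h.cont.and h.smooth
  obtain ⟨r₀, hr₀, hball⟩ : ∃ r₀ > 0, ∀ᶠ g in 𝓝 (1 : G), ∀ z ∈ Metric.ball x₀ r₀,
      ContinuousAt (fun p : G × E ↦ T p.1 p.2) (g, z) ∧ ContDiffAt ℝ 2 (T g) z := by
    rw [nhds_prod_eq] at hall
    obtain ⟨p, hp, q, hq, hpq⟩ := eventually_prod_iff.1 hall
    obtain ⟨r₀, hr₀, hr⟩ := Metric.eventually_nhds_iff_ball.1 hq
    exact ⟨r₀, hr₀, hp.mono fun g hg z hz ↦ hpq hg (hr z hz)⟩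
  have hx : ∀ᶠ g in 𝓝 (1 : G), ContDiffAt ℝ 2 (T g⁻¹) (T g x₀) := by
    have : Tendsto (fun g : G ↦ (g⁻¹, T g x₀)) (𝓝 1) (𝓝 (1, x₀)) := by
      refine Tendsto.prodMk_nhds (continuous_inv.tendsto' _ _ (by simp)) ?_
      exact h.tendsto.comp (Tendsto.prodMk_nhds tendsto_id tendsto_const_nhds)
    exact this.eventually h.smooth
  have hmul : ∀ᶠ g in 𝓝 (1 : G), ∀ᶠ p : G × E in 𝓝 (1, x₀),
      T p.1 p.2 = T g⁻¹ (T (g * p.1) p.2) := by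
    have h1 := h.mul.eventually_nhds
    have h2 : Tendsto (fun g : G ↦ ((g⁻¹, g), x₀)) (𝓝 1) (𝓝 ((1, 1), x₀)) := by
      refine Tendsto.prodMk_nhds (Tendsto.prodMk_nhds ?_ tendsto_id) tendsto_const_nhds
      exact continuous_inv.tendsto' _ _ (by simp)
    filter_upwards [h2.eventually h1] with g hg
    have h3 : Tendsto (fun p : G × E ↦ ((g⁻¹, g * p.1), p.2)) (𝓝 (1, x₀))
        (𝓝 ((g⁻¹, g), x₀)) := by
      refine Continuous.tendsto' (by fun_prop) _ _ (by simp)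
    filter_upwards [h3.eventually hg] with p hp
    simpa using hp
  obtain ⟨N, hN, hNo, h1N⟩ := eventually_nhds_iff.1 (hball.and (hx.and hmul))
  have : BaireSpace N := hNo.baireSpace
  have : Nonempty N := ⟨⟨1, h1N⟩⟩
  -- The bounds are phrased by finite differences because only `g ↦ T g x` is known to be
  -- continuous: such conditions are closed in `g`, while conditions on derivatives need not be. One
  -- index `n` serves both as constant and, through `1 / (n + 1)`, as radius.
  let C : ℕ → Set N := fun n ↦ {g | ∀ x ∈ Metric.ball x₀ (min r₀ (1 / (n + 1))),
    ∀ y ∈ Metric.ball x₀ (min r₀ (1 / (n + 1))), ‖T g x - T g y‖ ≤ n * ‖x - y‖ ∧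
    ∀ v, x + v ∈ Metric.ball x₀ (min r₀ (1 / (n + 1))) →
      y + v ∈ Metric.ball x₀ (min r₀ (1 / (n + 1))) →
      ‖T g (x + v) - T g x - (T g (y + v) - T g y)‖ ≤ n * ‖v‖ * ‖x - y‖}
  have hcont : ∀ x ∈ Metric.ball x₀ r₀, Continuous fun g : N ↦ T g x := by
    intro x hx
    rw [continuous_iff_continuousAt]
    intro g
    exact ContinuousAt.comp (f := fun g : N ↦ ((g : G), x)) ((hN g g.2).1 x hx).1
      (by fun_prop)
  have hsub : ∀ n : ℕ, Metric.ball x₀ (min r₀ (1 / ((n : ℝ) + 1))) ⊆ Metric.ball x₀ r₀ :=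
    fun n ↦ Metric.ball_subset_ball (min_le_left _ _)
  have hclosed : ∀ n, IsClosed (C n) := by
    intro n
    simp only [C, ofPred_forall, ofPred_and]
    refine isClosed_iInter fun x ↦ isClosed_iInter fun hx ↦ isClosed_iInter fun y ↦
      isClosed_iInter fun hy ↦ IsClosed.inter ?_ (isClosed_iInter fun v ↦ isClosed_iInter fun hxv ↦
      isClosed_iInter fun hyv ↦ ?_)
    · exact isClosed_le (((hcont x (hsub n hx)).sub (hcont y (hsub n hy))).norm) continuous_const
    · exact isClosed_le ((((hcont _ (hsub n hxv)).sub (hcont x (hsub n hx))).sub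
        ((hcont _ (hsub n hyv)).sub (hcont y (hsub n hy)))).norm) continuous_const
  have hcover : ⋃ n, C n = univ := by
    refine eq_univ_of_forall fun g ↦ mem_iUnion.2 ?_
    obtain ⟨K, hK, r, hr, hf⟩ := exists_isC11On_ball ((hN g g.2).1 x₀ (by simpa using hr₀)).2
    obtain ⟨n, hn⟩ := exists_nat_gt (max K (1 / r))
    have hn1 : K ≤ n := (le_max_left _ _).trans hn.le
    have hn2 : 1 / ((n : ℝ) + 1) ≤ r := by
      have : 1 / r ≤ n := (le_max_right _ _).trans hn.le
      rw [div_le_iff₀ (by positivity)]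
      rw [div_le_iff₀ hr] at this
      nlinarith
    have hf' : IsC11On (n : ℝ) (T g) (Metric.ball x₀ (min r₀ (1 / ((n : ℝ) + 1)))) :=
      (hf.weaken hn1).mono (Metric.ball_subset_ball ((min_le_right _ _).trans hn2))
    exact ⟨n, fun x hx y hy ↦ ⟨hf'.norm_sub_le (convex_ball _ _) hx hy, fun v hxv hyv ↦
      hf'.four_point (convex_ball _ _) hx hy hxv hyv⟩⟩
  -- Baire gives a common constant near some `g₀`, which need not be `1`. The bounds are moved to
  -- `1` by `T g = T g₀⁻¹ ∘ T (g₀ * g)`, where the fixed map `T g₀⁻¹` is `C^2` at `T g₀ x₀`.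
  obtain ⟨n, g₀, hg₀⟩ := nonempty_interior_of_iUnion_of_closed hclosed hcover
  set ρ := min r₀ (1 / ((n : ℝ) + 1)) with hρ
  have hρ0 : 0 < ρ := lt_min hr₀ (by positivity)
  have hC : ∀ᶠ g in 𝓝 (g₀ : G), IsC11On (n : ℝ) (T g) (Metric.ball x₀ ρ) := by
    have h1 : ∀ᶠ g in 𝓝 g₀, g ∈ C n := mem_interior_iff_mem_nhds.1 hg₀
    have h2 : ∀ᶠ g : N in 𝓝 g₀, IsC11On (n : ℝ) (T g) (Metric.ball x₀ ρ) := by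
      filter_upwards [h1] with g hg
      refine isC11On_of_differences Metric.isOpen_ball (by positivity) (fun x hx ↦ ?_)
        (fun x hx y hy ↦ (hg x hx y hy).1) (fun x hx y hy ↦ (hg x hx y hy).2)
      exact ((hN g g.2).1 x (hsub n hx)).2.differentiableAt (by simp)
    rw [nhds_subtype_eq_comap, eventually_comap] at h2
    filter_upwards [h2, hNo.mem_nhds g₀.2] with g hg hgN using hg ⟨g, hgN⟩ rfl
  obtain ⟨L, hL, r₁, hr₁, hf⟩ := exists_isC11On_ball (hN g₀ g₀.2).2.1
  have hnear : ∀ᶠ p : G × E in 𝓝 (1, x₀), T (g₀ * p.1) p.2 ∈ Metric.ball (T g₀ x₀) r₁ := by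
    have h1 : Tendsto (fun p : G × E ↦ ((g₀ : G) * p.1, p.2)) (𝓝 (1, x₀)) (𝓝 ((g₀ : G), x₀)) :=
      Continuous.tendsto' (by fun_prop) _ _ (by simp)
    have h2 := ((hN g₀ g₀.2).1 x₀ (by simpa using hr₀)).1.tendsto.comp h1
    exact h2.eventually (Metric.ball_mem_nhds _ hr₁)
  obtain ⟨r₂, hr₂, hgood⟩ : ∃ r₂ > 0, ∀ᶠ g in 𝓝 (1 : G), ∀ z ∈ Metric.ball x₀ r₂,
      T (g₀ * g) z ∈ Metric.ball (T g₀ x₀) r₁ ∧ T g z = T g₀⁻¹ (T (g₀ * g) z) := by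
    have := hnear.and (hN g₀ g₀.2).2.2
    rw [nhds_prod_eq] at this
    obtain ⟨p, hp, q, hq, hpq⟩ := eventually_prod_iff.1 this
    obtain ⟨r₀, hr₀, hr⟩ := Metric.eventually_nhds_iff_ball.1 hq
    exact ⟨r₀, hr₀, hp.mono fun g hg z hz ↦ hpq hg (hr z hz)⟩
  have hC' : ∀ᶠ g in 𝓝 (1 : G), IsC11On (n : ℝ) (T (g₀ * g)) (Metric.ball x₀ ρ) := by
    have : Tendsto (fun g ↦ (g₀ : G) * g) (𝓝 1) (𝓝 (g₀ : G)) :=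
      Continuous.tendsto' (by fun_prop) _ _ (by simp)
    exact this.eventually hC
  have hr : 0 < min ρ r₂ := lt_min hρ0 hr₂
  refine ⟨L * n + L * n * n + 1, by positivity, min ρ r₂, hr, ?_⟩
  filter_upwards [hgood, hC', hball] with g hg hgC hgb
  have hsub1 : Metric.ball x₀ (min ρ r₂) ⊆ Metric.ball x₀ r₂ :=
    Metric.ball_subset_ball (min_le_right _ _)
  have hsub2 : Metric.ball x₀ (min ρ r₂) ⊆ Metric.ball x₀ ρ :=
    Metric.ball_subset_ball (min_le_left _ _)
  have hcomp := (hf.comp (hgC.mono hsub2) (convex_ball _ _) (by positivity) hL.le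
    (fun z hz ↦ (hg z (hsub1 hz)).1)).weaken (L := L * n + L * n * n + 1) (by simp)
  have heq : ∀ z ∈ Metric.ball x₀ (min ρ r₂), T g =ᶠ[𝓝 z] T g₀⁻¹ ∘ T (g₀ * g) := fun z hz ↦ by
    filter_upwards [Metric.isOpen_ball.mem_nhds hz] with w hw using (hg w (hsub1 hw)).2
  refine ⟨⟨fun z hz ↦ (hcomp.diff z hz).congr_of_eventuallyEq (heq z hz), fun z hz ↦ ?_,
    fun z hz w hw ↦ ?_⟩, fun z hz ↦ (hgb z ?_).1⟩
  · rw [(heq z hz).fderiv_eq]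
    exact hcomp.bound z hz
  · rw [(heq z hz).fderiv_eq, (heq w hw).fderiv_eq]
    exact hcomp.lip z hz w hw
  · exact Metric.ball_subset_ball (min_le_left _ _) (hsub2 hz)

end LocalAction

end BanachChains

/-! ### The averaging map and its closeness to the identity -/

namespace BanachChains

open MeasureTheory

/-- The comparison goes through `b + (a' - b')`: from there to `a` the derivative at `q` controls
the change, and what remains compares one increment based at `b` and at `b'`. The auxiliary point
can leave the ball of radius `ε`, hence the domain of radius `3 * ε`. -/
theorem IsC11On.four_point_fderiv {E F : Type*} [NormedAddCommGroup E] [NormedSpace ℝ E]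
    [NormedAddCommGroup F] [NormedSpace ℝ F] {K ε : ℝ} {f : E → F} {q a b a' b' : E} (hK : 0 ≤ K)
    (h : IsC11On K f (Metric.ball q (3 * ε)))
    (ha : a ∈ Metric.ball q ε) (hb : b ∈ Metric.ball q ε) (ha' : a' ∈ Metric.ball q ε)
    (hb' : b' ∈ Metric.ball q ε) :
    ‖f a - f b - (f a' - f b') - fderiv ℝ f q (a - b - (a' - b'))‖
      ≤ K * (3 * ε) * ‖a - b - (a' - b')‖ + K * ‖a' - b'‖ * ‖b - b'‖ := by
  have hε : 0 < ε := dist_nonneg.trans_lt (Metric.mem_ball.1 ha)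
  have hsub : Metric.ball q ε ⊆ Metric.ball q (3 * ε) := Metric.ball_subset_ball (by linarith)
  have h3 : b + (a' - b') ∈ Metric.ball q (3 * ε) := by
    rw [mem_ball_iff_norm] at *
    calc ‖b + (a' - b') - q‖ = ‖(b - q) + ((a' - q) - (b' - q))‖ := by congr 1; abel
      _ ≤ ‖b - q‖ + (‖a' - q‖ + ‖b' - q‖) := by
        refine (norm_add_le _ _).trans ?_
        gcongr
        exact _root_.norm_sub_le _ _
      _ < 3 * ε := by linarith
  have e1 := h.norm_sub_sub_le (convex_ball _ _) hK (hsub ha) h3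
    (Metric.mem_ball_self (by linarith : 0 < 3 * ε))
    (fun w hw ↦ (mem_ball_iff_norm.1 hw).le)
  have e2 := h.four_point (convex_ball _ _) (hsub hb) (hsub hb') h3 (v := a' - b')
    (by simpa using hsub ha')
  have e3 : a - (b + (a' - b')) = a - b - (a' - b') := by abel
  have e4 : b' + (a' - b') = a' := by abel
  rw [e3] at e1
  rw [e4] at e2
  calc _ = ‖(f a - f (b + (a' - b')) - fderiv ℝ f q (a - b - (a' - b')))
        + (f (b + (a' - b')) - f b - (f a' - f b'))‖ := by congr 1; abel
    _ ≤ _ := (norm_add_le _ _).trans (add_le_add e1 e2)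

/-- The uniform bounds and the action laws of a local action on a fixed neighbourhood. -/
structure UniformLocalAction {G : Type*} [Group G] [TopologicalSpace G] {E : Type*}
    [NormedAddCommGroup E] [NormedSpace ℝ E] (T : G → E → E) (x₀ : E) (K r δ : ℝ) (N : Set G) :
    Prop where
  pos_K : 0 < K
  pos_δ : 0 < δ
  δ_le : δ ≤ r
  c11 : ∀ g ∈ N, IsC11On K (T g) (Metric.ball x₀ r)
  cont : ∀ g ∈ N, ∀ z ∈ Metric.ball x₀ r, ContinuousAt (fun p : G × E ↦ T p.1 p.2) (g, z)
  one : ∀ z ∈ Metric.ball x₀ r, T 1 z = z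
  mul : ∀ g ∈ N, ∀ h ∈ N, ∀ z ∈ Metric.ball x₀ r, T (g * h) z = T g (T h z)
  maps : ∀ g ∈ N, ∀ z ∈ Metric.ball x₀ δ, T g z ∈ Metric.ball x₀ r

theorem LocalAction.exists_uniformLocalAction {G : Type*} [Group G] [TopologicalSpace G]
    [IsTopologicalGroup G] [LocallyCompactSpace G] [T2Space G]
    {E : Type*} [NormedAddCommGroup E] [NormedSpace ℝ E] {T : G → E → E} {x₀ : E}
    (h : LocalAction T x₀) : ∃ K r δ, ∃ N ∈ 𝓝 (1 : G), UniformLocalAction T x₀ K r δ N := by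
  obtain ⟨K, hK, r₁, hr₁, h1⟩ := h.exists_uniform
  obtain ⟨N₂, hN₂, r₂, hr₂, h2⟩ : ∃ N ∈ 𝓝 (1 : G), ∃ r > 0, ∀ g ∈ N, ∀ h ∈ N,
      ∀ z ∈ Metric.ball x₀ r, T (g * h) z = T g (T h z) := by
    have := h.mul
    rw [nhds_prod_eq] at this
    obtain ⟨p, hp, q, hq, hpq⟩ := eventually_prod_iff.1 this
    rw [nhds_prod_eq, eventually_prod_iff] at hp
    obtain ⟨p1, hp1, p2, hp2, hp12⟩ := hp
    obtain ⟨r, hr, hball⟩ := Metric.eventually_nhds_iff_ball.1 hq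
    exact ⟨{g | p1 g ∧ p2 g}, hp1.and hp2, r, hr, fun g hg h hh z hz ↦
      hpq (hp12 hg.1 hh.2) (hball z hz)⟩
  obtain ⟨r₃, hr₃, h3⟩ := Metric.eventually_nhds_iff_ball.1 h.one
  set r := min r₁ (min r₂ r₃)
  have hr : 0 < r := lt_min hr₁ (lt_min hr₂ hr₃)
  have hs1 : Metric.ball x₀ r ⊆ Metric.ball x₀ r₁ := Metric.ball_subset_ball (min_le_left _ _)
  have hs2 : Metric.ball x₀ r ⊆ Metric.ball x₀ r₂ :=
    Metric.ball_subset_ball ((min_le_right _ _).trans (min_le_left _ _))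
  have hs3 : Metric.ball x₀ r ⊆ Metric.ball x₀ r₃ :=
    Metric.ball_subset_ball ((min_le_right _ _).trans (min_le_right _ _))
  have h4 := h.tendsto.eventually (Metric.ball_mem_nhds x₀ hr)
  rw [nhds_prod_eq] at h4
  obtain ⟨p, hp, q, hq, hpq⟩ := eventually_prod_iff.1 h4
  obtain ⟨δ, hδ, hball⟩ := Metric.eventually_nhds_iff_ball.1 hq
  refine ⟨K, r, min δ r, N₂ ∩ {g | p g ∧ _}, inter_mem hN₂ (hp.and h1), hK, lt_min hδ hr,
    min_le_right _ _, fun g hg ↦ hg.2.2.1.mono hs1, fun g hg z hz ↦ hg.2.2.2 z (hs1 hz),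
    fun z hz ↦ h3 z (hs3 hz), fun g hg h hh z hz ↦ h2 g hg.1 h hh.1 z (hs2 hz),
    fun g hg z hz ↦ hpq hg.2.1 (hball z (Metric.ball_subset_ball (min_le_left _ _) hz))⟩

/-- A bump function `ρ` around `1` with total mass `1`, which is Lipschitz under translations with
respect to the gauge `m`. -/
structure IsAveragingKernel {G : Type*} [Group G] [TopologicalSpace G] [MeasurableSpace G]
    (μ : Measure G) (m : G → ℝ) (ρ : G → ℝ) (C : ℝ) (S N : Set G) : Prop where
  continuous : Continuous ρ
  nonneg : ∀ k, 0 ≤ ρ k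
  integral_eq_one : ∫ k, ρ k ∂μ = 1
  hasCompactSupport : HasCompactSupport ρ
  tsupport_subset : tsupport ρ ⊆ N
  isCompact : IsCompact S
  C_nonneg : 0 ≤ C
  translate : ∀ᶠ u in 𝓝 (1 : G), ∀ k, |ρ (u * k) - ρ k| ≤ C * m u ∧ (k ∉ S → ρ (u * k) = 0)

namespace UniformLocalAction

variable {G : Type*} [Group G] [TopologicalSpace G] [IsTopologicalGroup G]
  {E : Type*} [NormedAddCommGroup E] [NormedSpace ℝ E] {T : G → E → E} {x₀ : E}
  {K r δ : ℝ} {N N₁ : Set G}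

omit [IsTopologicalGroup G] in
theorem mono_set (h : UniformLocalAction T x₀ K r δ N) (hN : N₁ ⊆ N) :
    UniformLocalAction T x₀ K r δ N₁ :=
  ⟨h.pos_K, h.pos_δ, h.δ_le, fun g hg ↦ h.c11 g (hN hg), fun g hg ↦ h.cont g (hN hg), h.one,
    fun g hg k hk ↦ h.mul g (hN hg) k (hN hk), fun g hg ↦ h.maps g (hN hg)⟩

omit [IsTopologicalGroup G] in
/-- The derivatives of the maps `T g` are jointly strongly continuous. -/
theorem continuousAt_fderiv_apply (h : UniformLocalAction T x₀ K r δ N) {g : G} {z v : E}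
    (hg : N ∈ 𝓝 g) (hz : z ∈ Metric.ball x₀ r) :
    ContinuousAt (fun p : G × E × E ↦ fderiv ℝ (T p.1) p.2.1 p.2.2) (g, z, v) := by
  have hK := h.pos_K
  refine continuousAt_of_locally_uniform_approx_of_continuousAt fun U hU ↦ ?_
  obtain ⟨ε, hε, hεU⟩ := Metric.mem_uniformity_dist.1 hU
  -- Difference quotients with a fixed step `τ` are jointly continuous, and the uniform Lipschitz
  -- bound on derivatives puts them within `K * (τ * ‖v‖) * ‖v‖` of the derivative, uniformly near
  -- `(g, z)`.
  obtain ⟨τ, hτ, hτz, hτε⟩ : ∃ τ > 0, τ * ‖v‖ < (r - dist z x₀) / 2 ∧ K * (τ * ‖v‖) * ‖v‖ < ε / 2 := by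
    have hz' : 0 < (r - dist z x₀) / 2 := by linarith [Metric.mem_ball.1 hz]
    have t1 : Tendsto (fun τ : ℝ ↦ τ * ‖v‖) (𝓝[>] 0) (𝓝 0) :=
      (Continuous.tendsto' (by fun_prop) _ _ (by simp)).mono_left nhdsWithin_le_nhds
    have t2 : Tendsto (fun τ : ℝ ↦ K * (τ * ‖v‖) * ‖v‖) (𝓝[>] 0) (𝓝 0) :=
      (Continuous.tendsto' (by fun_prop) _ _ (by simp)).mono_left nhdsWithin_le_nhds
    obtain ⟨τ, h1, h2, h3⟩ := ((t1.eventually_lt_const hz').and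
      ((t2.eventually_lt_const (half_pos hε)).and self_mem_nhdsWithin)).exists
    exact ⟨τ, h3, h1, h2⟩
  have hzτ : z + τ • v ∈ Metric.ball x₀ r := by
    rw [Metric.mem_ball] at hz ⊢
    calc dist (z + τ • v) x₀ ≤ dist (z + τ • v) z + dist z x₀ := dist_triangle _ _ _
      _ = τ * ‖v‖ + dist z x₀ := by simp [dist_eq_norm, norm_smul, abs_of_pos hτ]
      _ < r := by linarith
  have e1 : ∀ᶠ p : G × E × E in 𝓝 (g, z, v), p.1 ∈ N :=
    continuous_fst.tendsto (g, z, v) |>.eventually hg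
  have e2 : ∀ᶠ p : G × E × E in 𝓝 (g, z, v), dist p.2.1 z < (r - dist z x₀) / 2 := by
    have : Tendsto (fun p : G × E × E ↦ dist p.2.1 z) (𝓝 (g, z, v)) (𝓝 0) :=
      Continuous.tendsto' (by fun_prop) _ _ (by simp)
    exact this.eventually_lt_const (by linarith [Metric.mem_ball.1 hz])
  have e3 : ∀ᶠ p : G × E × E in 𝓝 (g, z, v), K * ‖p.2.2 - v‖ < ε / 2 := by
    have : Tendsto (fun p : G × E × E ↦ K * ‖p.2.2 - v‖) (𝓝 (g, z, v)) (𝓝 0) :=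
      Continuous.tendsto' (by fun_prop) _ _ (by simp)
    exact this.eventually_lt_const (by linarith)
  refine ⟨_, e1.and (e2.and e3), fun p ↦ τ⁻¹ • (T p.1 (p.2.1 + τ • v) - T p.1 p.2.1), ?_, ?_⟩
  · refine ContinuousAt.const_smul (ContinuousAt.sub ?_ ?_) _
    · exact ContinuousAt.comp (x := (g, z, v)) (f := fun p : G × E × E ↦ (p.1, p.2.1 + τ • v))
        (h.cont g (mem_of_mem_nhds hg) _ hzτ) (by fun_prop)
    · exact ContinuousAt.comp (x := (g, z, v)) (f := fun p : G × E × E ↦ (p.1, p.2.1))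
        (h.cont g (mem_of_mem_nhds hg) _ hz) (by fun_prop)
  · rintro ⟨g', z', v'⟩ ⟨hg', hz', hv'⟩
    simp only at hg' hz' hv'
    apply hεU
    have hsub : Metric.closedBall z' (τ * ‖v‖) ⊆ Metric.ball x₀ r := by
      intro w hw
      rw [Metric.mem_closedBall] at hw
      rw [Metric.mem_ball]
      linarith [dist_triangle w z' x₀, dist_triangle z' z x₀]
    have hz'mem : z' ∈ Metric.closedBall z' (τ * ‖v‖) :=
      Metric.mem_closedBall_self (by positivity)
    have hC := (h.c11 g' hg').mono hsub
    have e := hC.norm_sub_sub_le (convex_closedBall _ _) hK.le (x := z' + τ • v) (y := z')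
      (by simp [norm_smul, abs_of_pos hτ]) hz'mem hz'mem
      (fun w hw ↦ mem_closedBall_iff_norm.1 hw)
    rw [add_sub_cancel_left, norm_smul, Real.norm_of_nonneg hτ.le] at e
    have e' : ‖fderiv ℝ (T g') z' v - τ⁻¹ • (T g' (z' + τ • v) - T g' z')‖
        ≤ K * (τ * ‖v‖) * ‖v‖ := by
      have : fderiv ℝ (T g') z' v - τ⁻¹ • (T g' (z' + τ • v) - T g' z')
          = -(τ⁻¹ • (T g' (z' + τ • v) - T g' z' - fderiv ℝ (T g') z' (τ • v))) := by
        rw [map_smul, smul_sub _ _ (τ • _), inv_smul_smul₀ hτ.ne', neg_sub]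
      rw [this, norm_neg, norm_smul, norm_inv, Real.norm_of_nonneg hτ.le, inv_mul_le_iff₀ hτ]
      linarith
    have e'' : ‖fderiv ℝ (T g') z' v' - fderiv ℝ (T g') z' v‖ ≤ K * ‖v' - v‖ := by
      rw [← map_sub]
      exact (ContinuousLinearMap.le_opNorm _ _).trans
        (by gcongr; exact (h.c11 g' hg').bound z' (hsub hz'mem))
    rw [dist_eq_norm]
    calc _ = ‖(fderiv ℝ (T g') z' v' - fderiv ℝ (T g') z' v) +
          (fderiv ℝ (T g') z' v - τ⁻¹ • (T g' (z' + τ • v) - T g' z'))‖ := by congr 1; abel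
      _ ≤ _ := norm_add_le _ _
      _ < ε := by linarith

/-- The transport operator `T_{k⁻¹ q} Φ_k`. -/
noncomputable def transport (T : G → E → E) (q : E) (k : G) : E →L[ℝ] E :=
  fderiv ℝ (T k) (T k⁻¹ q)

/-- The average `∫ ρ(k) Γ_k T_{k⁻¹} z dk`. -/
noncomputable def average [MeasurableSpace G] (μ : Measure G) (ρ : G → ℝ) (T : G → E → E) (q z : E) :
    E :=
  ∫ k, ρ k • transport T q k (T k⁻¹ z) ∂μ

section

variable (h : UniformLocalAction T x₀ K r δ N) (hN₁ : IsOpen N₁) (hinv : ∀ g ∈ N₁, g⁻¹ ∈ N₁)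
  (hmulN : ∀ g ∈ N₁, ∀ k ∈ N₁, g * k ∈ N) (hsub : N₁ ⊆ N) {q : E} (hq : q ∈ Metric.ball x₀ δ)

include h hq hinv hsub

omit [IsTopologicalGroup G] in
theorem norm_transport_le {k : G} (hk : k ∈ N₁) : ‖transport T q k‖ ≤ K :=
  (h.c11 k (hsub hk)).bound _ (h.maps _ (hsub (hinv k hk)) _ hq)

-- Chain rule for `T k ∘ T k⁻¹ = id` near `q`. This makes the averaging map approximate the identity
-- near `q`.
omit [IsTopologicalGroup G] in
theorem transport_comp {k : G} (hk : k ∈ N₁) (v : E) :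
    transport T q k (fderiv ℝ (T k⁻¹) q v) = v := by
  have hq' : q ∈ Metric.ball x₀ r := Metric.ball_subset_ball h.δ_le hq
  have h1 : fderiv ℝ (T k ∘ T k⁻¹) q = (transport T q k).comp (fderiv ℝ (T k⁻¹) q) :=
    fderiv_comp q ((h.c11 k (hsub hk)).diff _ (h.maps _ (hsub (hinv k hk)) _ hq))
      ((h.c11 k⁻¹ (hsub (hinv k hk))).diff _ hq')
  have h2 : T k ∘ T k⁻¹ =ᶠ[𝓝 q] id := by
    filter_upwards [Metric.isOpen_ball.mem_nhds hq'] with z hz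
    rw [Function.comp_apply, ← h.mul k (hsub hk) _ (hsub (hinv k hk)) z hz, mul_inv_cancel,
      h.one z hz, id]
  rw [h2.fderiv_eq, fderiv_id] at h1
  exact (DFunLike.congr_fun h1 v).symm

-- The difference would vanish if the derivative of `T (u * k)` were taken at `T k⁻¹ q`; it is taken
-- at `T k⁻¹ (T u⁻¹ q)`, and the Lipschitz bound on derivatives pays for the shift. Only the
-- displacement of the single point `q` enters.
include hmulN in
omit [IsTopologicalGroup G] in
theorem norm_transport_sub_le {u k : G} (hu : u ∈ N₁) (hk : k ∈ N₁) (huk : u * k ∈ N₁) :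
    ‖transport T q (u * k) - (fderiv ℝ (T u) q).comp (transport T q k)‖
      ≤ K * K * ‖T u⁻¹ q - q‖ := by
  have hK := h.pos_K
  have hq' : q ∈ Metric.ball x₀ r := Metric.ball_subset_ball h.δ_le hq
  have hw : T k⁻¹ q ∈ Metric.ball x₀ r := h.maps _ (hsub (hinv k hk)) _ hq
  have hqk : T k (T k⁻¹ q) = q := by
    rw [← h.mul k (hsub hk) _ (hsub (hinv k hk)) q hq', mul_inv_cancel, h.one q hq']
  have h1 : fderiv ℝ (T (u * k)) (T k⁻¹ q) = (fderiv ℝ (T u) q).comp (transport T q k) := by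
    have e : T (u * k) =ᶠ[𝓝 (T k⁻¹ q)] T u ∘ T k := by
      filter_upwards [Metric.isOpen_ball.mem_nhds hw] with z hz using
        h.mul u (hsub hu) k (hsub hk) z hz
    rw [e.fderiv_eq, fderiv_comp _ (by rw [hqk]; exact (h.c11 u (hsub hu)).diff _ hq')
      ((h.c11 k (hsub hk)).diff _ hw), hqk, transport]
  rw [← h1, transport, mul_inv_rev]
  have hu' : T u⁻¹ q ∈ Metric.ball x₀ r := h.maps _ (hsub (hinv u hu)) _ hq
  rw [h.mul _ (hsub (hinv k hk)) _ (hsub (hinv u hu)) q hq']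
  have hw' : T k⁻¹ (T u⁻¹ q) ∈ Metric.ball x₀ r := by
    rw [← h.mul _ (hsub (hinv k hk)) _ (hsub (hinv u hu)) q hq']
    exact h.maps _ (hmulN _ (hinv k hk) _ (hinv u hu)) _ hq
  refine ((h.c11 _ (hsub huk)).lip _ hw' _ hw).trans ?_
  rw [mul_assoc]
  gcongr
  exact (h.c11 _ (hsub (hinv k hk))).norm_sub_le (convex_ball _ _) hu' hq'

variable [T2Space G] [MeasurableSpace G] [BorelSpace G] {μ : Measure G}
  [IsFiniteMeasureOnCompacts μ] {m ρ : G → ℝ} {C : ℝ} {S N₂ : Set G}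
  (hρ : IsAveragingKernel μ m ρ C S N₂) (hN₂ : N₂ ⊆ N₁)

include hN₁ hρ hN₂

theorem integrable_average {z : E} (hz : z ∈ Metric.ball x₀ δ) :
    Integrable (fun k ↦ ρ k • transport T q k (T k⁻¹ z)) μ := by
  have hz' : z ∈ Metric.ball x₀ r := Metric.ball_subset_ball h.δ_le hz
  have hq' : q ∈ Metric.ball x₀ r := Metric.ball_subset_ball h.δ_le hq
  have hc : ContinuousOn (fun k ↦ ρ k • transport T q k (T k⁻¹ z)) (tsupport ρ) := by
    intro k hk
    have hk1 : k ∈ N₁ := hN₂ (hρ.tsupport_subset hk)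
    refine ContinuousAt.continuousWithinAt ?_
    refine hρ.continuous.continuousAt.smul ?_
    have c1 : ∀ w ∈ Metric.ball x₀ r, ContinuousAt (fun k : G ↦ T k⁻¹ w) k := fun w hw ↦
      ContinuousAt.comp (f := fun k : G ↦ (k⁻¹, w)) (h.cont _ (hsub (hinv k hk1)) w hw)
        (by fun_prop)
    have c2 := h.continuousAt_fderiv_apply (v := T k⁻¹ z)
      (mem_of_superset (hN₁.mem_nhds hk1) hsub) (h.maps _ (hsub (hinv k hk1)) _ hq)
    exact ContinuousAt.comp (f := fun k : G ↦ (k, T k⁻¹ q, T k⁻¹ z)) c2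
      (continuousAt_id.prodMk ((c1 q hq').prodMk (c1 z hz')))
  have hi := hc.integrableOn_compact (μ := μ) hρ.hasCompactSupport
  rwa [integrableOn_iff_integrable_of_support_subset] at hi
  intro k hk
  by_contra hk'
  exact hk (by simp [image_eq_zero_of_notMem_tsupport hk'])

/-- The averaging map is close to the identity, up to second order differences. -/
theorem average_four_point [CompleteSpace E] {ε : ℝ} (hε : K * K * (3 * ε) ≤ 1 / 2)
    (hεδ : Metric.ball q (3 * ε) ⊆ Metric.ball x₀ δ) {a b a' b' : E}
    (ha : a ∈ Metric.ball q ε) (hb : b ∈ Metric.ball q ε) (ha' : a' ∈ Metric.ball q ε)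
    (hb' : b' ∈ Metric.ball q ε) :
    ‖average μ ρ T q a - average μ ρ T q b - (average μ ρ T q a' - average μ ρ T q b')
        - (a - b - (a' - b'))‖
      ≤ 1 / 2 * ‖a - b - (a' - b')‖ + K * K * ‖a' - b'‖ * ‖b - b'‖ := by
  have hK := h.pos_K
  have hε0 : 0 < ε := dist_nonneg.trans_lt (Metric.mem_ball.1 ha)
  have hs : Metric.ball q ε ⊆ Metric.ball x₀ δ :=
    (Metric.ball_subset_ball (by linarith)).trans hεδ
  have I := fun z (hz : z ∈ Metric.ball q ε) ↦
    h.integrable_average hN₁ hinv hsub hq hρ hN₂ (hs hz)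
  set w := a - b - (a' - b') with hw
  have hρi : Integrable ρ μ := hρ.continuous.integrable_of_hasCompactSupport hρ.hasCompactSupport
  have e1 : w = ∫ k, ρ k • w ∂μ := by
    rw [integral_smul_const, hρ.integral_eq_one, one_smul]
  have e2 : average μ ρ T q a - average μ ρ T q b - (average μ ρ T q a' - average μ ρ T q b') - w
      = ∫ k, (ρ k • transport T q k (T k⁻¹ a) - ρ k • transport T q k (T k⁻¹ b)
        - (ρ k • transport T q k (T k⁻¹ a') - ρ k • transport T q k (T k⁻¹ b')) - ρ k • w) ∂μ := by
    have I1 : Integrable (fun k ↦ ρ k • transport T q k (T k⁻¹ a)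
      - ρ k • transport T q k (T k⁻¹ b)) μ := (I a ha).sub (I b hb)
    have I2 : Integrable (fun k ↦ ρ k • transport T q k (T k⁻¹ a')
      - ρ k • transport T q k (T k⁻¹ b')) μ := (I a' ha').sub (I b' hb')
    have I3 : Integrable (fun k ↦ ρ k • transport T q k (T k⁻¹ a)
      - ρ k • transport T q k (T k⁻¹ b) - (ρ k • transport T q k (T k⁻¹ a')
      - ρ k • transport T q k (T k⁻¹ b'))) μ := I1.sub I2
    simp only [average]
    conv_lhs => rw [e1]
    rw [← integral_sub (I a ha) (I b hb), ← integral_sub (I a' ha') (I b' hb'),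
      ← integral_sub I1 I2, ← integral_sub I3 (hρi.smul_const w)]
  have e3 : (1 / 2 * ‖w‖ + K * K * ‖a' - b'‖ * ‖b - b'‖)
      = ∫ k, ρ k * (1 / 2 * ‖w‖ + K * K * ‖a' - b'‖ * ‖b - b'‖) ∂μ := by
    rw [integral_mul_const, hρ.integral_eq_one, one_mul]
  rw [e2, e3]
  refine norm_integral_le_of_norm_le (hρi.mul_const _) (Eventually.of_forall fun k ↦ ?_)
  by_cases hk : k ∈ tsupport ρ
  swap
  · simp [image_eq_zero_of_notMem_tsupport hk]
  have hk1 : k ∈ N₁ := hN₂ (hρ.tsupport_subset hk)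
  -- By `transport_comp`, `w` is the transport of `fderiv ℝ (T k⁻¹) q w`, so the integrand becomes a
  -- transported linearization error of `T k⁻¹` at `q`.
  have e4 : ρ k • transport T q k (T k⁻¹ a) - ρ k • transport T q k (T k⁻¹ b)
        - (ρ k • transport T q k (T k⁻¹ a') - ρ k • transport T q k (T k⁻¹ b')) - ρ k • w
      = ρ k • transport T q k (T k⁻¹ a - T k⁻¹ b - (T k⁻¹ a' - T k⁻¹ b')
        - fderiv ℝ (T k⁻¹) q w) := by
    rw [map_sub (transport T q k) _ (fderiv ℝ (T k⁻¹) q w),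
      h.transport_comp hinv hsub hq hk1]
    simp only [map_sub, smul_sub]
  rw [e4, norm_smul, Real.norm_of_nonneg (hρ.nonneg k)]
  refine mul_le_mul_of_nonneg_left ?_ (hρ.nonneg k)
  have e5 := ((h.c11 _ (hsub (hinv k hk1))).mono
    (hεδ.trans (Metric.ball_subset_ball h.δ_le))).four_point_fderiv hK.le ha hb ha' hb'
  calc _ ≤ K * (K * (3 * ε) * ‖w‖ + K * ‖a' - b'‖ * ‖b - b'‖) :=
        (ContinuousLinearMap.le_opNorm _ _).trans (mul_le_mul
          (h.norm_transport_le hinv hsub hq hk1) e5 (norm_nonneg _) hK.le)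
    _ = K * K * (3 * ε) * ‖w‖ + K * K * ‖a' - b'‖ * ‖b - b'‖ := by ring
    _ ≤ _ := by gcongr

end

end UniformLocalAction

end BanachChains

/-! ### Translating the argument of the averaging map -/

namespace BanachChains

open MeasureTheory

theorem exists_open_symm_mul_subset {G : Type*} [Group G] [TopologicalSpace G]
    [IsTopologicalGroup G] {M : Set G} (hM : M ∈ 𝓝 (1 : G)) :
    ∃ V : Set G, IsOpen V ∧ 1 ∈ V ∧ (∀ g ∈ V, g⁻¹ ∈ V) ∧ (∀ g ∈ V, ∀ k ∈ V, g * k ∈ M) ∧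
      V ⊆ M := by
  obtain ⟨V, hVo, h1V, hV⟩ := exists_open_nhds_one_mul_subset hM
  have hV' : ∀ g ∈ V, ∀ k ∈ V, g * k ∈ M := fun g hg k hk ↦ hV (mul_mem_mul hg hk)
  refine ⟨V ∩ V⁻¹, hVo.inter hVo.inv, ⟨h1V, by simpa using h1V⟩,
    fun g hg ↦ ⟨hg.2, by simpa using hg.1⟩, fun g hg k hk ↦ hV' g hg.1 k hk.1, fun g hg ↦ ?_⟩
  simpa using hV' g hg.1 1 h1V

/-- On a countably generated filter, failure of the uniform bound is witnessed by a sequence, to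
which the usual theorem applies; its finitely many initial terms are absorbed in the pointwise
constants. -/
theorem banach_steinhaus_filter {α E F : Type*} [NormedAddCommGroup E] [NormedSpace ℝ E]
    [CompleteSpace E] [NormedAddCommGroup F] [NormedSpace ℝ F] {l : Filter α}
    [l.IsCountablyGenerated] {B : α → E →L[ℝ] F} (h : ∀ v, ∃ C, ∀ᶠ a in l, ‖B a v‖ ≤ C) :
    ∃ C, ∀ᶠ a in l, ‖B a‖ ≤ C := by
  by_contra hcon
  push Not at hcon
  obtain ⟨s, hs⟩ := l.exists_antitone_basis
  have hex : ∀ n : ℕ, ∃ a ∈ s n, (n : ℝ) < ‖B a‖ := fun n ↦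
    ((hcon n).and_eventually (hs.mem n)).exists.imp fun a ha ↦ ⟨ha.2, ha.1⟩
  choose a has haB using hex
  have ha : Tendsto a atTop l := hs.tendsto has
  obtain ⟨C, hC⟩ := banach_steinhaus (g := fun n ↦ B (a n)) fun v ↦ by
    obtain ⟨C, hC⟩ := h v
    obtain ⟨n₀, hn₀⟩ := eventually_atTop.1 (ha.eventually hC)
    refine ⟨max C 0 + ∑ i ∈ Finset.range n₀, ‖B (a i) v‖, fun n ↦ ?_⟩
    rcases le_or_gt n₀ n with hn | hn
    · have : 0 ≤ ∑ i ∈ Finset.range n₀, ‖B (a i) v‖ := by positivity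
      linarith [hn₀ n hn, le_max_left C 0]
    · have := Finset.single_le_sum (f := fun i ↦ ‖B (a i) v‖) (fun i _ ↦ norm_nonneg _)
        (Finset.mem_range.2 hn)
      linarith [le_max_right C 0]
  obtain ⟨n, hn⟩ := exists_nat_gt C
  linarith [hC n, haB n]

namespace UniformLocalAction

variable {G : Type*} [Group G] [TopologicalSpace G] [IsTopologicalGroup G]
  {E : Type*} [NormedAddCommGroup E] [NormedSpace ℝ E] {T : G → E → E} {x₀ : E}
  {K r δ : ℝ} {N N₁ : Set G}

variable (h : UniformLocalAction T x₀ K r δ N) (hN₁ : IsOpen N₁) (hinv : ∀ g ∈ N₁, g⁻¹ ∈ N₁)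
  (hmulN : ∀ g ∈ N₁, ∀ k ∈ N₁, g * k ∈ N) (hsub : N₁ ⊆ N) {q : E} (hq : q ∈ Metric.ball x₀ δ)
  [T2Space G] [MeasurableSpace G] [BorelSpace G] {μ : Measure G}
  [IsFiniteMeasureOnCompacts μ] {m ρ : G → ℝ} {C : ℝ} {S N₂ : Set G}
  (hρ : IsAveragingKernel μ m ρ C S N₂) (hN₂ : N₂ ⊆ N₁)

include h hN₁ hinv hmulN hsub hq hρ hN₂ in
/-- Moving the argument of the averaging map by `u` amounts to applying the derivative of `T u`,
up to an error controlled by the gauge `m u`. -/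
theorem exists_average_remainder [CompleteSpace E] [μ.IsMulLeftInvariant] (hN₂o : N₂ ∈ 𝓝 (1 : G))
    (hinv₂ : ∀ g ∈ N₂, g⁻¹ ∈ N₂) (hmul₂ : ∀ g ∈ N₂, ∀ k ∈ N₂, g * k ∈ N₁) {Cq : ℝ}
    (hCq : ∀ᶠ u in 𝓝 (1 : G), ‖T u⁻¹ q - q‖ ≤ Cq * m u) (hm : ∀ u, 0 ≤ m u) :
    ∃ C', 0 ≤ C' ∧ ∀ᶠ u in 𝓝 (1 : G),
      ∀ z ∈ Metric.ball x₀ δ, T u z ∈ Metric.ball x₀ δ →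
      ∀ z' ∈ Metric.ball x₀ δ, T u z' ∈ Metric.ball x₀ δ →
      ‖average μ ρ T q (T u z) - fderiv ℝ (T u) q (average μ ρ T q z)‖ ≤ C' * m u ∧
      ‖average μ ρ T q (T u z) - fderiv ℝ (T u) q (average μ ρ T q z)
        - (average μ ρ T q (T u z') - fderiv ℝ (T u) q (average μ ρ T q z'))‖
        ≤ C' * m u * ‖z - z'‖ := by
  have hK := h.pos_K
  have hC := hρ.C_nonneg
  obtain ⟨B, hB⟩ := hρ.continuous.bounded_above_of_compact_support hρ.hasCompactSupport
  have hB0 : 0 ≤ B := (norm_nonneg _).trans (hB 1)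
  set M := C * K + B * (K * K * |Cq|) with hM
  have hM0 : 0 ≤ M := by positivity
  have hr : 0 < r := h.pos_δ.trans_le h.δ_le
  obtain ⟨L, hL1, hL2⟩ : ∃ L, ‖x₀‖ + r ≤ L ∧ K ≤ L :=
    ⟨‖x₀‖ + r + K, by linarith, by linarith [norm_nonneg x₀]⟩
  have hL0 : 0 ≤ L := hK.le.trans hL2
  refine ⟨M * L * μ.real S, by positivity, ?_⟩
  have h1S := hρ.translate.self_of_nhds
  filter_upwards [hρ.translate, hCq, hN₂o] with u hu huq huN z hz huz z' hz' huz'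
  have hmu := hm u
  -- After the substitution `k ↦ u * k` the remainder is the integral of `Ξ k (T k⁻¹ z)`. The
  -- operators `Ξ k` do not depend on `z`, so bounding them gives both the size and the Lipschitz
  -- estimate.
  let Ξ : G → E →L[ℝ] E := fun k ↦ ρ (u * k) • transport T q (u * k)
    - ρ k • (fderiv ℝ (T u) q).comp (transport T q k)
  have hsupp : ∀ k, k ∉ N₁ → ρ k = 0 ∧ ρ (u * k) = 0 := by
    refine fun k hk ↦ ⟨image_eq_zero_of_notMem_tsupport fun hk' ↦
      hk (hN₂ (hρ.tsupport_subset hk')), image_eq_zero_of_notMem_tsupport fun hk' ↦ hk ?_⟩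
    simpa using hmul₂ _ (hinv₂ u huN) _ (hρ.tsupport_subset hk')
  have hΞ0 : ∀ k, k ∉ S → Ξ k = 0 := fun k hk ↦ by
    have e1 := (hu k).2 hk
    have e2 := (h1S k).2 hk
    rw [one_mul] at e2
    simp [Ξ, e1, e2]
  have hΞN : ∀ k, k ∉ N₁ → Ξ k = 0 := fun k hk ↦ by simp [Ξ, hsupp k hk]
  have hΞ : ∀ k, ‖Ξ k‖ ≤ M * m u := by
    intro k
    by_cases hz : ρ k = 0 ∧ ρ (u * k) = 0
    · have : Ξ k = 0 := by simp [Ξ, hz]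
      rw [this, norm_zero]; positivity
    have hk : k ∈ N₁ := by
      by_contra hk
      exact hz (hsupp k hk)
    have huk : u * k ∈ N₁ := by
      by_cases h0 : ρ (u * k) = 0
      · have : k ∈ tsupport ρ := by
          by_contra hk'
          exact hz ⟨image_eq_zero_of_notMem_tsupport hk', h0⟩
        exact hmul₂ u huN k (hρ.tsupport_subset this)
      · exact hN₂ (hρ.tsupport_subset (subset_tsupport _ h0))
    -- Two sources of error: the bump function is translated, and the transport is multiplicative
    -- only approximately. Each is of order `m u`.
    have e : Ξ k = (ρ (u * k) - ρ k) • transport T q (u * k)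
        + ρ k • (transport T q (u * k) - (fderiv ℝ (T u) q).comp (transport T q k)) := by
      simp only [Ξ, sub_smul, smul_sub]; abel
    have e1 := h.norm_transport_le hinv hsub hq huk
    have e2 := h.norm_transport_sub_le hinv hmulN hsub hq (hN₂ huN) hk huk
    have e3 : K * K * ‖T u⁻¹ q - q‖ ≤ K * K * |Cq| * m u := by
      rw [mul_assoc _ _ (m u)]
      gcongr
      exact huq.trans (by gcongr; exact le_abs_self _)
    rw [e]
    refine (norm_add_le _ _).trans ?_
    rw [norm_smul, norm_smul]
    calc _ ≤ C * m u * K + B * (K * K * |Cq| * m u) := by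
          gcongr
          · exact (hu k).1
          · exact hB k
          · exact e2.trans e3
      _ = _ := by rw [hM]; ring
  have hrem : ∀ z ∈ Metric.ball x₀ δ, T u z ∈ Metric.ball x₀ δ →
      Integrable (fun k ↦ Ξ k (T k⁻¹ z)) μ ∧
      average μ ρ T q (T u z) - fderiv ℝ (T u) q (average μ ρ T q z) = ∫ k, Ξ k (T k⁻¹ z) ∂μ := by
    intro z hz huz
    have hz' : z ∈ Metric.ball x₀ r := Metric.ball_subset_ball h.δ_le hz
    have i1 := h.integrable_average hN₁ hinv hsub hq hρ hN₂ huz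
    have i2 := h.integrable_average hN₁ hinv hsub hq hρ hN₂ hz
    have i1' := i1.comp_mul_left u
    have i2' := (fderiv ℝ (T u) q).integrable_comp i2
    -- Left invariance of the measure; then `u` disappears from the argument because `(u * k)⁻¹ * u
    -- = k⁻¹`.
    have e1 : average μ ρ T q (T u z)
        = ∫ k, ρ (u * k) • transport T q (u * k) (T (u * k)⁻¹ (T u z)) ∂μ :=
      (integral_mul_left_eq_self _ u).symm
    have e2 : fderiv ℝ (T u) q (average μ ρ T q z)
        = ∫ k, fderiv ℝ (T u) q (ρ k • transport T q k (T k⁻¹ z)) ∂μ :=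
      ((fderiv ℝ (T u) q).integral_comp_comm i2).symm
    have e3 : ∀ k, ρ (u * k) • transport T q (u * k) (T (u * k)⁻¹ (T u z))
        - fderiv ℝ (T u) q (ρ k • transport T q k (T k⁻¹ z)) = Ξ k (T k⁻¹ z) := by
      intro k
      by_cases h0 : ρ (u * k) = 0
      · simp [Ξ, h0]
      have huk : u * k ∈ N₂ := hρ.tsupport_subset (subset_tsupport _ h0)
      have : T (u * k)⁻¹ (T u z) = T k⁻¹ z := by
        rw [← h.mul _ (hsub (hinv _ (hN₂ huk))) u (hsub (hN₂ huN)) z hz']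
        congr 1
        group
      rw [this]
      simp [Ξ]
    refine ⟨(i1'.sub i2').congr (Eventually.of_forall e3), ?_⟩
    rw [e1, e2, ← integral_sub i1' i2']
    exact integral_congr_ae (Eventually.of_forall e3)
  have hint : ∀ (f : G → E) (c : ℝ), (∀ k ∈ N₁, ‖f k‖ ≤ c) → 0 ≤ c →
      ‖∫ k, Ξ k (f k) ∂μ‖ ≤ M * m u * c * μ.real S := by
    intro f c hf hc
    have hSm := hρ.isCompact.measurableSet
    have e : M * m u * c * μ.real S = ∫ k, S.indicator (fun _ ↦ M * m u * c) k ∂μ := by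
      rw [integral_indicator_const _ hSm, smul_eq_mul, mul_comm]
    rw [e]
    refine norm_integral_le_of_norm_le ?_ (Eventually.of_forall fun k ↦ ?_)
    · exact (integrable_indicator_iff hSm).2
        (integrableOn_const (hρ.isCompact.measure_lt_top.ne))
    · by_cases hk : k ∈ S
      · rw [indicator_of_mem hk]
        by_cases hk1 : k ∈ N₁
        · exact (ContinuousLinearMap.le_opNorm _ _).trans
            (mul_le_mul (hΞ k) (hf k hk1) (norm_nonneg _) (by positivity))
        · rw [hΞN k hk1]; simp; positivity
      · rw [indicator_of_notMem hk, hΞ0 k hk]; simp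
  have hμS : 0 ≤ μ.real S := measureReal_nonneg
  have hsubδ : Metric.ball x₀ δ ⊆ Metric.ball x₀ r := Metric.ball_subset_ball h.δ_le
  constructor
  · rw [(hrem z hz huz).2]
    refine (hint _ (‖x₀‖ + r) (fun k hk ↦ ?_) (by positivity)).trans ?_
    · have := mem_ball_iff_norm.1 (h.maps _ (hsub (hinv k hk)) z hz)
      calc ‖T k⁻¹ z‖ = ‖x₀ + (T k⁻¹ z - x₀)‖ := by congr 1; abel
        _ ≤ ‖x₀‖ + r := (norm_add_le _ _).trans (by linarith)
    · calc M * m u * (‖x₀‖ + r) * μ.real S = M * (‖x₀‖ + r) * μ.real S * m u := by ring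
        _ ≤ _ := by gcongr
  · rw [(hrem z hz huz).2, (hrem z' hz' huz').2,
      ← integral_sub (hrem z hz huz).1 (hrem z' hz' huz').1]
    simp only [← map_sub]
    refine (hint (fun k ↦ T k⁻¹ z - T k⁻¹ z') (K * ‖z - z'‖) (fun k hk ↦ ?_)
      (by positivity)).trans ?_
    · exact (h.c11 _ (hsub (hinv k hk))).norm_sub_le (convex_ball _ _) (hsubδ hz) (hsubδ hz')
    · calc M * m u * (K * ‖z - z'‖) * μ.real S = M * K * μ.real S * m u * ‖z - z'‖ := by ring
        _ ≤ _ := by gcongr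

end UniformLocalAction

end BanachChains

/-! ### Uniform Lipschitz estimates for the orbit maps -/

namespace BanachChains

open MeasureTheory

namespace LocalAction

open UniformLocalAction

variable {G : Type*} [Group G] [TopologicalSpace G] [IsTopologicalGroup G] [T2Space G]
  [LocallyCompactSpace G] [FirstCountableTopology G] [MeasurableSpace G] [BorelSpace G]
  {E F : Type*} [NormedAddCommGroup E] [NormedSpace ℝ E] [CompleteSpace E]
  [NormedAddCommGroup F] [NormedSpace ℝ F] [CompleteSpace F]
  {T : G → E → E} {S : G → F → F} {x₀ : E} {ι : E →L[ℝ] F}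

/-- Let `ι` intertwine the local actions `T` on `E` and `S` on `F`. If the orbit maps of `T` are
Lipschitz at `1` as maps into `F`, and for a dense set of points also as maps into `E`, then
they are Lipschitz as maps into `F` locally uniformly, in the `C^1` sense, in the point. -/
theorem exists_lipschitz_orbits (hT : LocalAction T x₀) (hS : LocalAction S (ι x₀))
    (hι : ∀ᶠ p : G × E in 𝓝 (1, x₀), ι (T p.1 p.2) = S p.1 (ι p.2))
    (μ : Measure G) [μ.IsMulLeftInvariant] [IsFiniteMeasureOnCompacts μ] {m : G → ℝ}
    (hm0 : ∀ u, 0 ≤ m u) (hm : ∀ᶠ u in 𝓝 (1 : G), m u = 0 → u = 1)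
    (hker : ∀ N ∈ 𝓝 (1 : G), ∃ ρ C A, IsAveragingKernel μ m ρ C A N)
    (horb : ∀ᶠ z in 𝓝 x₀, ∃ C, ∀ᶠ u in 𝓝 (1 : G), ‖ι (T u z) - ι z‖ ≤ C * m u)
    (hsm : ∃ᶠ q in 𝓝 x₀, ∃ C, ∀ᶠ u in 𝓝 (1 : G), ‖T u⁻¹ q - q‖ ≤ C * m u) :
    ∃ C, ∃ r > 0, ∀ᶠ u in 𝓝 (1 : G), ∀ z ∈ Metric.ball x₀ r, ∀ z' ∈ Metric.ball x₀ r,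
      ‖ι (T u z) - ι z‖ ≤ C * m u ∧
      ‖ι (T u z) - ι z - (ι (T u z') - ι z')‖ ≤ C * m u * ‖z - z'‖ := by
  obtain ⟨K, r, δ, N, hN, hU⟩ := hT.exists_uniformLocalAction
  obtain ⟨K', r', δ', N', hN', hU'⟩ := hS.exists_uniformLocalAction
  have hK := hU.pos_K
  have hK' := hU'.pos_K
  have hδ := hU.pos_δ
  have hδ' := hU'.pos_δ
  -- neighbourhoods on which `ι` intertwines the actions
  obtain ⟨M₁, hM₁, r₁, hr₁, h1⟩ : ∃ M ∈ 𝓝 (1 : G), ∃ r > 0, ∀ g ∈ M, ∀ z ∈ Metric.ball x₀ r,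
      ι (T g z) = S g (ι z) := by
    rw [nhds_prod_eq] at hι
    obtain ⟨a, ha, b, hb, hab⟩ := eventually_prod_iff.1 hι
    obtain ⟨r, hr, hball⟩ := Metric.eventually_nhds_iff_ball.1 hb
    exact ⟨_, ha, r, hr, fun g hg z hz ↦ hab hg (hball z hz)⟩
  obtain ⟨M₂, hM₂, r₂, hr₂, h2⟩ : ∃ M ∈ 𝓝 (1 : G), ∃ r > 0, ∀ g ∈ M, ∀ z ∈ Metric.ball x₀ r,
      T g z ∈ Metric.ball x₀ r₁ := by
    have := hT.tendsto.eventually (Metric.ball_mem_nhds x₀ hr₁)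
    rw [nhds_prod_eq] at this
    obtain ⟨a, ha, b, hb, hab⟩ := eventually_prod_iff.1 this
    obtain ⟨r, hr, hball⟩ := Metric.eventually_nhds_iff_ball.1 hb
    exact ⟨_, ha, r, hr, fun g hg z hz ↦ hab hg (hball z hz)⟩
  obtain ⟨N₁, hN₁o, h1N₁, hinv, hmulN, hN₁⟩ := exists_open_symm_mul_subset
    (inter_mem (inter_mem hN hN') (inter_mem hM₁ hM₂))
  obtain ⟨N₂, hN₂o, h1N₂, hinv₂, hmul₂, hN₂⟩ := exists_open_symm_mul_subset (hN₁o.mem_nhds h1N₁)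
  obtain ⟨ρ, Cρ, A, hρ⟩ := hker N₂ (hN₂o.mem_nhds h1N₂)
  replace hU := hU.mono_set (N₁ := N ∩ N' ∩ (M₁ ∩ M₂)) fun _ h ↦ h.1.1
  replace hU' := hU'.mono_set (N₁ := N ∩ N' ∩ (M₁ ∩ M₂)) fun _ h ↦ h.1.2
  -- the radii
  obtain ⟨δ₀, hδ₀, hδ₀δ, hδ₀1, hδ₀2⟩ : ∃ d > 0, d ≤ δ ∧ d ≤ r₁ ∧ d ≤ r₂ :=
    ⟨min δ (min r₁ r₂), lt_min hδ (lt_min hr₁ hr₂), min_le_left _ _,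
      (min_le_right _ _).trans (min_le_left _ _), (min_le_right _ _).trans (min_le_right _ _)⟩
  obtain ⟨ε', hε'0, hε'1, hε'2⟩ : ∃ e > 0, e ≤ δ' / 6 ∧ K' * K' * (3 * e) ≤ 1 / 2 := by
    refine ⟨min (δ' / 6) (1 / (6 * (K' * K'))), by positivity, min_le_left _ _, ?_⟩
    calc _ ≤ K' * K' * (3 * (1 / (6 * (K' * K')))) := by gcongr; exact min_le_right _ _
      _ = 1 / 2 := by field_simp; norm_num
  obtain ⟨ε, hε0, hε1, hε2, hε3⟩ : ∃ e > 0, e ≤ δ₀ / 6 ∧ K * K * (3 * e) ≤ 1 / 2 ∧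
      ‖ι‖ * e ≤ ε' := by
    refine ⟨min (δ₀ / 6) (min (1 / (6 * (K * K))) (ε' / (‖ι‖ + 1))), by positivity,
      min_le_left _ _, ?_, ?_⟩
    · calc _ ≤ K * K * (3 * (1 / (6 * (K * K)))) := by
            gcongr; exact (min_le_right _ _).trans (min_le_left _ _)
        _ = 1 / 2 := by field_simp; norm_num
    · calc _ ≤ ‖ι‖ * (ε' / (‖ι‖ + 1)) := by
            gcongr; exact (min_le_right _ _).trans (min_le_right _ _)
        _ ≤ (‖ι‖ + 1) * (ε' / (‖ι‖ + 1)) := by gcongr; linarith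
        _ = ε' := by field_simp
  obtain ⟨η, hη, hηε, hηT, hηo⟩ : ∃ η > 0, η ≤ ε / 4 ∧
      (∀ᶠ u in 𝓝 (1 : G), ∀ z ∈ Metric.ball x₀ η, T u z ∈ Metric.ball x₀ (ε / 2)) ∧
      ∀ z ∈ Metric.ball x₀ η, ∃ C, ∀ᶠ u in 𝓝 (1 : G), ‖ι (T u z) - ι z‖ ≤ C * m u := by
    have := hT.tendsto.eventually (Metric.ball_mem_nhds x₀ (half_pos hε0))
    rw [nhds_prod_eq] at this
    obtain ⟨a, ha, b, hb, hab⟩ := eventually_prod_iff.1 this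
    obtain ⟨η, hη, hball⟩ := Metric.eventually_nhds_iff_ball.1 (hb.and horb)
    refine ⟨min η (ε / 4), by positivity, min_le_right _ _, ha.mono fun u hu z hz ↦
      hab hu (hball z (Metric.ball_subset_ball (min_le_left _ _) hz)).1, fun z hz ↦
      (hball z (Metric.ball_subset_ball (min_le_left _ _) hz)).2⟩
  -- The averages are centred not at `x₀` but at a nearby point whose orbit map is Lipschitz already
  -- into `E`, as the remainder estimate demands.
  obtain ⟨q, ⟨Cq, hCq⟩, hqη⟩ := (hsm.and_eventually (Metric.ball_mem_nhds x₀ hη)).exists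
  have hqη' := Metric.mem_ball.1 hqη
  have hqx : ∀ {c z}, z ∈ Metric.ball x₀ c → z ∈ Metric.ball q (c + η) := fun {c z} hz ↦ by
    rw [Metric.mem_ball] at *
    linarith [dist_triangle_right z q x₀]
  have hxq : ∀ {c z}, z ∈ Metric.ball q c → z ∈ Metric.ball x₀ (c + η) := fun {c z} hz ↦ by
    rw [Metric.mem_ball] at *
    linarith [dist_triangle z q x₀]
  have hD : Metric.ball x₀ η ⊆ Metric.ball q ε := fun z hz ↦
    Metric.ball_subset_ball (by linarith) (hqx hz)
  have hTD : ∀ᶠ u in 𝓝 (1 : G), ∀ z ∈ Metric.ball x₀ η, T u z ∈ Metric.ball q ε :=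
    hηT.mono fun u hu z hz ↦ Metric.ball_subset_ball (by linarith) (hqx (hu z hz))
  have h3ε : Metric.ball q (3 * ε) ⊆ Metric.ball x₀ δ₀ := fun z hz ↦
    Metric.ball_subset_ball (by linarith) (hxq hz)
  have hεδ₀ : Metric.ball q ε ⊆ Metric.ball x₀ δ₀ :=
    (Metric.ball_subset_ball (by linarith)).trans h3ε
  have hδ₀δ' : Metric.ball x₀ δ₀ ⊆ Metric.ball x₀ δ := Metric.ball_subset_ball hδ₀δ
  have hqε : q ∈ Metric.ball q ε := Metric.mem_ball_self hε0
  have hq : q ∈ Metric.ball x₀ δ := hδ₀δ' (hεδ₀ hqε)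
  have hιball : ∀ z ∈ Metric.ball q ε, ι z ∈ Metric.ball (ι q) ε' := fun z hz ↦ by
    rw [mem_ball_iff_norm] at *
    rw [← map_sub]
    rcases (norm_nonneg ι).eq_or_lt with h0 | h0
    · have : ι = 0 := by simpa using h0.symm
      simpa [this] using hε'0
    · exact (ι.le_opNorm _).trans_lt ((mul_lt_mul_of_pos_left hz h0).trans_le hε3)
  have hιq : dist (ι q) (ι x₀) ≤ ε' := by
    rw [dist_eq_norm, ← map_sub]
    refine (ι.le_opNorm _).trans (le_trans ?_ hε3)
    gcongr
    rw [← dist_eq_norm]; linarith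
  have h3ε' : Metric.ball (ι q) (3 * ε') ⊆ Metric.ball (ι x₀) δ' := fun z hz ↦ by
    rw [Metric.mem_ball] at *
    linarith [dist_triangle z (ι q) (ι x₀)]
  have hιq' : ι q ∈ Metric.ball (ι x₀) δ' := h3ε' (Metric.mem_ball_self (by linarith))
  -- the averaging maps
  set a := UniformLocalAction.average μ ρ T q with ha
  set b := UniformLocalAction.average μ ρ S (ι q) with hb
  -- On the support of the kernel `ι` intertwines the maps and, by differentiation, the transports;
  -- it then passes through the integral.
  have hcomm : ∀ z ∈ Metric.ball q ε, ι (a z) = b (ι z) := by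
    intro z hz
    have hzδ := hεδ₀ hz
    rw [ha, hb, UniformLocalAction.average, UniformLocalAction.average, ← ι.integral_comp_comm
      (hU.integrable_average hN₁o hinv hN₁ hq hρ hN₂ (hδ₀δ' hzδ))]
    refine integral_congr_ae (Eventually.of_forall fun k ↦ ?_)
    by_cases hk : k ∈ tsupport ρ
    swap
    · simp [image_eq_zero_of_notMem_tsupport hk]
    have hk1 : k ∈ N₁ := hN₂ (hρ.tsupport_subset hk)
    have hkM := (hN₁ hk1).2
    have hkM' := (hN₁ (hinv k hk1)).2
    have hb1 : ∀ w ∈ Metric.ball x₀ δ₀, ι (T k⁻¹ w) = S k⁻¹ (ι w) := fun w hw ↦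
      h1 _ hkM'.1 w (Metric.ball_subset_ball hδ₀1 hw)
    have hw : T k⁻¹ q ∈ Metric.ball x₀ r₁ :=
      h2 _ hkM'.2 q (Metric.ball_subset_ball hδ₀2 (hεδ₀ hqε))
    have hder : ι.comp (transport T q k) = (transport S (ι q) k).comp ι := by
      have e : ι ∘ T k =ᶠ[𝓝 (T k⁻¹ q)] S k ∘ ι := by
        filter_upwards [Metric.isOpen_ball.mem_nhds hw] with w hw using h1 k hkM.1 w hw
      have e1 : fderiv ℝ (ι ∘ T k) (T k⁻¹ q) = ι.comp (transport T q k) := by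
        rw [fderiv_comp _ ι.differentiableAt
          ((hU.c11 k (hN₁ hk1)).diff _ (hU.maps _ (hN₁ (hinv k hk1)) _ hq)), ι.fderiv, transport]
      have e2 : fderiv ℝ (S k ∘ ι) (T k⁻¹ q) = (transport S (ι q) k).comp ι := by
        have hd : DifferentiableAt ℝ (S k) (ι (T k⁻¹ q)) := by
          rw [hb1 q (hεδ₀ hqε)]
          exact (hU'.c11 k (hN₁ hk1)).diff _ (hU'.maps _ (hN₁ (hinv k hk1)) _ hιq')
        rw [fderiv_comp _ hd ι.differentiableAt, ι.fderiv, hb1 q (hεδ₀ hqε), transport]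
      rw [← e1, ← e2, e.fderiv_eq]
    have := DFunLike.congr_fun hder (T k⁻¹ z)
    simp only [ContinuousLinearMap.comp_apply] at this
    simp only [map_smul]
    rw [this, hb1 z hzδ]
  have hfa := fun {z₁ z₂ z₃ z₄ : E} ↦ hU.average_four_point hN₁o hinv hN₁ hq hρ hN₂ hε2
    (h3ε.trans hδ₀δ') (a := z₁) (b := z₂) (a' := z₃) (b' := z₄)
  have hfb := fun {z₁ z₂ z₃ z₄ : F} ↦ hU'.average_four_point hN₁o hinv hN₁ hιq' hρ hN₂ hε'2
    h3ε' (a := z₁) (b := z₂) (a' := z₃) (b' := z₄)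
  have ha2 : ∀ z ∈ Metric.ball q ε, ∀ z' ∈ Metric.ball q ε,
      ‖a z - a z' - (z - z')‖ ≤ 1 / 2 * ‖z - z'‖ := fun z hz z' hz' ↦ by
    simpa using hfa hz hz' hz' hz'
  have hb2 : ∀ z ∈ Metric.ball (ι q) ε', ∀ z' ∈ Metric.ball (ι q) ε',
      ‖b z - b z' - (z - z')‖ ≤ 1 / 2 * ‖z - z'‖ := fun z hz z' hz' ↦ by
    simpa using hfb hz hz' hz' hz'
  have ha3 : ∀ z ∈ Metric.ball q ε, ∀ z' ∈ Metric.ball q ε, ‖a z - a z'‖ ≤ 2 * ‖z - z'‖ :=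
    fun z hz z' hz' ↦ by
      have := norm_add_le (a z - a z' - (z - z')) (z - z')
      rw [sub_add_cancel] at this
      linarith [ha2 z hz z' hz', norm_nonneg (z - z')]
  have hb3 : ∀ z ∈ Metric.ball (ι q) ε', ∀ z' ∈ Metric.ball (ι q) ε',
      ‖b z - b z'‖ ≤ 2 * ‖z - z'‖ := fun z hz z' hz' ↦ by
    have := norm_add_le (b z - b z' - (z - z')) (z - z')
    rw [sub_add_cancel] at this
    linarith [hb2 z hz z' hz', norm_nonneg (z - z')]
  -- The map `a` approximates the identity with constant `1 / 2`, so its image contains an open set.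
  -- This turns information at the points `a z` into information about all vectors.
  have himage : a '' Metric.ball x₀ η ∈ 𝓝 (a q) := by
    have happ : ApproximatesLinearOn a ((ContinuousLinearEquiv.refl ℝ E : E ≃L[ℝ] E) : E →L[ℝ] E)
        (Metric.ball x₀ η) (1 / 2) := fun z hz z' hz' ↦ by
      simpa using ha2 z (hD hz) z' (hD hz')
    refine happ.image_mem_nhds (ContinuousLinearEquiv.refl ℝ E).toNonlinearRightInverse
      (Metric.isOpen_ball.mem_nhds hqη) ?_
    rcases subsingleton_or_nontrivial E with hE | hE
    · exact Or.inl hE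
    · right
      have : (ContinuousLinearEquiv.refl ℝ E).toNonlinearRightInverse.nnnorm = 1 := by
        change ‖((ContinuousLinearEquiv.refl ℝ E).symm : E →L[ℝ] E)‖₊ = 1
        have : ((ContinuousLinearEquiv.refl ℝ E).symm : E →L[ℝ] E)
            = ContinuousLinearMap.id ℝ E := rfl
        rw [this]
        exact NNReal.eq ContinuousLinearMap.norm_id
      rw [this, inv_one]
      exact NNReal.half_lt_self one_ne_zero
  obtain ⟨C₁, hC₁, hrem⟩ := hU.exists_average_remainder hN₁o hinv hmulN hN₁ hq hρ hN₂
    (hN₂o.mem_nhds h1N₂) hinv₂ hmul₂ hCq hm0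
  rw [← ha] at hrem
  set L : G → E →L[ℝ] E := fun u ↦ fderiv ℝ (T u) q with hL
  -- In the coordinate `a` the map `T u` acts as `L u` up to `O(m u)`. The goal is now to bound `B
  -- u` in operator norm by a multiple of `m u`.
  set B : G → E →L[ℝ] F := fun u ↦ ι.comp (L u - ContinuousLinearMap.id ℝ E) with hB
  have hBa : ∀ u z, z ∈ Metric.ball q ε → T u z ∈ Metric.ball q ε →
      B u (a z) = b (ι (T u z)) - b (ι z) - ι (a (T u z) - L u (a z)) := by
    intro u z hz hz'
    rw [← hcomm z hz, ← hcomm _ hz', hB]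
    simp
  have hBv : ∀ v, ∃ C, ∀ᶠ u in 𝓝 (1 : G), ‖B u v‖ ≤ C * m u := by
    have hBy : ∀ y ∈ a '' Metric.ball x₀ η, ∃ C, ∀ᶠ u in 𝓝 (1 : G), ‖B u y‖ ≤ C * m u := by
      rintro _ ⟨z, hz, rfl⟩
      obtain ⟨C, hC⟩ := hηo z hz
      refine ⟨2 * C + ‖ι‖ * C₁, ?_⟩
      filter_upwards [hC, hrem, hTD] with u hu hru hTu
      have e1 := (hru z (hδ₀δ' (hεδ₀ (hD hz))) (hδ₀δ' (hεδ₀ (hTu z hz))) z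
        (hδ₀δ' (hεδ₀ (hD hz))) (hδ₀δ' (hεδ₀ (hTu z hz)))).1
      rw [hBa u z (hD hz) (hTu z hz)]
      have e2 := hb3 _ (hιball _ (hTu z hz)) _ (hιball _ (hD hz))
      have e3 : ‖ι (a (T u z) - L u (a z))‖ ≤ ‖ι‖ * (C₁ * m u) :=
        (ι.le_opNorm _).trans (by gcongr)
      refine (norm_sub_le _ _).trans ?_
      linarith
    intro v
    -- An arbitrary vector is a multiple of a difference of two points in the open part of the image
    -- of `a`.
    have hlim : Tendsto (fun t : ℝ ↦ a q + t • v) (𝓝[>] 0) (𝓝 (a q)) :=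
      (Continuous.tendsto' (by fun_prop) _ _ (by simp)).mono_left nhdsWithin_le_nhds
    obtain ⟨t, ht, ht0⟩ := ((hlim.eventually himage).and self_mem_nhdsWithin).exists
    replace ht0 : 0 < t := ht0
    obtain ⟨c₁, hc₁⟩ := hBy _ ht
    obtain ⟨c₂, hc₂⟩ := hBy _ (mem_of_mem_nhds himage)
    refine ⟨t⁻¹ * (c₁ + c₂), ?_⟩
    filter_upwards [hc₁, hc₂] with u hu₁ hu₂
    have : B u v = t⁻¹ • (B u (a q + t • v) - B u (a q)) := by
      rw [map_add, add_sub_cancel_left, map_smul, inv_smul_smul₀ ht0.ne']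
    rw [this, norm_smul, norm_inv, Real.norm_of_nonneg ht0.le, mul_assoc]
    gcongr
    refine (norm_sub_le _ _).trans ?_
    linarith
  obtain ⟨C₂, hC₂⟩ : ∃ C, ∀ᶠ u in 𝓝 (1 : G), ‖B u‖ ≤ C * m u := by
    -- The quotients `(m u)⁻¹ • B u` are eventually bounded at each vector. Completeness of `E` and
    -- first countability of `G` make the bound uniform.
    obtain ⟨C, hC⟩ := banach_steinhaus_filter (l := 𝓝 (1 : G)) (B := fun u ↦ (m u)⁻¹ • B u)
      fun v ↦ by
        obtain ⟨C, hC⟩ := hBv v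
        refine ⟨max C 0, hC.mono fun u hu ↦ ?_⟩
        rw [smul_apply, norm_smul, norm_inv, Real.norm_of_nonneg (hm0 u)]
        rcases (hm0 u).eq_or_lt with h0 | h0
        · simp [← h0]
        · rw [inv_mul_le_iff₀ h0, mul_comm]
          exact hu.trans (by gcongr; exact le_max_left _ _)
    refine ⟨C, ?_⟩
    filter_upwards [hC, hm] with u hu hmu
    -- Where the gauge vanishes the quotient carries no information, but there `u = 1` and `B u =
    -- 0`.
    rcases (hm0 u).eq_or_lt with h0 | h0
    · have h1 : L 1 = ContinuousLinearMap.id ℝ E := by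
        have e : T 1 =ᶠ[𝓝 q] id := by
          filter_upwards [Metric.isOpen_ball.mem_nhds (Metric.ball_subset_ball hU.δ_le hq)]
            with z hz using hU.one z hz
        rw [hL]
        exact e.fderiv_eq.trans fderiv_id
      have : B u = 0 := by
        rw [hmu h0.symm, hB]; simp [h1]
      rw [this, ← h0]; simp
    · rw [norm_smul, norm_inv, Real.norm_of_nonneg (hm0 u), inv_mul_le_iff₀ h0] at hu
      linarith
  -- conclusion
  set D := ‖a q‖ + 2 * ε with hDdef
  have haD : ∀ z ∈ Metric.ball q ε, ‖a z‖ ≤ D := fun z hz ↦ by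
    have := ha3 z hz q hqε
    have h3 := mem_ball_iff_norm.1 hz
    have := norm_add_le (a z - a q) (a q)
    rw [sub_add_cancel] at this
    linarith
  have hD0 : 0 ≤ D := by positivity
  set X := 2 * (|C₂| * D + ‖ι‖ * C₁) with hX
  have hX0 : 0 ≤ X := by positivity
  refine ⟨X + 2 * (‖ι‖ * C₁ + |C₂| * 2 + K' * K' * X * ‖ι‖), η, hη, ?_⟩
  filter_upwards [hC₂, hrem, hTD] with u hu hru hTu z hz z' hz'
  have hmu := hm0 u
  have hu' : ‖B u‖ ≤ |C₂| * m u := hu.trans (by gcongr; exact le_abs_self _)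
  have hz1 := hD hz
  have hz1' := hD hz'
  have hR := hru z (hδ₀δ' (hεδ₀ (hD hz))) (hδ₀δ' (hεδ₀ (hTu z hz))) z'
        (hδ₀δ' (hεδ₀ (hD hz'))) (hδ₀δ' (hεδ₀ (hTu z' hz')))
  have hR' := (hru z' (hδ₀δ' (hεδ₀ (hD hz'))) (hδ₀δ' (hεδ₀ (hTu z' hz'))) z'
        (hδ₀δ' (hεδ₀ (hD hz'))) (hδ₀δ' (hεδ₀ (hTu z' hz')))).1
  have hfirst : ∀ w ∈ Metric.ball x₀ η, ‖a (T u w) - L u (a w)‖ ≤ C₁ * m u →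
      ‖ι (T u w) - ι w‖ ≤ X * m u := by
    intro w hw hRw
    -- Since `b` changes differences by at most half their norm, bounds on differences of `b`-values
    -- pull back with a factor `2`.
    have e1 := hb2 _ (hιball _ (hTu w hw)) _ (hιball _ (hD hw))
    have e2 : ‖b (ι (T u w)) - b (ι w)‖ ≤ (|C₂| * D + ‖ι‖ * C₁) * m u := by
      have e3 : b (ι (T u w)) - b (ι w) = B u (a w) + ι (a (T u w) - L u (a w)) := by
        rw [hBa u w (hD hw) (hTu w hw)]; abel
      rw [e3]
      refine (norm_add_le _ _).trans ?_
      have e4 : ‖B u (a w)‖ ≤ |C₂| * m u * D :=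
        ((B u).le_opNorm _).trans (mul_le_mul hu' (haD w (hD hw)) (norm_nonneg _) (by positivity))
      have e5 : ‖ι (a (T u w) - L u (a w))‖ ≤ ‖ι‖ * (C₁ * m u) :=
        (ι.le_opNorm _).trans (by gcongr)
      linarith
    have e6 := norm_sub_norm_le (ι (T u w) - ι w) (b (ι (T u w)) - b (ι w))
    rw [norm_sub_rev (ι (T u w) - ι w)] at e6
    rw [hX]
    linarith
  have hw1 := hfirst z hz hR.1
  have hw2 := hfirst z' hz' hR'
  have hY0 : 0 ≤ 2 * (‖ι‖ * C₁ + |C₂| * 2 + K' * K' * X * ‖ι‖) := by positivity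
  refine ⟨hw1.trans (mul_le_mul_of_nonneg_right (by linarith) hmu), ?_⟩
  -- The four-point estimate lets half of `‖w‖` be absorbed. Its quadratic term is a product of the
  -- displacement, of order `m u` by the first bound, and `‖ι z - ι z'‖`.
  have e1 := hfb (hιball _ (hTu z hz)) (hιball _ hz1) (hιball _ (hTu z' hz')) (hιball _ hz1')
  rw [← hb] at e1
  set w := ι (T u z) - ι z - (ι (T u z') - ι z') with hw
  set bw := b (ι (T u z)) - b (ι z) - (b (ι (T u z')) - b (ι z')) with hbw
  have e2 : ‖bw‖ ≤ (‖ι‖ * C₁ + |C₂| * 2) * m u * ‖z - z'‖ := by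
    have e3 : bw = B u (a z - a z') + ι (a (T u z) - L u (a z) - (a (T u z') - L u (a z'))) := by
      rw [map_sub (B u), map_sub ι (a (T u z) - L u (a z)), hBa u z hz1 (hTu z hz),
        hBa u z' hz1' (hTu z' hz'), hbw]
      abel
    rw [e3]
    refine (norm_add_le _ _).trans ?_
    have e4 : ‖B u (a z - a z')‖ ≤ |C₂| * m u * (2 * ‖z - z'‖) :=
      ((B u).le_opNorm _).trans (mul_le_mul hu' (ha3 z hz1 z' hz1') (norm_nonneg _)
        (by positivity))
    have e5 : ‖ι (a (T u z) - L u (a z) - (a (T u z') - L u (a z')))‖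
        ≤ ‖ι‖ * (C₁ * m u * ‖z - z'‖) := (ι.le_opNorm _).trans (by gcongr; exact hR.2)
    linarith
  have e6 : K' * K' * ‖ι (T u z') - ι z'‖ * ‖ι z - ι z'‖ ≤ K' * K' * (X * m u) * (‖ι‖ * ‖z - z'‖) := by
    gcongr
    rw [← map_sub]
    exact ι.le_opNorm _
  have e7 := norm_sub_norm_le w bw
  rw [norm_sub_rev w bw] at e7
  have e8 : ‖w‖ ≤ 2 * (‖ι‖ * C₁ + |C₂| * 2 + K' * K' * X * ‖ι‖) * m u * ‖z - z'‖ := by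
    linarith
  refine e8.trans ?_
  gcongr
  linarith

end LocalAction

end BanachChains

/-! ### Lie groups: the chart gauge and averaging kernels -/

namespace BanachChains

open MeasureTheory
open scoped Pointwise

set_option linter.unusedSectionVars false

theorem firstCountableTopology_of_chartedSpace (E : Type*) [NormedAddCommGroup E] (M : Type*)
    [TopologicalSpace M] [ChartedSpace E M] : FirstCountableTopology M := by
  refine ⟨fun x ↦ ?_⟩
  rw [← (chartAt E x).symm_map_nhds_eq (mem_chart_source E x)]
  infer_instance

section Charts

variable {E : Type*} [NormedAddCommGroup E] [NormedSpace ℝ E] {M : Type*} [TopologicalSpace M]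
  [ChartedSpace E M] {e : OpenPartialHomeomorph M E}

theorem contMDiffAt_chart (he : e ∈ IsManifold.maximalAtlas 𝓘(ℝ, E) ∞ M) {x : M}
    (hx : x ∈ e.source) : ContMDiffAt 𝓘(ℝ, E) 𝓘(ℝ, E) ∞ e x :=
  (contMDiffOn_of_mem_maximalAtlas he).contMDiffAt (e.open_source.mem_nhds hx)

theorem contMDiffAt_chart_symm (he : e ∈ IsManifold.maximalAtlas 𝓘(ℝ, E) ∞ M) {y : E}
    (hy : y ∈ e.target) : ContMDiffAt 𝓘(ℝ, E) 𝓘(ℝ, E) ∞ e.symm y :=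
  (contMDiffOn_symm_of_mem_maximalAtlas he).contMDiffAt (e.open_target.mem_nhds hy)

end Charts

section LieGroup

variable {EG : Type*} [NormedAddCommGroup EG] [NormedSpace ℝ EG]
  {G : Type*} [TopologicalSpace G] [ChartedSpace EG G] [Group G]

variable (EG) in
/-- The distance to `1` in the preferred chart of the Lie group `G` at `1`. -/
noncomputable def gauge (u : G) : ℝ := ‖chartAt EG (1 : G) u - chartAt EG (1 : G) 1‖

theorem gauge_nonneg (u : G) : 0 ≤ gauge EG u := norm_nonneg _

theorem eventually_eq_one_of_gauge_eq_zero : ∀ᶠ u in 𝓝 (1 : G), gauge EG u = 0 → u = 1 := by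
  filter_upwards [(chartAt EG (1 : G)).open_source.mem_nhds (mem_chart_source EG (1 : G))]
    with u hu h0
  refine (chartAt EG (1 : G)).injOn hu (mem_chart_source EG (1 : G)) ?_
  rwa [gauge, norm_eq_zero, sub_eq_zero] at h0

theorem tendsto_chart_one : Tendsto (chartAt EG (1 : G)) (𝓝 1) (𝓝 (chartAt EG (1 : G) 1)) :=
  (chartAt EG (1 : G)).continuousAt (mem_chart_source EG (1 : G))

theorem tendsto_chart_symm_one :
    Tendsto (chartAt EG (1 : G)).symm (𝓝 (chartAt EG (1 : G) 1)) (𝓝 1) := by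
  have := (chartAt EG (1 : G)).symm.continuousAt (mem_chart_target EG (1 : G))
  rwa [ContinuousAt, (chartAt EG (1 : G)).left_inv (mem_chart_source EG (1 : G))] at this

/-- A function on `G` which is differentiable at `1` in the chart is `O(gauge)` at `1`. -/
theorem exists_norm_sub_le_gauge {F : Type*} [NormedAddCommGroup F] [NormedSpace ℝ F] {f : G → F}
    (hf : DifferentiableAt ℝ (fun a ↦ f ((chartAt EG (1 : G)).symm a)) (chartAt EG (1 : G) 1)) :
    ∃ C, ∀ᶠ u in 𝓝 (1 : G), ‖f u - f 1‖ ≤ C * gauge EG u := by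
  obtain ⟨C, hC⟩ := hf.hasFDerivAt.isBigO_sub.bound
  refine ⟨C, ?_⟩
  filter_upwards [tendsto_chart_one.eventually hC,
    (chartAt EG (1 : G)).open_source.mem_nhds (mem_chart_source EG (1 : G))] with u hu hus
  rwa [(chartAt EG (1 : G)).left_inv hus,
    (chartAt EG (1 : G)).left_inv (mem_chart_source EG (1 : G))] at hu

variable [LieGroup 𝓘(ℝ, EG) ∞ G]

/-- Right division in the chart at `1`. -/
theorem contDiffAt_chart_mul_inv :
    ContDiffAt ℝ ∞ (fun p : EG × EG ↦ chartAt EG (1 : G) ((chartAt EG (1 : G)).symm p.2 *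
      ((chartAt EG (1 : G)).symm p.1)⁻¹)) (chartAt EG (1 : G) 1, chartAt EG (1 : G) 1) := by
  set κ := chartAt EG (1 : G)
  have hκ : κ ∈ IsManifold.maximalAtlas 𝓘(ℝ, EG) ∞ G := IsManifold.chart_mem_maximalAtlas 1
  have h1 : κ.symm (κ 1) = 1 := κ.left_inv (mem_chart_source EG (1 : G))
  have hs := contMDiffAt_chart_symm hκ (mem_chart_target EG (1 : G))
  rw [← contMDiffAt_iff_contDiffAt]
  have e1 : ContMDiffAt 𝓘(ℝ, EG × EG) 𝓘(ℝ, EG) ∞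
      (fun p : EG × EG ↦ κ.symm p.2) (κ 1, κ 1) :=
    ContMDiffAt.comp (x := (κ 1, κ 1)) hs contDiff_snd.contMDiff.contMDiffAt
  have e2 : ContMDiffAt 𝓘(ℝ, EG × EG) 𝓘(ℝ, EG) ∞
      (fun p : EG × EG ↦ κ.symm p.1) (κ 1, κ 1) :=
    ContMDiffAt.comp (x := (κ 1, κ 1)) hs contDiff_fst.contMDiff.contMDiffAt
  refine ContMDiffAt.comp (x := (κ 1, κ 1)) (g := κ) (f := fun p : EG × EG ↦ κ.symm p.2 * (κ.symm p.1)⁻¹)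
    ?_ (e1.mul e2.inv)
  refine contMDiffAt_chart hκ ?_
  simp only [h1, mul_inv_cancel]
  exact mem_chart_source EG (1 : G)

/-- Inversion fixes `1` and is differentiable there in the chart. The remainder estimate displaces
the centre by `u⁻¹`, whereas the bounds are expressed in `u`. -/
theorem exists_gauge_inv_le :
    ∃ C, ∀ᶠ u in 𝓝 (1 : G), gauge EG u⁻¹ ≤ C * gauge EG u := by
  set κ := chartAt EG (1 : G) with hκ
  have h1 : κ.symm (κ 1) = 1 := κ.left_inv (mem_chart_source EG (1 : G))
  have hd : DifferentiableAt ℝ (fun a ↦ κ (κ.symm a)⁻¹) (κ 1) := by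
    have h := (contDiffAt_chart_mul_inv (EG := EG) (G := G)).differentiableAt (by simp)
    have := DifferentiableAt.comp (𝕜 := ℝ) (κ 1) (f := fun a ↦ (a, κ 1)) h (by fun_prop)
    refine this.congr_of_eventuallyEq (Eventually.of_forall fun a ↦ ?_)
    simp [← hκ, h1]
  obtain ⟨C, hC⟩ := exists_norm_sub_le_gauge (f := fun g : G ↦ κ g⁻¹) hd
  refine ⟨C, hC.mono fun u hu ↦ ?_⟩
  simpa [gauge] using hu

variable [FiniteDimensional ℝ EG] [T2Space G]

/-- Small smooth bump functions on a Lie group are averaging kernels. -/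
theorem exists_isAveragingKernel [MeasurableSpace G] [BorelSpace G] (μ : Measure G)
    [μ.IsOpenPosMeasure] [IsFiniteMeasureOnCompacts μ] {N : Set G} (hN : N ∈ 𝓝 1) :
    ∃ ρ C A, IsAveragingKernel μ (gauge EG) ρ C A N := by
  have : IsTopologicalGroup G := topologicalGroup_of_lieGroup 𝓘(ℝ, EG) ∞
  have : LocallyCompactSpace G := Manifold.locallyCompact_of_finiteDimensional 𝓘(ℝ, EG)
  obtain ⟨f, -, hf⟩ := (SmoothBumpFunction.nhds_basis_tsupport (I := 𝓘(ℝ, EG)) (1 : G)).mem_iff.1 hN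
  have hfc : Continuous f := f.contMDiff.continuous
  have hfs : HasCompactSupport f := f.hasCompactSupport
  have hpos : 0 < ∫ k, f k ∂μ := by
    refine hfc.integral_pos_of_hasCompactSupport_nonneg_nonzero hfs (fun _ ↦ f.nonneg) (x := 1) ?_
    simp
  set I := ∫ k, f k ∂μ
  obtain ⟨V, hV, h1V⟩ := exists_compact_mem_nhds (1 : G)
  -- For `u⁻¹ ∈ V` the translate `k ↦ f (u * k)` is supported in `A`, so one compact set serves for
  -- all small `u`.
  set A : Set G := V * tsupport f
  have hA : IsCompact A := hV.mul hfs
  set κ := chartAt EG (1 : G) with hκ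
  have hκm : κ ∈ IsManifold.maximalAtlas 𝓘(ℝ, EG) ∞ G := IsManifold.chart_mem_maximalAtlas 1
  -- local Lipschitz bounds
  have hloc : ∀ k₀ : G, ∃ s ∈ 𝓝 k₀, ∃ C, 0 ≤ C ∧ ∀ᶠ u in 𝓝 (1 : G), ∀ k ∈ s,
      |f (u * k) - f k| ≤ C * gauge EG u := by
    intro k₀
    set e := chartAt EG k₀
    have hem : e ∈ IsManifold.maximalAtlas 𝓘(ℝ, EG) ∞ G := IsManifold.chart_mem_maximalAtlas k₀
    have hd : ContDiffAt ℝ 1 (fun p : EG × EG ↦ f (κ.symm p.1 * e.symm p.2)) (κ 1, e k₀) := by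
      refine ContDiffAt.of_le (n := ∞) ?_ (by simp)
      rw [← contMDiffAt_iff_contDiffAt]
      have e1 : ContMDiffAt 𝓘(ℝ, EG × EG) 𝓘(ℝ, EG) ∞
          (fun p : EG × EG ↦ κ.symm p.1) (κ 1, e k₀) :=
        ContMDiffAt.comp (x := (κ 1, e k₀))
          (contMDiffAt_chart_symm hκm (mem_chart_target EG (1 : G))) contDiff_fst.contMDiff.contMDiffAt
      have e2 : ContMDiffAt 𝓘(ℝ, EG × EG) 𝓘(ℝ, EG) ∞
          (fun p : EG × EG ↦ e.symm p.2) (κ 1, e k₀) :=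
        ContMDiffAt.comp (x := (κ 1, e k₀))
          (contMDiffAt_chart_symm hem (mem_chart_target EG k₀)) contDiff_snd.contMDiff.contMDiffAt
      exact f.contMDiff.contMDiffAt.comp (κ 1, e k₀) (e1.mul e2)
    obtain ⟨L, t, ht, hL⟩ := hd.exists_lipschitzOnWith
    rw [nhds_prod_eq] at ht
    obtain ⟨t₁, ht₁, t₂, ht₂, ht₁₂⟩ := mem_prod_iff.1 ht
    refine ⟨e.source ∩ e ⁻¹' t₂, inter_mem (e.open_source.mem_nhds (mem_chart_source EG k₀))
      (e.continuousAt (mem_chart_source EG k₀) ht₂), L, L.2, ?_⟩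
    filter_upwards [tendsto_chart_one.eventually ht₁,
      κ.open_source.mem_nhds (mem_chart_source EG (1 : G))] with u hu hus k hk
    have h := hL.norm_sub_le (ht₁₂ (mk_mem_prod hu hk.2))
      (ht₁₂ (mk_mem_prod (mem_of_mem_nhds ht₁) hk.2))
    have h' : ‖((κ u, e k) : EG × EG) - (κ 1, e k)‖ = gauge EG u := by
      simp [gauge, Prod.norm_def, hκ]
    rw [h', Real.norm_eq_abs] at h
    simpa [← hκ, κ.left_inv hus, κ.left_inv (mem_chart_source EG (1 : G)), e.left_inv hk.1] using h
  obtain ⟨C, hC0, hC⟩ : ∃ C, 0 ≤ C ∧ ∀ᶠ u in 𝓝 (1 : G), ∀ k ∈ A,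
      |f (u * k) - f k| ≤ C * gauge EG u := by
    refine hA.induction_on (p := fun s ↦ ∃ C, 0 ≤ C ∧ ∀ᶠ u in 𝓝 (1 : G), ∀ k ∈ s,
      |f (u * k) - f k| ≤ C * gauge EG u) ⟨0, le_rfl, by simp⟩ ?_ ?_ ?_
    · rintro s t hst ⟨C, hC, h⟩
      exact ⟨C, hC, h.mono fun u hu k hk ↦ hu k (hst hk)⟩
    · rintro s t ⟨C, hC, h⟩ ⟨C', hC', h'⟩
      refine ⟨C + C', by positivity, ?_⟩
      filter_upwards [h, h'] with u hu hu' k hk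
      have := gauge_nonneg (EG := EG) u
      rcases hk with hk | hk
      · exact (hu k hk).trans (by gcongr; linarith)
      · exact (hu' k hk).trans (by gcongr; linarith)
    · intro k _
      obtain ⟨s, hs, h⟩ := hloc k
      exact ⟨s, mem_nhdsWithin_of_mem_nhds hs, h⟩
  have hzero : ∀ᶠ u in 𝓝 (1 : G), ∀ k, k ∉ A → f (u * k) = 0 := by
    have : Tendsto (fun u : G ↦ u⁻¹) (𝓝 1) (𝓝 1) := continuous_inv.tendsto' _ _ (by simp)
    filter_upwards [this.eventually h1V] with u hu k hk
    refine image_eq_zero_of_notMem_tsupport fun h ↦ hk ?_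
    exact ⟨u⁻¹, hu, u * k, h, by simp⟩
  refine ⟨fun k ↦ I⁻¹ * f k, I⁻¹ * C, A, by fun_prop, fun k ↦ by have := f.nonneg (x := k); positivity,
    ?_, hfs.mul_left, (tsupport_mul_subset_right).trans hf, hA, by positivity, ?_⟩
  · rw [integral_const_mul, inv_mul_cancel₀ hpos.ne']
  · have h1 := hzero.self_of_nhds
    filter_upwards [hC, hzero] with u hu hu0 k
    have hI : 0 ≤ I⁻¹ := by positivity
    refine ⟨?_, fun hk ↦ by rw [hu0 k hk, mul_zero]⟩
    rw [← mul_sub, abs_mul, abs_of_nonneg hI, mul_assoc]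
    gcongr
    by_cases hk : k ∈ A
    · exact hu k hk
    · have := h1 k hk
      rw [one_mul] at this
      rw [hu0 k hk, this]
      simpa using mul_nonneg hC0 (gauge_nonneg u)

end LieGroup

end BanachChains

/-! ### Joint `C^1` regularity of the action -/

namespace BanachChains

open MeasureTheory

variable {EG : Type*} [NormedAddCommGroup EG] [NormedSpace ℝ EG] [FiniteDimensional ℝ EG]
  {G : Type*} [TopologicalSpace G] [T2Space G] [ChartedSpace EG G] [Group G]
  [LieGroup 𝓘(ℝ, EG) ∞ G]
  {E F : Type*} [NormedAddCommGroup E] [NormedSpace ℝ E] [CompleteSpace E]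
  [NormedAddCommGroup F] [NormedSpace ℝ F] [CompleteSpace F]
  {T : G → E → E} {S : G → F → F} {x₀ : E} {ι : E →L[ℝ] F}

/-- Haar measure and the chart gauge provide the data of `exists_lipschitz_orbits`: an orbit map
differentiable at `1` moves its point by `O(gauge)`. -/
theorem LocalAction.exists_gauge_bounds (hT : LocalAction T x₀) (hS : LocalAction S (ι x₀))
    (hι : ∀ᶠ p : G × E in 𝓝 (1, x₀), ι (T p.1 p.2) = S p.1 (ι p.2))
    (horb : ∀ᶠ z in 𝓝 x₀, DifferentiableAt ℝ (fun a ↦ ι (T ((chartAt EG (1 : G)).symm a) z))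
      (chartAt EG (1 : G) 1))
    (hsm : ∃ᶠ z in 𝓝 x₀, DifferentiableAt ℝ (fun a ↦ T ((chartAt EG (1 : G)).symm a) z)
      (chartAt EG (1 : G) 1)) :
    ∃ C, ∃ r > 0, ∀ᶠ u in 𝓝 (1 : G), ∀ z ∈ Metric.ball x₀ r, ∀ z' ∈ Metric.ball x₀ r,
      ‖ι (T u z) - ι z‖ ≤ C * gauge EG u ∧
      ‖ι (T u z) - ι z - (ι (T u z') - ι z')‖ ≤ C * gauge EG u * ‖z - z'‖ := by
  have : IsTopologicalGroup G := topologicalGroup_of_lieGroup 𝓘(ℝ, EG) ∞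
  have : LocallyCompactSpace G := Manifold.locallyCompact_of_finiteDimensional 𝓘(ℝ, EG)
  have : FirstCountableTopology G := firstCountableTopology_of_chartedSpace EG G
  let _ : MeasurableSpace G := borel G
  have : BorelSpace G := ⟨rfl⟩
  refine hT.exists_lipschitz_orbits hS hι Measure.haar (m := gauge EG) gauge_nonneg
    eventually_eq_one_of_gauge_eq_zero (fun N hN ↦ exists_isAveragingKernel _ hN) ?_ ?_
  · filter_upwards [horb, hT.one] with z hz h1
    simpa [h1] using exists_norm_sub_le_gauge (f := fun g : G ↦ ι (T g z)) hz
  · refine (hsm.and_eventually hT.one).mono fun z hz ↦ ?_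
    obtain ⟨C, hC⟩ := exists_norm_sub_le_gauge (f := fun g : G ↦ T g z) hz.1
    obtain ⟨C', hC'⟩ := exists_gauge_inv_le (EG := EG) (G := G)
    have hinv : Tendsto (fun u : G ↦ u⁻¹) (𝓝 1) (𝓝 1) := continuous_inv.tendsto' _ _ (by simp)
    refine ⟨|C| * C', ?_⟩
    filter_upwards [hinv.eventually hC, hC'] with u hu hu'
    rw [hz.2] at hu
    calc _ ≤ C * gauge EG u⁻¹ := hu
      _ ≤ |C| * (C' * gauge EG u) :=
        mul_le_mul (le_abs_self C) hu' (gauge_nonneg _) (abs_nonneg C)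
      _ = _ := by ring

/-- Let `ι` intertwine the local actions `T` on `E` and `S` on `F`. If the orbit maps are
differentiable at `1` as maps into `F`, and for a dense set of points also as maps into `E`, then
the action `(g, z) ↦ ι (T g z)` is jointly of class `C^1` near `(1, x₀)`. -/
theorem LocalAction.contDiffAt_orbit (hT : LocalAction T x₀) (hS : LocalAction S (ι x₀))
    (hι : ∀ᶠ p : G × E in 𝓝 (1, x₀), ι (T p.1 p.2) = S p.1 (ι p.2))
    (horb : ∀ᶠ z in 𝓝 x₀, DifferentiableAt ℝ (fun a ↦ ι (T ((chartAt EG (1 : G)).symm a) z))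
      (chartAt EG (1 : G) 1))
    (hsm : ∃ᶠ z in 𝓝 x₀, DifferentiableAt ℝ (fun a ↦ T ((chartAt EG (1 : G)).symm a) z)
      (chartAt EG (1 : G) 1)) :
    ContDiffAt ℝ 1 (fun p : EG × E ↦ ι (T ((chartAt EG (1 : G)).symm p.1) p.2))
      (chartAt EG (1 : G) 1, x₀) := by
  have : IsTopologicalGroup G := topologicalGroup_of_lieGroup 𝓘(ℝ, EG) ∞
  have : LocallyCompactSpace G := Manifold.locallyCompact_of_finiteDimensional 𝓘(ℝ, EG)
  obtain ⟨C, r, hr, hL⟩ := hT.exists_gauge_bounds hS hι horb hsm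
  obtain ⟨K, r', δ, N, hN, hU⟩ := hT.exists_uniformLocalAction
  have hr' : 0 < r' := hU.pos_δ.trans_le hU.δ_le
  obtain ⟨r₁, hr₁, horb'⟩ := Metric.eventually_nhds_iff_ball.1 horb
  have h1s := mem_chart_source EG (1 : G)
  have h1t := mem_chart_target EG (1 : G)
  have ht1 := tendsto_chart_one (EG := EG) (G := G)
  have ht1s := tendsto_chart_symm_one (EG := EG) (G := G)
  set κ := chartAt EG (1 : G) with hκ
  have hκ1 : κ.symm (κ 1) = 1 := κ.left_inv h1s
  -- `D w` is the tangent at `1` of the orbit map of `w`, and `R a` the derivative at `a` of right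
  -- division by the element with coordinate `a`. The partial derivative in the group variable will
  -- be `D (T (κ.symm a) z)` composed with `R a`.
  let D : E → EG →L[ℝ] F := fun w ↦ fderiv ℝ (fun a ↦ ι (T (κ.symm a) w)) (κ 1)
  let R : EG → EG →L[ℝ] EG := fun a ↦ fderiv ℝ (fun a' ↦ κ (κ.symm a' * (κ.symm a)⁻¹)) a
  -- the ball where everything is under control
  set ρ := min r (min r' r₁) with hρ
  have hρ0 : 0 < ρ := lt_min hr (lt_min hr' hr₁)
  have hb : Metric.ball x₀ ρ ⊆ Metric.ball x₀ r := Metric.ball_subset_ball (min_le_left _ _)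
  have hb' : Metric.ball x₀ ρ ⊆ Metric.ball x₀ r' :=
    Metric.ball_subset_ball ((min_le_right _ _).trans (min_le_left _ _))
  have hb₁ : Metric.ball x₀ ρ ⊆ Metric.ball x₀ r₁ :=
    Metric.ball_subset_ball ((min_le_right _ _).trans (min_le_right _ _))
  have hgood : ∀ᶠ p : EG × E in 𝓝 (κ 1, x₀), p.1 ∈ κ.target ∧ κ.symm p.1 ∈ N ∧
      p.2 ∈ Metric.ball x₀ ρ ∧ T (κ.symm p.1) p.2 ∈ Metric.ball x₀ ρ ∧
      ContinuousAt (fun p : G × E ↦ T p.1 p.2) (κ.symm p.1, p.2) := by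
    have e1 : Tendsto (fun p : EG × E ↦ p.1) (𝓝 (κ 1, x₀)) (𝓝 (κ 1)) := continuous_fst.tendsto _
    have e2 : Tendsto (fun p : EG × E ↦ (κ.symm p.1, p.2)) (𝓝 (κ 1, x₀)) (𝓝 (1, x₀)) :=
      (ht1s.comp e1).prodMk_nhds (continuous_snd.tendsto _)
    filter_upwards [e1.eventually (κ.open_target.mem_nhds h1t), (ht1s.comp e1).eventually hN,
      (continuous_snd.tendsto (κ 1, x₀)).eventually (Metric.ball_mem_nhds x₀ hρ0),
      (hT.tendsto.comp e2).eventually (Metric.ball_mem_nhds x₀ hρ0), e2.eventually hT.cont]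
      with p h1 h2 h3 h4 h5 using ⟨h1, h2, h3, h4, h5⟩
  have hdiv : ∀ {a₀ : EG}, a₀ ∈ κ.target →
      Tendsto (fun a ↦ κ.symm a * (κ.symm a₀)⁻¹) (𝓝 a₀) (𝓝 1) := by
    intro a₀ ha₀
    have := (κ.symm.continuousAt ha₀).tendsto.mul_const (κ.symm a₀)⁻¹
    simpa using this
  have hRd : ∀ᶠ a in 𝓝 (κ 1), ContinuousAt R a ∧
      DifferentiableAt ℝ (fun a' ↦ κ (κ.symm a' * (κ.symm a)⁻¹)) a := by
    have hm : ContDiffAt ℝ 2 (Function.uncurry fun a a' : EG ↦ κ (κ.symm a' * (κ.symm a)⁻¹))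
        (κ 1, κ 1) := (contDiffAt_chart_mul_inv (EG := EG) (G := G)).of_le (by norm_cast)
    have h1 : ContDiffAt ℝ 1 R (κ 1) :=
      ContDiffAt.fderiv (f := fun a a' : EG ↦ κ (κ.symm a' * (κ.symm a)⁻¹)) (g := id) hm
        contDiffAt_id (by norm_num)
    have h2 : Tendsto (fun a : EG ↦ (a, a)) (𝓝 (κ 1)) (𝓝 (κ 1, κ 1)) :=
      Continuous.tendsto' (by fun_prop) _ _ rfl
    filter_upwards [h1.eventually (by simp), h2.eventually (hm.eventually (by simp))] with a ha ha'
    refine ⟨ha.continuousAt, ?_⟩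
    exact DifferentiableAt.comp (𝕜 := ℝ) a (f := fun a' ↦ (a, a')) (ha'.differentiableAt (by simp))
      (by fun_prop)
  have hDc : ∀ w ∈ Metric.ball x₀ ρ, ContinuousAt D w := by
    intro w hw
    -- The bound on second differences says, to first order in the group variable, that `D` is
    -- Lipschitz.
    have hlip : ∀ w' ∈ Metric.ball x₀ ρ, ‖D w' - D w‖ ≤ |C| * ‖w' - w‖ := by
      intro w' hw'
      refine ((horb' w' (hb₁ hw')).hasFDerivAt.sub (horb' w (hb₁ hw)).hasFDerivAt).le_of_lip'
        (by positivity) ?_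
      filter_upwards [ht1s.eventually hL, κ.open_target.mem_nhds h1t] with a ha hat
      have h1 := (ha w' (hb hw') w (hb hw)).2
      have h2 : gauge EG (κ.symm a) = ‖a - κ 1‖ := by rw [gauge, ← hκ, κ.right_inv hat]
      rw [h2] at h1
      calc _ = ‖ι (T (κ.symm a) w') - ι (T (κ.symm a) w)
              - (ι (T (κ.symm (κ 1)) w') - ι (T (κ.symm (κ 1)) w))‖ := rfl
        _ = ‖ι (T (κ.symm a) w') - ι w' - (ι (T (κ.symm a) w) - ι w)‖ := by
            rw [hκ1, hU.one _ (hb' hw), hU.one _ (hb' hw')]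
            congr 1
            abel
        _ ≤ _ := h1
        _ ≤ |C| * ‖a - κ 1‖ * ‖w' - w‖ := by gcongr; exact le_abs_self C
        _ = _ := by ring
    rw [ContinuousAt, tendsto_iff_norm_sub_tendsto_zero]
    have h0 : Tendsto (fun w' ↦ |C| * ‖w' - w‖) (𝓝 w) (𝓝 0) :=
      Continuous.tendsto' (by fun_prop) _ _ (by simp)
    refine squeeze_zero' (Eventually.of_forall fun _ ↦ norm_nonneg _) ?_ h0
    filter_upwards [Metric.isOpen_ball.mem_nhds hw] with w' hw' using hlip w' hw'
  let f₁ : EG → E → EG →L[ℝ] F := fun a z ↦ (D (T (κ.symm a) z)).comp (R a)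
  let f₂ : EG → E → E →L[ℝ] F := fun a z ↦ ι.comp (fderiv ℝ (T (κ.symm a)) z)
  have cf₁ : ∀ᶠ v in 𝓝 (κ 1, x₀), ContinuousAt (fun v : EG × E ↦ f₁ v.1 v.2) v := by
    have e1 : Tendsto (fun p : EG × E ↦ p.1) (𝓝 (κ 1, x₀)) (𝓝 (κ 1)) := continuous_fst.tendsto _
    filter_upwards [hgood, e1.eventually hRd] with v hv hRv
    have e2 : ContinuousAt (fun p : EG × E ↦ (κ.symm p.1, p.2)) v :=
      (ContinuousAt.comp (x := v) (κ.symm.continuousAt hv.1) continuousAt_fst).prodMk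
        continuousAt_snd
    have e3 : ContinuousAt (fun p : EG × E ↦ T (κ.symm p.1) p.2) v :=
      ContinuousAt.comp (g := fun p : G × E ↦ T p.1 p.2)
        (f := fun p : EG × E ↦ (κ.symm p.1, p.2)) (x := v) hv.2.2.2.2 e2
    have e4 : ContinuousAt (fun p : EG × E ↦ D (T (κ.symm p.1) p.2)) v :=
      ContinuousAt.comp (x := v) (hDc _ hv.2.2.2.1) e3
    exact e4.clm_comp (ContinuousAt.comp (x := v) hRv.1 continuousAt_fst)
  have cf₂ : ∀ᶠ v in 𝓝 (κ 1, x₀), ContinuousAt (fun v : EG × E ↦ f₂ v.1 v.2) v := by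
    filter_upwards [hgood] with v hv
    obtain ⟨a₀, z₀⟩ := v
    obtain ⟨hat, haN, hz₀, hTz₀, hc⟩ := hv
    simp only at hat haN hz₀ hTz₀ hc
    set g₀ := κ.symm a₀ with hg₀
    rw [ContinuousAt, tendsto_iff_norm_sub_tendsto_zero]
    have e1 : Tendsto (fun p : EG × E ↦ κ.symm p.1 * g₀⁻¹) (𝓝 (a₀, z₀)) (𝓝 1) :=
      (hdiv hat).comp (continuous_fst.tendsto _)
    have hTc : Tendsto (fun p : EG × E ↦ T g₀ p.2) (𝓝 (a₀, z₀)) (𝓝 (T g₀ z₀)) :=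
      ((hU.c11 g₀ haN).diff z₀ (hb' hz₀)).continuousAt.tendsto.comp (continuous_snd.tendsto _)
    have hg : Tendsto (fun p : EG × E ↦ gauge EG (κ.symm p.1 * g₀⁻¹)) (𝓝 (a₀, z₀)) (𝓝 0) := by
      have h1 : Tendsto (fun u : G ↦ gauge EG u) (𝓝 1) (𝓝 0) := by
        have := (ht1.sub_const (κ 1)).norm
        simpa [gauge] using this
      exact h1.comp e1
    have h0 : Tendsto (fun p : EG × E ↦ |C| * gauge EG (κ.symm p.1 * g₀⁻¹) * K
        + ‖ι‖ * (K * ‖p.2 - z₀‖)) (𝓝 (a₀, z₀)) (𝓝 0) := by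
      have h1 : Tendsto (fun p : EG × E ↦ ‖ι‖ * (K * ‖p.2 - z₀‖)) (𝓝 (a₀, z₀)) (𝓝 0) :=
        Continuous.tendsto' (by fun_prop) _ _ (by simp)
      have h2 := ((hg.const_mul |C|).mul_const K).add h1
      simpa using h2
    refine squeeze_zero' (Eventually.of_forall fun _ ↦ norm_nonneg _) ?_ h0
    filter_upwards [e1.eventually hN, e1.eventually hL,
      hTc.eventually (Metric.isOpen_ball.mem_nhds hTz₀),
      (continuous_snd.tendsto (a₀, z₀)).eventually (Metric.isOpen_ball.mem_nhds hz₀)]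
      with p hpN hpL hpT hpz
    obtain ⟨a, z⟩ := p
    simp only at hpN hpL hpT hpz ⊢
    set u := κ.symm a * g₀⁻¹ with hu
    have hug : κ.symm a = u * g₀ := by simp [hu]
    have hder : fderiv ℝ (T (κ.symm a)) z
        = (fderiv ℝ (T u) (T g₀ z)).comp (fderiv ℝ (T g₀) z) := by
      have : T (κ.symm a) =ᶠ[𝓝 z] T u ∘ T g₀ := by
        filter_upwards [Metric.isOpen_ball.mem_nhds (hb' hpz)] with w hw
        rw [hug, hU.mul u hpN g₀ haN w hw, Function.comp_apply]
      rw [this.fderiv_eq, fderiv_comp _ ((hU.c11 u hpN).diff _ (hb' hpT))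
        ((hU.c11 g₀ haN).diff _ (hb' hpz))]
    -- Strong continuity of the derivatives would not suffice for joint `C^1`. After composition
    -- with `ι`, the second-difference bound gives convergence in operator norm as `u → 1`.
    have hnear : ‖ι.comp (fderiv ℝ (T u) (T g₀ z)) - ι‖ ≤ |C| * gauge EG u := by
      have h1 : HasFDerivAt (fun w ↦ ι (T u w) - ι w) (ι.comp (fderiv ℝ (T u) (T g₀ z)) - ι)
          (T g₀ z) :=
        (ι.hasFDerivAt.comp _ ((hU.c11 u hpN).diff _ (hb' hpT)).hasFDerivAt).sub ι.hasFDerivAt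
      refine h1.le_of_lip' (mul_nonneg (abs_nonneg _) (gauge_nonneg _)) ?_
      filter_upwards [Metric.isOpen_ball.mem_nhds (hb hpT)] with w hw
      refine (hpL w hw _ (hb hpT)).2.trans ?_
      gcongr
      · exact gauge_nonneg _
      · exact le_abs_self C
    have hdiff : f₂ a z - f₂ a₀ z₀ = (ι.comp (fderiv ℝ (T u) (T g₀ z)) - ι).comp
        (fderiv ℝ (T g₀) z) + ι.comp (fderiv ℝ (T g₀) z - fderiv ℝ (T g₀) z₀) := by
      simp only [f₂]
      rw [hder]
      ext v
      simp [hg₀]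
    rw [hdiff]
    refine (norm_add_le _ _).trans (add_le_add ?_ ?_)
    · refine (ContinuousLinearMap.opNorm_comp_le _ _).trans (mul_le_mul hnear
        ((hU.c11 g₀ haN).bound z (hb' hpz)) (norm_nonneg _)
        (mul_nonneg (abs_nonneg _) (gauge_nonneg _)))
    · refine (ContinuousLinearMap.opNorm_comp_le _ _).trans ?_
      gcongr
      exact (hU.c11 g₀ haN).lip z (hb' hpz) z₀ (hb' hz₀)
  have df₁ : ∀ᶠ v : EG × E in 𝓝 (κ 1, x₀),
      HasFDerivAt (fun a ↦ ι (T (κ.symm a) v.2)) (f₁ v.1 v.2) v.1 := by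
    have e1 : Tendsto (fun p : EG × E ↦ p.1) (𝓝 (κ 1, x₀)) (𝓝 (κ 1)) := continuous_fst.tendsto _
    filter_upwards [hgood, e1.eventually hRd] with v hv hRv
    obtain ⟨a, z⟩ := v
    obtain ⟨hat, haN, hz, hTz, hc⟩ := hv
    simp only at hat haN hz hTz hRv ⊢
    -- Near `a` the orbit of `z` is reparametrized as the orbit of `T (κ.symm a) z` near `1`, by
    -- right division.
    have h1 : HasFDerivAt (fun b ↦ ι (T (κ.symm b) (T (κ.symm a) z))) (D (T (κ.symm a) z))
        (κ (κ.symm a * (κ.symm a)⁻¹)) := by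
      rw [mul_inv_cancel]
      exact (horb' _ (hb₁ hTz)).hasFDerivAt
    refine (h1.comp a hRv.2.hasFDerivAt).congr_of_eventuallyEq ?_
    filter_upwards [(hdiv hat).eventually hN,
      (hdiv hat).eventually (κ.open_source.mem_nhds h1s)] with a' ha' ha's
    simp only [Function.comp_apply]
    rw [κ.left_inv ha's, ← hU.mul _ ha' _ haN z (hb' hz)]
    simp
  have df₂ : ∀ᶠ v : EG × E in 𝓝 (κ 1, x₀),
      HasFDerivAt (fun z ↦ ι (T (κ.symm v.1) z)) (f₂ v.1 v.2) v.2 := by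
    filter_upwards [hgood] with v hv
    exact ι.hasFDerivAt.comp _ ((hU.c11 _ hv.2.1).diff _ (hb' hv.2.2.1)).hasFDerivAt
  have hall := cf₁.and (cf₂.and (df₁.eventually_nhds.and df₂.eventually_nhds))
  rw [contDiffAt_one_iff]
  refine ⟨fun v ↦ (f₁ v.1 v.2).coprod (f₂ v.1 v.2), _, hall, fun v hv ↦ ?_, fun v hv ↦ ?_⟩
  · exact (hv.1.continuousLinearMapCoprod hv.2.1).continuousWithinAt
  · exact (hasStrictFDerivAt_uncurry_coprod (f := fun a z ↦ ι (T (κ.symm a) z)) (f₁ := f₁)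
      (f₂ := f₂) hv.2.2.1 hv.2.2.2 hv.1 hv.2.1).hasFDerivAt

end BanachChains

/-! ### Charts as local actions, and curves in isotropy groups -/

namespace BanachChains

section LocalActions

variable {E : Type*} [NormedAddCommGroup E] [NormedSpace ℝ E]
  {M : Type*} [TopologicalSpace M] [ChartedSpace E M]
  {G : Type*} [TopologicalSpace G] [Group G] [MulAction G M]

/-- A continuous action by smooth maps, read in a chart, is a local action. -/
theorem localAction_chart [IsTopologicalGroup G] (hc : Continuous fun p : G × M ↦ p.1 • p.2)
    (hs : ∀ g : G, ContMDiff 𝓘(ℝ, E) 𝓘(ℝ, E) ∞ (fun x : M ↦ g • x))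
    {e : OpenPartialHomeomorph M E} (he : e ∈ IsManifold.maximalAtlas 𝓘(ℝ, E) ∞ M) {q : M}
    (hq : q ∈ e.source) : LocalAction (fun (g : G) z ↦ e (g • e.symm z)) (e q) := by
  have h1 : ∀ᶠ z in 𝓝 (e q), z ∈ e.target := e.open_target.mem_nhds (e.map_source hq)
  have hcs : ∀ p : G × E, p.2 ∈ e.target → ContinuousAt (fun p : G × E ↦ p.1 • e.symm p.2) p :=
    fun p hp ↦ hc.continuousAt.comp (f := fun p : G × E ↦ (p.1, e.symm p.2))
      (continuousAt_fst.prodMk ((e.symm.continuousAt hp).comp continuousAt_snd))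
  have h2 : ∀ᶠ p : G × E in 𝓝 (1, e q), p.2 ∈ e.target ∧ p.1 • e.symm p.2 ∈ e.source := by
    refine ((continuous_snd.tendsto _).eventually h1).and ?_
    refine (hcs (1, e q) (e.map_source hq)).eventually (e.open_source.mem_nhds ?_)
    simpa [e.left_inv hq] using hq
  refine ⟨?_, ?_, ?_, ?_⟩
  · filter_upwards [h1] with z hz
    rw [one_smul, e.right_inv hz]
  · have h3 : Tendsto (fun p : (G × G) × E ↦ (p.1.2, p.2)) (𝓝 ((1, 1), e q)) (𝓝 (1, e q)) :=
      Continuous.tendsto' (by fun_prop) _ _ rfl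
    filter_upwards [h3.eventually h2] with p hp
    rw [e.left_inv hp.2, mul_smul]
  · filter_upwards [h2] with p hp
    exact (e.continuousAt hp.2).comp (f := fun p : G × E ↦ p.1 • e.symm p.2) (hcs p hp.1)
  · filter_upwards [h2] with p hp
    rw [← contMDiffAt_iff_contDiffAt]
    have h3 : ContMDiffAt 𝓘(ℝ, E) 𝓘(ℝ, E) ∞ (fun z ↦ p.1 • e.symm z) p.2 :=
      ContMDiffAt.comp (x := p.2) (hs p.1).contMDiffAt (contMDiffAt_chart_symm he hp.1)
    have h4 : ContMDiffAt 𝓘(ℝ, E) 𝓘(ℝ, E) ∞ (fun z ↦ e (p.1 • e.symm z)) p.2 :=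
      ContMDiffAt.comp (x := p.2) (contMDiffAt_chart he hp.2) h3
    exact h4.of_le (by norm_cast)

end LocalActions

variable {EG : Type*} [NormedAddCommGroup EG] [NormedSpace ℝ EG]
  {G : Type*} [TopologicalSpace G] [ChartedSpace EG G] [Group G]
  [LieGroup 𝓘(ℝ, EG) ∞ G]

theorem contDiffAt_chart_mul :
    ContDiffAt ℝ ∞ (fun p : EG × EG ↦ chartAt EG (1 : G) ((chartAt EG (1 : G)).symm p.1 *
      (chartAt EG (1 : G)).symm p.2)) (chartAt EG (1 : G) 1, chartAt EG (1 : G) 1) := by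
  set κ := chartAt EG (1 : G)
  have hκ : κ ∈ IsManifold.maximalAtlas 𝓘(ℝ, EG) ∞ G := IsManifold.chart_mem_maximalAtlas 1
  have h1 : κ.symm (κ 1) = 1 := κ.left_inv (mem_chart_source EG (1 : G))
  have hs := contMDiffAt_chart_symm hκ (mem_chart_target EG (1 : G))
  rw [← contMDiffAt_iff_contDiffAt]
  have e1 : ContMDiffAt 𝓘(ℝ, EG × EG) 𝓘(ℝ, EG) ∞
      (fun p : EG × EG ↦ κ.symm p.2) (κ 1, κ 1) :=
    ContMDiffAt.comp (x := (κ 1, κ 1)) hs contDiff_snd.contMDiff.contMDiffAt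
  have e2 : ContMDiffAt 𝓘(ℝ, EG × EG) 𝓘(ℝ, EG) ∞
      (fun p : EG × EG ↦ κ.symm p.1) (κ 1, κ 1) :=
    ContMDiffAt.comp (x := (κ 1, κ 1)) hs contDiff_fst.contMDiff.contMDiffAt
  refine ContMDiffAt.comp (x := (κ 1, κ 1)) (g := κ)
    (f := fun p : EG × EG ↦ κ.symm p.1 * κ.symm p.2) ?_ (e2.mul e1)
  refine contMDiffAt_chart hκ ?_
  simp only [h1, mul_one]
  exact mem_chart_source EG (1 : G)

section Curve

variable [FiniteDimensional ℝ EG]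
  {E F : Type*} [NormedAddCommGroup E] [NormedSpace ℝ E]
  [NormedAddCommGroup F] [NormedSpace ℝ F]
  {T : G → E → E} {S : G → F → F} {x₀ : E} {ι : E →L[ℝ] F}

/-- A vector annihilated by the tangent map of the orbit map of `z` is the velocity of a curve in
the isotropy group of `z`. -/
theorem LocalAction.exists_curve (hT : LocalAction T x₀) (hS : LocalAction S (ι x₀))
    (hι : ∀ᶠ p : G × E in 𝓝 (1, x₀), ι (T p.1 p.2) = S p.1 (ι p.2))
    (hf : ContDiffAt ℝ 1 (fun p : EG × E ↦ ι (T ((chartAt EG (1 : G)).symm p.1) p.2))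
      (chartAt EG (1 : G) 1, x₀)) :
    ∀ᶠ z in 𝓝 x₀, ∀ ξ, fderiv ℝ (fun a ↦ ι (T ((chartAt EG (1 : G)).symm a) z))
        (chartAt EG (1 : G) 1) ξ = 0 →
      ∃ c : ℝ → EG, c 0 = chartAt EG (1 : G) 1 ∧ HasDerivAt c ξ 0 ∧
        ∀ᶠ t in 𝓝 0, ι (T ((chartAt EG (1 : G)).symm (c t)) z) = ι z := by
  have : IsTopologicalGroup G := topologicalGroup_of_lieGroup 𝓘(ℝ, EG) ∞
  have : CompleteSpace EG := FiniteDimensional.complete ℝ EG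
  have h1s := mem_chart_source EG (1 : G)
  have h1t := mem_chart_target EG (1 : G)
  have ht1s := tendsto_chart_symm_one (EG := EG) (G := G)
  have hm : ContDiffAt ℝ 2 (fun p : EG × EG ↦ chartAt EG (1 : G) ((chartAt EG (1 : G)).symm p.1 *
      (chartAt EG (1 : G)).symm p.2)) (chartAt EG (1 : G) 1, chartAt EG (1 : G) 1) :=
    contDiffAt_chart_mul.of_le (by norm_cast)
  set κ := chartAt EG (1 : G) with hκ
  set o := κ 1 with ho
  have hκ1 : κ.symm o = 1 := κ.left_inv h1s
  -- Multiplication in the chart; `a ↦ fderiv ℝ (m a) o ξ` is the left-invariant vector field with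
  -- value `ξ` at the unit, and the curve sought is its integral curve.
  let m : EG → EG → EG := fun a b ↦ κ (κ.symm a * κ.symm b)
  have hm1 : ContDiffAt ℝ 1 (fun a ↦ fderiv ℝ (m a) o) o :=
    ContDiffAt.fderiv (f := m) (g := fun _ ↦ o) hm contDiffAt_const (by norm_num)
  have hmo : ∀ᶠ b in 𝓝 o, m o b = b := by
    filter_upwards [κ.open_target.mem_nhds h1t] with b hb
    simp only [m, hκ1, one_mul, κ.right_inv hb]
  have hmd : ∀ᶠ a in 𝓝 o, DifferentiableAt ℝ (m a) o ∧ m a o = a := by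
    have h2 : Tendsto (fun a : EG ↦ (a, o)) (𝓝 o) (𝓝 (o, o)) :=
      Continuous.tendsto' (by fun_prop) _ _ rfl
    filter_upwards [h2.eventually (hm.eventually (by simp)), κ.open_target.mem_nhds h1t]
      with a ha hat
    refine ⟨DifferentiableAt.comp (𝕜 := ℝ) o (f := fun b ↦ (a, b)) (ha.differentiableAt (by simp))
      (by fun_prop), ?_⟩
    simp only [m, hκ1, mul_one, κ.right_inv hat]
  -- the orbit map transported along left translations
  have hkey : ∀ᶠ p : EG × E in 𝓝 (o, x₀),
      DifferentiableAt ℝ (fun a ↦ ι (T (κ.symm a) p.2)) p.1 ∧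
      DifferentiableAt ℝ (fun a ↦ ι (T (κ.symm a) p.2)) o ∧
      (∀ᶠ b in 𝓝 o, ι (T (κ.symm (m p.1 b)) p.2) = S (κ.symm p.1) (ι (T (κ.symm b) p.2))) ∧
      DifferentiableAt ℝ (S (κ.symm p.1)) (ι p.2) ∧ T 1 p.2 = p.2 := by
    have e1 : Tendsto (fun p : EG × E ↦ (κ.symm p.1, p.2)) (𝓝 (o, x₀)) (𝓝 (1, x₀)) :=
      (ht1s.comp (continuous_fst.tendsto _)).prodMk_nhds (continuous_snd.tendsto _)
    have e2 : Tendsto (fun p : EG × E ↦ (o, p.2)) (𝓝 (o, x₀)) (𝓝 (o, x₀)) :=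
      Continuous.tendsto' (by fun_prop) _ _ rfl
    have d : ∀ p : EG × E, ContDiffAt ℝ 1 (fun p : EG × E ↦ ι (T (κ.symm p.1) p.2)) p →
        DifferentiableAt ℝ (fun a ↦ ι (T (κ.symm a) p.2)) p.1 := fun p hp ↦
      DifferentiableAt.comp (𝕜 := ℝ) p.1 (f := fun b ↦ (b, p.2)) (hp.differentiableAt (by simp))
        (by fun_prop)
    have hev := hf.eventually (by simp)
    have hsrc : ∀ᶠ p : (G × G) × E in 𝓝 ((1, 1), x₀), p.1.1 * p.1.2 ∈ κ.source ∧
        ι (T (p.1.1 * p.1.2) p.2) = S p.1.1 (ι (T p.1.2 p.2)) := by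
      have t1 : Tendsto (fun p : (G × G) × E ↦ p.1.1 * p.1.2) (𝓝 ((1, 1), x₀)) (𝓝 1) :=
        Continuous.tendsto' (by fun_prop) _ _ (by simp)
      have t2 : Tendsto (fun p : (G × G) × E ↦ (p.1.2, p.2)) (𝓝 ((1, 1), x₀)) (𝓝 (1, x₀)) :=
        Continuous.tendsto' (by fun_prop) _ _ rfl
      have t3 : Tendsto (fun p : (G × G) × E ↦ (p.1.1, T p.1.2 p.2)) (𝓝 ((1, 1), x₀))
          (𝓝 (1, x₀)) := by
        refine Tendsto.prodMk_nhds ?_ (hT.tendsto.comp t2)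
        exact Continuous.tendsto' (by fun_prop) _ _ rfl
      filter_upwards [t1.eventually (κ.open_source.mem_nhds h1s), hT.mul, t3.eventually hι]
        with p h1 h2 h3 using ⟨h1, by rw [h2, h3]⟩
    have e3 : Tendsto (fun p : EG × E ↦ ((κ.symm p.1, (1 : G)), p.2)) (𝓝 (o, x₀))
        (𝓝 ((1, 1), x₀)) :=
      ((ht1s.comp (continuous_fst.tendsto _)).prodMk_nhds tendsto_const_nhds).prodMk_nhds
        (continuous_snd.tendsto _)
    have e4 : Tendsto (fun p : EG × E ↦ (κ.symm p.1, ι p.2)) (𝓝 (o, x₀)) (𝓝 (1, ι x₀)) :=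
      (ht1s.comp (continuous_fst.tendsto _)).prodMk_nhds
        ((ι.continuous.comp continuous_snd).tendsto _)
    filter_upwards [hev, e2.eventually hev, e3.eventually hsrc.eventually_nhds,
      e4.eventually hS.smooth, (continuous_snd.tendsto (o, x₀)).eventually hT.one]
      with p h1 h2 h3 h4 h5
    refine ⟨d p h1, d (o, p.2) h2, ?_, h4.differentiableAt (by simp), h5⟩
    have e5 : Tendsto (fun b ↦ ((κ.symm p.1, κ.symm b), p.2)) (𝓝 o)
        (𝓝 ((κ.symm p.1, 1), p.2)) :=
      (tendsto_const_nhds.prodMk_nhds ht1s).prodMk_nhds tendsto_const_nhds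
    filter_upwards [e5.eventually h3] with b hb
    simp only [m]
    rw [κ.left_inv hb.1, hb.2]
  have hcurry : ∀ᶠ z in 𝓝 x₀, ∀ᶠ a in 𝓝 o, _ :=
    ((continuous_swap.tendsto' (x₀, o) (o, x₀) rfl).eventually hkey).curry_nhds
  filter_upwards [hcurry] with z hz ξ hξ
  have hX : ContDiffAt ℝ 1 (fun a ↦ fderiv ℝ (m a) o ξ) o :=
    hm1.clm_apply contDiffAt_const
  obtain ⟨c, hc0, ε, hε, hc⟩ :=
    hX.exists_forall_mem_closedBall_exists_eq_forall_mem_Ioo_hasDerivAt₀ 0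
  simp only [zero_sub, zero_add] at hc
  have hmem : (0 : ℝ) ∈ Ioo (-ε) ε := ⟨by linarith, hε⟩
  have hXo : fderiv ℝ (m o) o ξ = ξ := by
    have : m o =ᶠ[𝓝 o] id := hmo
    rw [this.fderiv_eq, fderiv_id, ContinuousLinearMap.id_apply]
  have hc' := hc 0 hmem
  rw [hc0, hXo] at hc'
  refine ⟨c, hc0, hc', ?_⟩
  let f : EG → F := fun a ↦ ι (T (κ.symm a) z)
  -- Equivariance reads `f (m a b) = S (κ.symm a) (f b)`. Differentiating in `b` at the unit, the
  -- derivative of `f` kills the left-invariant field near `o` once it kills `ξ`, so `f` is constant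
  -- along the integral curve.
  have hzero : ∀ᶠ a in 𝓝 o, DifferentiableAt ℝ f a ∧
      fderiv ℝ f a (fderiv ℝ (m a) o ξ) = 0 := by
    filter_upwards [hz, hmd] with a ha hma
    obtain ⟨d1, d2, d3, d4, d5⟩ := ha
    simp only [Prod.swap_prod_mk] at d1 d2 d3 d4 d5
    refine ⟨d1, ?_⟩
    have h1 : HasFDerivAt (fun b ↦ f (m a b)) ((fderiv ℝ f a).comp (fderiv ℝ (m a) o)) o := by
      have h2 : HasFDerivAt f (fderiv ℝ f a) (m a o) := by
        rw [hma.2]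
        exact d1.hasFDerivAt
      exact h2.comp o hma.1.hasFDerivAt
    have h2 : HasFDerivAt (fun b ↦ f (m a b))
        ((fderiv ℝ (S (κ.symm a)) (ι z)).comp (fderiv ℝ f o)) o := by
      have h3 : HasFDerivAt (S (κ.symm a)) (fderiv ℝ (S (κ.symm a)) (ι z)) (f o) := by
        simp only [f, hκ1, d5]
        exact d4.hasFDerivAt
      exact (h3.comp o d2.hasFDerivAt).congr_of_eventuallyEq d3
    have h3 := congrArg (fun L : EG →L[ℝ] F ↦ L ξ) (h1.unique h2)
    simp only [ContinuousLinearMap.comp_apply] at h3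
    rw [h3, hξ, map_zero]
  have hev : ∀ᶠ t in 𝓝 (0 : ℝ), HasDerivAt (fun t ↦ f (c t)) 0 t := by
    have hcc : Tendsto c (𝓝 0) (𝓝 o) := by
      have := hc'.continuousAt.tendsto
      rwa [hc0] at this
    filter_upwards [hcc.eventually hzero, Ioo_mem_nhds hmem.1 hmem.2] with t ht hti
    have := ht.1.hasFDerivAt.comp_hasDerivAt t (hc t hti)
    rwa [ht.2] at this
  obtain ⟨δ, hδ, hball⟩ := Metric.eventually_nhds_iff_ball.1 hev
  have hfo : f o = ι z := by
    have := hz.self_of_nhds.2.2.2.2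
    simp only [Prod.snd_swap] at this
    simp only [f, hκ1, this]
  filter_upwards [Metric.ball_mem_nhds 0 hδ] with t ht
  have := Metric.isOpen_ball.is_const_of_fderiv_eq_zero (𝕜 := ℝ) (f := fun t ↦ f (c t))
    (convex_ball (0 : ℝ) δ).isPreconnected
    (fun t ht ↦ (hball t ht).differentiableAt.differentiableWithinAt) (fun t ht ↦ by
      rw [(hball t ht).hasFDerivAt.fderiv]; simp) ht (Metric.mem_ball_self hδ)
  rw [hc0, hfo] at this
  exact this

end Curve

end BanachChains

/-! ### Restricted charts as orbit charts -/

namespace BanachChains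

set_option linter.unusedSectionVars false

section OrbitCharts

variable (EG : Type*) [NormedAddCommGroup EG] [NormedSpace ℝ EG]
  {G : Type*} [TopologicalSpace G] [ChartedSpace EG G] [Group G]

/-- The velocities at `1` of the curves in the subgroup `K`, read in the chart at `1`. -/
def lieSet (K : Subgroup G) : Set EG :=
  {ξ | ∃ c : ℝ → EG, c 0 = chartAt EG (1 : G) 1 ∧ HasDerivAt c ξ 0 ∧
    ∀ᶠ t in 𝓝 0, (chartAt EG (1 : G)).symm (c t) ∈ K}

variable (G) in
/-- A chart `ψ` of the `G`-space `X`, centred at `q`, in which the action is of class `C^1` after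
composition with the continuous linear injection `ι`, and in which the kernels of the tangent maps
of the orbit maps are the Lie algebras of the isotropy groups. -/
structure IsOrbitChart {X : Type*} [TopologicalSpace X] [MulAction G X]
    {E F : Type*} [NormedAddCommGroup E] [NormedSpace ℝ E] [NormedAddCommGroup F]
    [NormedSpace ℝ F] (ι : E →L[ℝ] F) (q : X) (ψ : OpenPartialHomeomorph X E) : Prop where
  mem_source : q ∈ ψ.source
  map_eq_zero : ψ q = 0
  injective : Function.Injective ι
  contDiffAt : ContDiffAt ℝ 1
    (fun p : EG × E ↦ ι (ψ ((chartAt EG (1 : G)).symm p.1 • ψ.symm p.2)))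
    (chartAt EG (1 : G) 1, 0)
  ker_eq : ∀ᶠ z in 𝓝 (0 : E), ∀ ξ,
    fderiv ℝ (fun a ↦ ι (ψ ((chartAt EG (1 : G)).symm a • ψ.symm z)))
      (chartAt EG (1 : G) 1) ξ = 0 ↔ ξ ∈ lieSet EG (MulAction.stabilizer G (ψ.symm z))

variable {EG}

theorem differentiableAt_chart_comp [IsManifold 𝓘(ℝ, EG) ∞ G]
    {E : Type*} [NormedAddCommGroup E] [NormedSpace ℝ E]
    {M : Type*} [TopologicalSpace M] [ChartedSpace E M] {h : G → M}
    (hh : ContMDiffAt 𝓘(ℝ, EG) 𝓘(ℝ, E) 1 h 1) {e : OpenPartialHomeomorph M E}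
    (he : e ∈ IsManifold.maximalAtlas 𝓘(ℝ, E) ∞ M) (h1 : h 1 ∈ e.source) :
    DifferentiableAt ℝ (fun a ↦ e (h ((chartAt EG (1 : G)).symm a))) (chartAt EG (1 : G) 1) := by
  set κ := chartAt EG (1 : G)
  have hκ1 : κ.symm (κ 1) = 1 := κ.left_inv (mem_chart_source EG (1 : G))
  have e1 : ContMDiffAt 𝓘(ℝ, EG) 𝓘(ℝ, EG) 1 κ.symm (κ 1) :=
    (contMDiffAt_chart_symm (IsManifold.chart_mem_maximalAtlas 1)
      (mem_chart_target EG (1 : G))).of_le (by norm_cast)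
  have e2 : ContMDiffAt 𝓘(ℝ, E) 𝓘(ℝ, E) 1 e (h (κ.symm (κ 1))) := by
    rw [hκ1]
    exact (contMDiffAt_chart he h1).of_le (by norm_cast)
  have e3 : ContMDiffAt 𝓘(ℝ, EG) 𝓘(ℝ, E) 1 h (κ.symm (κ 1)) := by rwa [hκ1]
  have e4 : ContMDiffAt 𝓘(ℝ, EG) 𝓘(ℝ, E) 1 (fun a ↦ e (h (κ.symm a))) (κ 1) :=
    ContMDiffAt.comp (x := κ 1) e2 (ContMDiffAt.comp (x := κ 1) e3 e1)
  exact (contMDiffAt_iff_contDiffAt.1 e4).differentiableAt (by simp)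

end OrbitCharts

section Chains

variable {s₀ : ℝ} {E : Ioi s₀ → Type*} [∀ s, NormedAddCommGroup (E s)] [∀ s, NormedSpace ℝ (E s)]
  {Q : Ioi s₀ → Type*} [∀ s, TopologicalSpace (Q s)] [∀ s, ChartedSpace (E s) (Q s)]
  {C : Chain E Q}

/-- The tangent map of the inclusion `Q^s → Q^{s-1}` at `q`. -/
noncomputable def inclTangent (C : Chain E Q) (s : Ioi s₀) (hs : s₀ + 1 < (s : ℝ)) (q : Q s) :
    E s →L[ℝ] E (pred s hs) :=
  mfderiv 𝓘(ℝ, E s) 𝓘(ℝ, E (pred s hs)) (C.incl (pred_lt s hs)) q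

variable {EG : Type*} [NormedAddCommGroup EG] [NormedSpace ℝ EG] [FiniteDimensional ℝ EG]
  {G : Type*} [TopologicalSpace G] [T2Space G] [ChartedSpace EG G] [Group G]
  [LieGroup 𝓘(ℝ, EG) ∞ G] [∀ s, MulAction G (Q s)]

/-- The index set is unbounded above, so there is always the index `s + 1`; orbit maps of points of
`Q^{s+1}` are `C^1` into `Q^s`. -/
theorem exists_eq_pred (s : Ioi s₀) : ∃ r hr, s = pred r hr := by
  refine ⟨⟨(s : ℝ) + 1, ?_⟩, ?_, ?_⟩
  · have := s.2
    rw [mem_Ioi] at this ⊢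
    linarith
  · have := s.2
    rw [mem_Ioi] at this
    simp only
    linarith
  · ext
    simp [pred]

/-- The image of `Q^{s+1}` is dense in `Q^s`, and its points lose one index only down to `Q^s`
itself. They serve as centres of the averages. -/
theorem IsChainAction.frequently_differentiableAt [∀ s, IsManifold 𝓘(ℝ, E s) ∞ (Q s)]
    (hΦ : IsChainAction EG G C) (s : Ioi s₀) {q : Q s} {ψ : OpenPartialHomeomorph (Q s) (E s)}
    (hψ : ψ ∈ IsManifold.maximalAtlas 𝓘(ℝ, E s) ∞ (Q s)) (hq : q ∈ ψ.source) :
    ∃ᶠ z in 𝓝 (ψ q), DifferentiableAt ℝ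
      (fun a ↦ ψ ((chartAt EG (1 : G)).symm a • ψ.symm z)) (chartAt EG (1 : G) 1) := by
  obtain ⟨r, hr, rfl⟩ := exists_eq_pred s
  rw [frequently_iff]
  intro U hU
  rw [← ψ.map_nhds_eq hq, mem_map] at hU
  obtain ⟨O, hOU, hO, hqO⟩ := mem_nhds_iff.1 (inter_mem hU (ψ.open_source.mem_nhds hq))
  obtain ⟨p, hp⟩ := (C.denseRange_incl (pred_lt r hr)).exists_mem_open hO ⟨q, hqO⟩
  refine ⟨ψ (C.incl (pred_lt r hr) p), (hOU hp).1, ?_⟩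
  rw [ψ.left_inv (hOU hp).2]
  simp only [← hΦ.incl_smul]
  refine differentiableAt_chart_comp (h := fun g : G ↦ C.incl (pred_lt r hr) (g • p))
    (hΦ.contMDiff_orbit r hr p).contMDiffAt hψ ?_
  rw [one_smul]
  exact (hOU hp).2

variable [∀ s, CompleteSpace (E s)]

/-- Read in the two charts, the actions on `Q^s` and `Q^{s-1}` are local actions intertwined by `ι`.
Joint regularity then comes from `LocalAction.contDiffAt_orbit`. A kernel vector is the velocity of
an isotropy curve by `LocalAction.exists_curve`; conversely the orbit map is constant along such a
curve. -/
theorem IsRestrictedChart.isOrbitChart [∀ s, IsManifold 𝓘(ℝ, E s) ∞ (Q s)]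
    (hΦ : IsChainAction EG G C) {s : Ioi s₀} {hs : s₀ + 1 < (s : ℝ)} {q : Q s}
    {ψ : OpenPartialHomeomorph (Q s) (E s)} (hψ : IsRestrictedChart C (pred_lt s hs) q ψ) :
    IsOrbitChart EG G (inclTangent C s hs q) q ψ := by
  have : IsTopologicalGroup G := topologicalGroup_of_lieGroup 𝓘(ℝ, EG) ∞
  obtain ⟨hψq, φ, hφ, hsub, hι⟩ := hψ
  set i := C.incl (pred_lt s hs) with hi
  set ι := inclTangent C s hs q with hιdef
  replace hι : ∀ x ∈ ψ.source, ι (ψ x) = φ (i x) := hι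
  have hφ0 : φ (i q) = 0 := hφ.map_eq_zero
  have hψ0 : ψ q = 0 := hψq.map_eq_zero
  -- The tangent map is the inclusion itself in these charts, so it inherits injectivity: a kernel
  -- vector, scaled into the chart domain, would give a second point with the same image as `q`.
  have hinj : Function.Injective ι := by
    rw [injective_iff_map_eq_zero]
    intro v hv
    have h0 : (0 : E s) ∈ ψ.target := by
      rw [← hψ0]
      exact ψ.map_source hψq.mem_source
    have ht : Tendsto (fun t : ℝ ↦ t • v) (𝓝[≠] 0) (𝓝 0) :=
      (Continuous.tendsto' (by fun_prop) _ _ (by simp)).mono_left nhdsWithin_le_nhds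
    obtain ⟨t, htt, ht0⟩ :=
      ((ht.eventually (ψ.open_target.mem_nhds h0)).and self_mem_nhdsWithin).exists
    have h1 := hι _ (ψ.map_target htt)
    rw [ψ.right_inv htt, map_smul, hv, smul_zero, ← hφ0] at h1
    have h2 := C.incl_injective _
      (φ.injOn hφ.mem_source (hsub (ψ.map_target htt)) h1)
    have h3 : t • v = 0 := by rw [← ψ.right_inv htt, ← h2, hψ0]
    exact (smul_eq_zero.1 h3).resolve_left ht0
  have hT : LocalAction (fun (g : G) z ↦ ψ (g • ψ.symm z)) 0 := by
    rw [← hψ0]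
    exact localAction_chart (hΦ.continuous_smul s) (hΦ.contMDiff_smul s) hψq.mem_maximalAtlas
      hψq.mem_source
  have hS : LocalAction (fun (g : G) y ↦ φ (g • φ.symm y)) (ι 0) := by
    rw [map_zero, ← hφ0]
    exact localAction_chart (hΦ.continuous_smul _) (hΦ.contMDiff_smul _) hφ.mem_maximalAtlas
      hφ.mem_source
  have htgt : ∀ᶠ z in 𝓝 (0 : E s), z ∈ ψ.target := by
    rw [← hψ0]
    exact ψ.open_target.mem_nhds (ψ.map_source hψq.mem_source)
  have hsrc : ∀ᶠ p : G × E s in 𝓝 (1, 0), p.2 ∈ ψ.target ∧ p.1 • ψ.symm p.2 ∈ ψ.source := by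
    refine ((continuous_snd.tendsto _).eventually htgt).and ?_
    have h1 : ContinuousAt (fun p : G × E s ↦ p.1 • ψ.symm p.2) (1, 0) :=
      (hΦ.continuous_smul s).continuousAt.comp (f := fun p : G × E s ↦ (p.1, ψ.symm p.2))
        (continuousAt_fst.prodMk (ContinuousAt.comp (x := ((1 : G), (0 : E s))) (f := Prod.snd)
          (ψ.symm.continuousAt htgt.self_of_nhds) continuousAt_snd))
    refine h1.eventually (ψ.open_source.mem_nhds ?_)
    simp only [one_smul]
    exact ψ.map_target htgt.self_of_nhds
  have hint : ∀ᶠ p : G × E s in 𝓝 (1, 0),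
      ι (ψ (p.1 • ψ.symm p.2)) = φ (p.1 • φ.symm (ι p.2)) := by
    filter_upwards [hsrc] with p hp
    have h1 := hι _ (ψ.map_target hp.1)
    rw [ψ.right_inv hp.1] at h1
    rw [hι _ hp.2, h1, φ.left_inv (hsub (ψ.map_target hp.1)), hi, hΦ.incl_smul]
  have horb : ∀ᶠ z in 𝓝 (0 : E s), DifferentiableAt ℝ
      (fun a ↦ ι (ψ ((chartAt EG (1 : G)).symm a • ψ.symm z))) (chartAt EG (1 : G) 1) := by
    filter_upwards [htgt] with z hz
    have h1 : DifferentiableAt ℝ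
        (fun a ↦ φ (i ((chartAt EG (1 : G)).symm a • ψ.symm z))) (chartAt EG (1 : G) 1) := by
      refine differentiableAt_chart_comp (h := fun g : G ↦ i (g • ψ.symm z))
        (hΦ.contMDiff_orbit s hs _).contMDiffAt hφ.mem_maximalAtlas ?_
      rw [one_smul]
      exact hsub (ψ.map_target hz)
    refine h1.congr_of_eventuallyEq ?_
    have h2 : Tendsto (fun g : G ↦ g • ψ.symm z) (𝓝 1) (𝓝 (ψ.symm z)) :=
      ((hΦ.continuous_smul s).comp (continuous_id.prodMk continuous_const)).tendsto' _ _
        (one_smul _ _)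
    filter_upwards [(h2.comp tendsto_chart_symm_one).eventually
      (ψ.open_source.mem_nhds (ψ.map_target hz))] with a ha using hι _ ha
  have hf := hT.contDiffAt_orbit hS hint horb
    (by simpa [hψ0] using hΦ.frequently_differentiableAt s hψq.mem_maximalAtlas hψq.mem_source)
  refine ⟨hψq.mem_source, hψ0, hinj, hf, ?_⟩
  set κ := chartAt EG (1 : G) with hκ
  have hfix : ∀ z ∈ ψ.target, ∀ g : G, g • ψ.symm z ∈ ψ.source →
      (ι (ψ (g • ψ.symm z)) = ι z ↔ g ∈ MulAction.stabilizer G (ψ.symm z)) := by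
    intro z hz g hg
    rw [hinj.eq_iff, MulAction.mem_stabilizer_iff]
    exact ⟨fun h ↦ by rw [← ψ.left_inv hg, h], fun h ↦ by rw [h, ψ.right_inv hz]⟩
  have hcurve := hT.exists_curve hS hint hf
  filter_upwards [hcurve, htgt, horb] with z hz hzt hzd ξ
  have hsm : Tendsto (fun a ↦ κ.symm a • ψ.symm z) (𝓝 (κ 1)) (𝓝 (ψ.symm z)) :=
    (((hΦ.continuous_smul s).comp (continuous_id.prodMk continuous_const)).tendsto' _ _
        (one_smul _ _)).comp tendsto_chart_symm_one
  have hev := hsm.eventually (ψ.open_source.mem_nhds (ψ.map_target hzt))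
  have hcc : ∀ c : ℝ → EG, c 0 = κ 1 → HasDerivAt c ξ 0 →
      ∀ᶠ t in 𝓝 0, κ.symm (c t) • ψ.symm z ∈ ψ.source := by
    intro c h0 hd
    have : Tendsto c (𝓝 0) (𝓝 (κ 1)) := by
      rw [← h0]
      exact hd.continuousAt
    exact this.eventually hev
  constructor
  · intro hξ
    obtain ⟨c, h0, hd, hc⟩ := hz ξ hξ
    refine ⟨c, h0, hd, ?_⟩
    filter_upwards [hc, hcc c h0 hd] with t h1 h2 using (hfix z hzt _ h2).1 h1
  · rintro ⟨c, h0, hd, hc⟩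
    have h1 : HasDerivAt (fun t ↦ ι (ψ (κ.symm (c t) • ψ.symm z)))
        (fderiv ℝ (fun a ↦ ι (ψ (κ.symm a • ψ.symm z))) (κ 1) ξ) 0 := by
      refine HasFDerivAt.comp_hasDerivAt (0 : ℝ) (f := c)
        (l := fun a ↦ ι (ψ (κ.symm a • ψ.symm z))) ?_ hd
      rw [h0]
      exact hzd.hasFDerivAt
    refine h1.unique ((hasDerivAt_const (0 : ℝ) (ι z)).congr_of_eventuallyEq ?_)
    filter_upwards [hc, hcc c h0 hd] with t h1 h2 using (hfix z hzt _ h2).2 h1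

end Chains

end BanachChains

/-! ### The adjoint map, dimensions of kernels, and a parametric inverse function theorem -/

namespace BanachChains

section Conj

variable {EG : Type*} [NormedAddCommGroup EG] [NormedSpace ℝ EG]
  {G : Type*} [TopologicalSpace G] [ChartedSpace EG G] [Group G]
  [LieGroup 𝓘(ℝ, EG) ∞ G]

theorem differentiableAt_conj (g : G) :
    DifferentiableAt ℝ (fun a ↦ chartAt EG (1 : G) (g * (chartAt EG (1 : G)).symm a * g⁻¹))
      (chartAt EG (1 : G) 1) := by
  refine differentiableAt_chart_comp (h := fun x : G ↦ g * x * g⁻¹) ?_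
    (IsManifold.chart_mem_maximalAtlas 1) (by simp)
  have h : ContMDiffAt 𝓘(ℝ, EG) 𝓘(ℝ, EG) ∞ (fun x : G ↦ g * x * g⁻¹) 1 :=
    (contMDiffAt_const.mul contMDiffAt_id).mul contMDiffAt_const
  exact h.of_le (by norm_cast)

/-- The adjoint representation, in the chart at `1`. -/
noncomputable def adjoint (EG : Type*) [NormedAddCommGroup EG] [NormedSpace ℝ EG]
    {G : Type*} [TopologicalSpace G] [ChartedSpace EG G] [Group G] (g : G) : EG →L[ℝ] EG :=
  fderiv ℝ (fun a ↦ chartAt EG (1 : G) (g * (chartAt EG (1 : G)).symm a * g⁻¹))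
    (chartAt EG (1 : G) 1)

theorem eventually_conj_mem_source (g : G) : ∀ᶠ a in 𝓝 (chartAt EG (1 : G) 1),
    g * (chartAt EG (1 : G)).symm a * g⁻¹ ∈ (chartAt EG (1 : G)).source := by
  have : IsTopologicalGroup G := topologicalGroup_of_lieGroup 𝓘(ℝ, EG) ∞
  have h : Tendsto (fun x : G ↦ g * x * g⁻¹) (𝓝 1) (𝓝 1) :=
    Continuous.tendsto' (by fun_prop) _ _ (by simp)
  exact (h.comp tendsto_chart_symm_one).eventually
    ((chartAt EG (1 : G)).open_source.mem_nhds (mem_chart_source EG (1 : G)))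

theorem adjoint_mem_lieSet (g : G) {K : Subgroup G} {ξ : EG} (hξ : ξ ∈ lieSet EG K) :
    adjoint EG g ξ ∈ lieSet EG (K.map (MulAut.conj g).toMonoidHom) := by
  obtain ⟨c, h0, hd, hc⟩ := hξ
  set κ := chartAt EG (1 : G) with hκ
  have hκ1 : κ.symm (κ 1) = 1 := κ.left_inv (mem_chart_source EG (1 : G))
  refine ⟨fun t ↦ κ (g * κ.symm (c t) * g⁻¹), ?_, ?_, ?_⟩
  · simp [h0, hκ1, ← hκ]
  · refine HasFDerivAt.comp_hasDerivAt (0 : ℝ) (f := c)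
      (l := fun a ↦ κ (g * κ.symm a * g⁻¹)) ?_ hd
    rw [h0]
    exact (differentiableAt_conj g).hasFDerivAt
  · have hcc : Tendsto c (𝓝 0) (𝓝 (κ 1)) := by
      rw [← h0]
      exact hd.continuousAt
    filter_upwards [hc, hcc.eventually (eventually_conj_mem_source g)] with t h1 h2
    rw [κ.left_inv h2]
    exact ⟨_, h1, rfl⟩

/-- Conjugation by `g⁻¹` undoes conjugation by `g`, so by the chain rule `adjoint EG g⁻¹` is a left
inverse. -/
theorem adjoint_injective (g : G) : Function.Injective (adjoint EG g) := by
  set κ := chartAt EG (1 : G) with hκ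
  have hκ1 : κ.symm (κ 1) = 1 := κ.left_inv (mem_chart_source EG (1 : G))
  have h1 : HasFDerivAt (fun a ↦ κ (g⁻¹ * κ.symm (κ (g * κ.symm a * g⁻¹)) * g⁻¹⁻¹))
      ((adjoint EG g⁻¹).comp (adjoint EG g)) (κ 1) := by
    refine HasFDerivAt.comp (g := fun a ↦ κ (g⁻¹ * κ.symm a * g⁻¹⁻¹)) (κ 1) ?_
      (differentiableAt_conj g).hasFDerivAt
    simp only [hκ1, mul_one, mul_inv_cancel]
    exact (differentiableAt_conj g⁻¹).hasFDerivAt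
  have h2 : HasFDerivAt (fun a ↦ κ (g⁻¹ * κ.symm (κ (g * κ.symm a * g⁻¹)) * g⁻¹⁻¹))
      (ContinuousLinearMap.id ℝ EG) (κ 1) := by
    refine (hasFDerivAt_id (κ 1)).congr_of_eventuallyEq ?_
    filter_upwards [eventually_conj_mem_source g,
      κ.open_target.mem_nhds (mem_chart_target EG (1 : G))] with a ha hat
    rw [κ.left_inv ha]
    simpa [mul_assoc] using κ.right_inv hat
  have h3 := h1.unique h2
  intro x y hxy
  have := congrArg (fun L : EG →L[ℝ] EG ↦ L x - L y) h3
  simpa [hxy, sub_eq_zero, eq_comm] using this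

/-- The adjoint map carries velocities of curves in `K` injectively to velocities of curves in the
conjugate group. Only the kernels need be subspaces; linearity of `lieSet` is never required. -/
theorem finrank_ker_le_of_lieSet [FiniteDimensional ℝ EG] {F F' : Type*} [AddCommGroup F]
    [Module ℝ F] [AddCommGroup F'] [Module ℝ F'] {L : EG →ₗ[ℝ] F} {L' : EG →ₗ[ℝ] F'}
    {K : Subgroup G} (g : G) (h : ∀ ξ, L ξ = 0 → ξ ∈ lieSet EG K)
    (h' : ∀ ξ ∈ lieSet EG (K.map (MulAut.conj g).toMonoidHom), L' ξ = 0) :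
    Module.finrank ℝ L.ker ≤ Module.finrank ℝ L'.ker := by
  have hmap : ∀ ξ ∈ L.ker, (adjoint EG g : EG →ₗ[ℝ] EG) ξ ∈ L'.ker := fun ξ hξ ↦
    h' _ (adjoint_mem_lieSet g (h ξ hξ))
  refine LinearMap.finrank_le_finrank_of_injective
    (f := (adjoint EG g : EG →ₗ[ℝ] EG).restrict hmap) ?_
  intro x y hxy
  exact Subtype.ext (adjoint_injective g (congrArg Subtype.val hxy))

theorem finrank_ker_eq_of_lieSet [FiniteDimensional ℝ EG] {F F' : Type*} [AddCommGroup F]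
    [Module ℝ F] [AddCommGroup F'] [Module ℝ F'] {L : EG →ₗ[ℝ] F} {L' : EG →ₗ[ℝ] F'}
    {K K' : Subgroup G} {g : G} (hg : K' = K.map (MulAut.conj g).toMonoidHom)
    (h : ∀ ξ, L ξ = 0 ↔ ξ ∈ lieSet EG K) (h' : ∀ ξ, L' ξ = 0 ↔ ξ ∈ lieSet EG K') :
    Module.finrank ℝ L.ker = Module.finrank ℝ L'.ker := by
  refine le_antisymm (finrank_ker_le_of_lieSet g (fun ξ ↦ (h ξ).1) fun ξ hξ ↦ ?_)
    (finrank_ker_le_of_lieSet g⁻¹ (fun ξ ↦ (h' ξ).1) fun ξ hξ ↦ ?_)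
  · exact (h' ξ).2 (hg ▸ hξ)
  · refine (h ξ).2 ?_
    convert hξ
    rw [hg, Subgroup.map_map]
    ext x
    simp [Subgroup.mem_map, mul_assoc]

end Conj

section Linear

variable {V : Type*} [NormedAddCommGroup V] [NormedSpace ℝ V] [FiniteDimensional ℝ V]

theorem finrank_ker_comp_of_injective {F : Type*} [AddCommGroup F] [Module ℝ F]
    (L : V →ₗ[ℝ] F) {R : V →ₗ[ℝ] V} (hR : Function.Injective R) :
    Module.finrank ℝ (L ∘ₗ R).ker = Module.finrank ℝ L.ker := by
  have h : R.range = ⊤ := LinearMap.range_eq_top.2 (LinearMap.injective_iff_surjective.1 hR)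
  have h1 := LinearMap.finrank_range_add_finrank_ker (L ∘ₗ R)
  have h2 := LinearMap.finrank_range_add_finrank_ker L
  rw [LinearMap.range_comp, h, Submodule.map_top] at h1
  omega

/-- The dimension of the kernel is upper semicontinuous. -/
theorem eventually_finrank_ker_le {W : Type*} [NormedAddCommGroup W] [NormedSpace ℝ W]
    [FiniteDimensional ℝ W] (A : V →L[ℝ] W) :
    ∀ᶠ B : V →L[ℝ] W in 𝓝 A, Module.finrank ℝ (B : V →ₗ[ℝ] W).ker ≤ Module.finrank ℝ (A : V →ₗ[ℝ] W).ker := by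
  have hopen := isOpen_setOfPred_nat_le_rank (𝕜 := ℝ) (E := V) (F := W)
    (Module.finrank ℝ (A : V →ₗ[ℝ] W).range)
  have hA : A ∈ {f : V →L[ℝ] W | ↑(Module.finrank ℝ (A : V →ₗ[ℝ] W).range) ≤
      (f : V →ₗ[ℝ] W).rank} := by
    simp only [mem_ofPred_eq, LinearMap.rank]
    rw [← Module.finrank_eq_rank]
  filter_upwards [hopen.mem_nhds hA] with B hB
  simp only [LinearMap.rank] at hB
  rw [← Module.finrank_eq_rank] at hB
  have h1 := LinearMap.finrank_range_add_finrank_ker (A : V →ₗ[ℝ] W)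
  have h2 := LinearMap.finrank_range_add_finrank_ker (B : V →ₗ[ℝ] W)
  have h3 : Module.finrank ℝ (A : V →ₗ[ℝ] W).range ≤ Module.finrank ℝ (B : V →ₗ[ℝ] W).range := by
    exact_mod_cast hB
  omega

end Linear

section Inverse

variable {V E : Type*} [NormedAddCommGroup V] [NormedSpace ℝ V] [CompleteSpace V]
  [NormedAddCommGroup E] [NormedSpace ℝ E] [CompleteSpace E]

/-- The inverse function theorem for a family `Θ (·, z)` of maps with derivative the identity. -/
theorem exists_parametric_inverse {Θ : V × E → V} {p₀ : V × E} (hΘ : ContDiffAt ℝ 1 Θ p₀)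
    (hd : ∀ v, fderiv ℝ Θ p₀ (v, 0) = v) :
    ∃ A : V × E → V, ContDiffAt ℝ 1 A (Θ p₀, p₀.2) ∧ A (Θ p₀, p₀.2) = p₀.1 ∧
      (∀ᶠ p in 𝓝 p₀, A (Θ p, p.2) = p.1) ∧
      ∀ᶠ p in 𝓝 (Θ p₀, p₀.2), Θ (A p, p.2) = p.1 := by
  let B : E →L[ℝ] V := (fderiv ℝ Θ p₀).comp (ContinuousLinearMap.inr ℝ V E)
  have hdB : ∀ p : V × E, fderiv ℝ Θ p₀ p = p.1 + B p.2 := by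
    intro p
    have : p = (p.1, 0) + (0, p.2) := by simp
    conv_lhs => rw [this, map_add, hd]
    simp [B]
  -- The shear `(v, z) ↦ (v + B z, z)`, the derivative at `p₀` of `p ↦ (Θ p, p.2)`. The ordinary
  -- inverse function theorem for that map contains the parametric one.
  let e : (V × E) ≃L[ℝ] (V × E) := ContinuousLinearEquiv.equivOfInverse
    (((ContinuousLinearMap.fst ℝ V E) + B.comp (ContinuousLinearMap.snd ℝ V E)).prod
      (ContinuousLinearMap.snd ℝ V E))
    (((ContinuousLinearMap.fst ℝ V E) - B.comp (ContinuousLinearMap.snd ℝ V E)).prod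
      (ContinuousLinearMap.snd ℝ V E))
    (fun p ↦ by simp) (fun p ↦ by simp)
  let M : V × E → V × E := fun p ↦ (Θ p, p.2)
  have hM : ContDiffAt ℝ 1 M p₀ := hΘ.prodMk contDiffAt_snd
  have hMd : HasFDerivAt M (e : (V × E) →L[ℝ] (V × E)) p₀ := by
    have h1 : HasFDerivAt M ((fderiv ℝ Θ p₀).prod (ContinuousLinearMap.snd ℝ V E)) p₀ :=
      (hΘ.differentiableAt (by simp)).hasFDerivAt.prodMk hasFDerivAt_snd
    convert h1 using 1
    ext p <;> simp [e, hdB]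
  let Φ := hM.toOpenPartialHomeomorph M hMd one_ne_zero
  have hs : p₀ ∈ Φ.source := hM.mem_toOpenPartialHomeomorph_source hMd one_ne_zero
  have ht : M p₀ ∈ Φ.target := hM.image_mem_toOpenPartialHomeomorph_target hMd one_ne_zero
  have hsnd : ∀ p ∈ Φ.target, (Φ.symm p).2 = p.2 ∧ Θ (Φ.symm p) = p.1 := by
    intro p hp
    have : M (Φ.symm p) = p := Φ.right_inv hp
    have h1 := congrArg Prod.fst this
    have h2 := congrArg Prod.snd this
    exact ⟨h2, h1⟩
  refine ⟨fun p ↦ (Φ.symm p).1, ?_, ?_, ?_, ?_⟩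
  · exact contDiffAt_fst.comp (M p₀) (hM.to_localInverse hMd one_ne_zero)
  · exact congrArg Prod.fst (Φ.left_inv hs)
  · filter_upwards [Φ.open_source.mem_nhds hs] with p hp
    exact congrArg Prod.fst (Φ.left_inv hp)
  · filter_upwards [Φ.open_target.mem_nhds ht] with p hp
    obtain ⟨h1, h2⟩ := hsnd p hp
    rw [← h1]
    exact h2

end Inverse

end BanachChains

/-! ### Constant rank and straightening of the orbits -/

namespace BanachChains

set_option linter.unusedSectionVars false

variable {EG : Type*} [NormedAddCommGroup EG] [NormedSpace ℝ EG] [FiniteDimensional ℝ EG]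
  {G : Type*} [TopologicalSpace G] [ChartedSpace EG G] [Group G] [LieGroup 𝓘(ℝ, EG) ∞ G]
  {X : Type*} [TopologicalSpace X] [MulAction G X]
  {E F : Type*} [NormedAddCommGroup E] [NormedSpace ℝ E] [NormedAddCommGroup F] [NormedSpace ℝ F]
  {ι : E →L[ℝ] F} {q : X} {ψ : OpenPartialHomeomorph X E}

variable (EG G) in
/-- The action, read in the charts. -/
noncomputable def orbitMap (ι : E →L[ℝ] F) (ψ : OpenPartialHomeomorph X E) (p : EG × E) : F :=
  ι (ψ ((chartAt EG (1 : G)).symm p.1 • ψ.symm p.2))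

variable (EG G) in
/-- The tangent map at `1` of the orbit map of the centre of the chart. -/
noncomputable def orbitTangent (ι : E →L[ℝ] F) (ψ : OpenPartialHomeomorph X E) : EG →L[ℝ] F :=
  fderiv ℝ (fun a ↦ orbitMap EG G ι ψ (a, 0)) (chartAt EG (1 : G) 1)

/-- The derivative is the identity at the unit and depends continuously on the base point, and
invertible operators form an open set. It transfers ranks of orbit maps from `1` to nearby group
elements. -/
theorem eventually_injective_rightTranslation : ∀ᶠ a in 𝓝 (chartAt EG (1 : G) 1),
    DifferentiableAt ℝ (fun b ↦ chartAt EG (1 : G) ((chartAt EG (1 : G)).symm b *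
      ((chartAt EG (1 : G)).symm a)⁻¹)) a ∧
    Function.Injective (fderiv ℝ (fun b ↦ chartAt EG (1 : G) ((chartAt EG (1 : G)).symm b *
      ((chartAt EG (1 : G)).symm a)⁻¹)) a) := by
  have : CompleteSpace EG := FiniteDimensional.complete ℝ EG
  have hm : ContDiffAt ℝ 2 (Function.uncurry fun a b : EG ↦ chartAt EG (1 : G)
      ((chartAt EG (1 : G)).symm b * ((chartAt EG (1 : G)).symm a)⁻¹))
      (chartAt EG (1 : G) 1, chartAt EG (1 : G) 1) :=
    (contDiffAt_chart_mul_inv (EG := EG) (G := G)).of_le (by norm_cast)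
  have h1t := mem_chart_target EG (1 : G)
  set κ := chartAt EG (1 : G) with hκ
  have hκ1 : κ.symm (κ 1) = 1 := κ.left_inv (mem_chart_source EG (1 : G))
  let R : EG → EG →L[ℝ] EG := fun a ↦ fderiv ℝ (fun b ↦ κ (κ.symm b * (κ.symm a)⁻¹)) a
  have h1 : ContDiffAt ℝ 1 R (κ 1) :=
    ContDiffAt.fderiv (f := fun a b : EG ↦ κ (κ.symm b * (κ.symm a)⁻¹)) (g := id) hm
      contDiffAt_id (by norm_num)
  have hR1 : R (κ 1) = 1 := by
    have : (fun b ↦ κ (κ.symm b * (κ.symm (κ 1))⁻¹)) =ᶠ[𝓝 (κ 1)] id := by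
      filter_upwards [κ.open_target.mem_nhds h1t] with b hb
      simp [hκ1, κ.right_inv hb]
    simp only [R]
    rw [this.fderiv_eq, fderiv_id]
    rfl
  have hunit : ∀ᶠ a in 𝓝 (κ 1), IsUnit (R a) := by
    refine h1.continuousAt.eventually (Units.isOpen.mem_nhds ?_)
    rw [hR1]
    exact isUnit_one
  have h2 : Tendsto (fun a : EG ↦ (a, a)) (𝓝 (κ 1)) (𝓝 (κ 1, κ 1)) :=
    Continuous.tendsto' (by fun_prop) _ _ rfl
  filter_upwards [hunit, h2.eventually (hm.eventually (by simp))] with a ha ha'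
  refine ⟨DifferentiableAt.comp (𝕜 := ℝ) a (f := fun b ↦ (a, b)) (ha'.differentiableAt (by simp))
    (by fun_prop), ?_⟩
  obtain ⟨u, hu⟩ := ha
  intro x y hxy
  have h3 : (↑u⁻¹ : EG →L[ℝ] EG) (R a x) = (↑u⁻¹ : EG →L[ℝ] EG) (R a y) := congrArg _ hxy
  have h4 : ∀ w, (↑u⁻¹ : EG →L[ℝ] EG) ((u : EG →L[ℝ] EG) w) = w := fun w ↦
    congrArg (fun L : EG →L[ℝ] EG ↦ L w) u.inv_mul
  rwa [← hu, h4, h4] at h3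

namespace IsOrbitChart

theorem zero_mem_target (h : IsOrbitChart EG G ι q ψ) : (0 : E) ∈ ψ.target := by
  rw [← h.map_eq_zero]
  exact ψ.map_source h.mem_source

theorem symm_zero (h : IsOrbitChart EG G ι q ψ) : ψ.symm 0 = q := by
  rw [← h.map_eq_zero, ψ.left_inv h.mem_source]

theorem tendsto_chart (h : IsOrbitChart EG G ι q ψ) : Tendsto ψ (𝓝 q) (𝓝 0) := by
  have := ψ.continuousAt h.mem_source
  rwa [ContinuousAt, h.map_eq_zero] at this

theorem tendsto_symm (h : IsOrbitChart EG G ι q ψ) : Tendsto ψ.symm (𝓝 0) (𝓝 q) := by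
  have := ψ.symm.continuousAt h.zero_mem_target
  rwa [ContinuousAt, h.symm_zero] at this

theorem differentiableAt_orbitMap_left (h : IsOrbitChart EG G ι q ψ) :
    ∀ᶠ p in 𝓝 (chartAt EG (1 : G) 1, (0 : E)), DifferentiableAt ℝ (orbitMap EG G ι ψ) p ∧
      ∀ v, fderiv ℝ (fun a ↦ orbitMap EG G ι ψ (a, p.2)) p.1 v
        = fderiv ℝ (orbitMap EG G ι ψ) p (v, 0) := by
  filter_upwards [h.contDiffAt.eventually (by simp)] with p hp
  have h1 : DifferentiableAt ℝ (orbitMap EG G ι ψ) p := hp.differentiableAt (by simp)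
  refine ⟨h1, fun v ↦ ?_⟩
  have h2 : HasFDerivAt (fun a ↦ orbitMap EG G ι ψ (a, p.2)) ((fderiv ℝ (orbitMap EG G ι ψ) p).comp
      (ContinuousLinearMap.inl ℝ EG E)) p.1 :=
    HasFDerivAt.comp (g := orbitMap EG G ι ψ) p.1 h1.hasFDerivAt (hasFDerivAt_prodMk_left p.1 p.2)
  rw [h2.fderiv]
  simp

variable [ContinuousSMul G X]

theorem tendsto_smul (h : IsOrbitChart EG G ι q ψ) :
    Tendsto (fun p : EG × E ↦ (chartAt EG (1 : G)).symm p.1 • ψ.symm p.2)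
      (𝓝 (chartAt EG (1 : G) 1, 0)) (𝓝 q) := by
  have := (tendsto_chart_symm_one.comp (continuous_fst.tendsto (chartAt EG (1 : G) 1, (0 : E)))).smul
    (h.tendsto_symm.comp (continuous_snd.tendsto (chartAt EG (1 : G) 1, (0 : E))))
  simpa using this

/-- If all isotropy groups are conjugate, the orbit maps have constant rank. -/
theorem eventually_finrank_ker_eq (h : IsOrbitChart EG G ι q ψ)
    (hconj : ∀ x y : X, ∃ g : G, MulAction.stabilizer G y =
      (MulAction.stabilizer G x).map (MulAut.conj g).toMonoidHom) :
    ∀ᶠ p in 𝓝 (chartAt EG (1 : G) 1, (0 : E)),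
      Module.finrank ℝ (fderiv ℝ (fun a ↦ orbitMap EG G ι ψ (a, p.2)) p.1 : EG →ₗ[ℝ] F).ker =
      Module.finrank ℝ (orbitTangent EG G ι ψ : EG →ₗ[ℝ] F).ker := by
  have : IsTopologicalGroup G := topologicalGroup_of_lieGroup 𝓘(ℝ, EG) ∞
  have hinj := eventually_injective_rightTranslation (EG := EG) (G := G)
  have htend := h.tendsto_smul
  have hdiff := h.differentiableAt_orbitMap_left
  have hker := h.ker_eq
  have h1s := mem_chart_source EG (1 : G)
  have h1 : ∀ᶠ z in 𝓝 (0 : E), Module.finrank ℝ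
      (fderiv ℝ (fun a ↦ orbitMap EG G ι ψ (a, z)) (chartAt EG (1 : G) 1) : EG →ₗ[ℝ] F).ker =
      Module.finrank ℝ (orbitTangent EG G ι ψ : EG →ₗ[ℝ] F).ker := by
    filter_upwards [hker] with z hz
    obtain ⟨g, hg⟩ := hconj (ψ.symm z) (ψ.symm 0)
    exact finrank_ker_eq_of_lieSet hg hz hker.self_of_nhds
  set κ := chartAt EG (1 : G) with hκ
  have e1 : Tendsto (fun p : EG × E ↦ p.1) (𝓝 (κ 1, (0 : E))) (𝓝 (κ 1)) :=
    continuous_fst.tendsto _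
  have e3 : Tendsto (fun p : EG × E ↦ (κ 1, ψ (κ.symm p.1 • ψ.symm p.2))) (𝓝 (κ 1, (0 : E)))
      (𝓝 (κ 1, 0)) := tendsto_const_nhds.prodMk_nhds (h.tendsto_chart.comp htend)
  filter_upwards [e1.eventually hinj, htend.eventually (ψ.open_source.mem_nhds h.mem_source),
    (h.tendsto_chart.comp htend).eventually h1, e3.eventually hdiff,
    e1.eventually (κ.open_target.mem_nhds (mem_chart_target EG (1 : G)))] with p h2 h3 h4 h5 h6
  simp only [Function.comp_apply] at h4
  -- Away from the unit, the orbit map of a point is a right translation followed by the orbit map,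
  -- near the unit, of the moved point; an injective endomorphism of `EG` does not change the kernel
  -- dimension.
  rw [← h4, ← finrank_ker_comp_of_injective (fderiv ℝ (fun a ↦ orbitMap EG G ι ψ
    (a, ψ (κ.symm p.1 • ψ.symm p.2))) (κ 1) : EG →ₗ[ℝ] F) (R := (fderiv ℝ (fun b ↦ κ (κ.symm b *
      (κ.symm p.1)⁻¹)) p.1 : EG →ₗ[ℝ] EG)) h2.2]
  refine congrArg (fun L : EG →L[ℝ] F ↦ Module.finrank ℝ (L : EG →ₗ[ℝ] F).ker)
    (a₂ := (fderiv ℝ (fun a ↦ orbitMap EG G ι ψ (a, ψ (κ.symm p.1 • ψ.symm p.2))) (κ 1)).comp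
      (fderiv ℝ (fun b ↦ κ (κ.symm b * (κ.symm p.1)⁻¹)) p.1)) ?_
  have h7 : HasFDerivAt (fun a ↦ orbitMap EG G ι ψ (a, ψ (κ.symm p.1 • ψ.symm p.2)))
      (fderiv ℝ (fun a ↦ orbitMap EG G ι ψ (a, ψ (κ.symm p.1 • ψ.symm p.2))) (κ 1))
      (κ (κ.symm p.1 * (κ.symm p.1)⁻¹)) := by
    rw [mul_inv_cancel]
    exact (DifferentiableAt.comp (𝕜 := ℝ) (κ 1) (g := orbitMap EG G ι ψ)
      (f := fun a ↦ (a, ψ (κ.symm p.1 • ψ.symm p.2))) h5.1 (by fun_prop)).hasFDerivAt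
  refine HasFDerivAt.fderiv ((h7.comp p.1 h2.1.hasFDerivAt).congr_of_eventuallyEq ?_)
  have h8 : Tendsto (fun b ↦ κ.symm b * (κ.symm p.1)⁻¹) (𝓝 p.1) (𝓝 1) := by
    have := (κ.symm.continuousAt h6).tendsto.mul_const (κ.symm p.1)⁻¹
    simpa using this
  filter_upwards [h8.eventually (κ.open_source.mem_nhds h1s)] with b hb
  simp only [Function.comp_apply, orbitMap, ← hκ]
  rw [κ.left_inv hb, ψ.left_inv h3, smul_smul]
  simp

variable [CompleteSpace E]

/-- Coordinates on `G` adapted to the orbits of all points near `q`. -/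
theorem exists_straightening (h : IsOrbitChart EG G ι q ψ)
    (hconj : ∀ x y : X, ∃ g : G, MulAction.stabilizer G y =
      (MulAction.stabilizer G x).map (MulAut.conj g).toMonoidHom)
    {l : F →L[ℝ] EG}
    (hl : ∀ v, orbitTangent EG G ι ψ (l (orbitTangent EG G ι ψ v)) = orbitTangent EG G ι ψ v)
    (hl' : ∀ y, l (orbitTangent EG G ι ψ (l y)) = l y) :
    ∃ (A : EG × E → EG) (v : EG × E → EG),
      (∀ᶠ p in 𝓝 (0, (0 : E)), ContinuousAt A p) ∧ (∀ᶠ z in 𝓝 (0 : E), A (0, z) = chartAt EG (1 : G) 1) ∧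
      Tendsto v (𝓝 (chartAt EG (1 : G) 1, 0)) (𝓝 0) ∧
      (∀ᶠ p in 𝓝 (chartAt EG (1 : G) 1, (0 : E)), A (v p, p.2) = p.1 ∧
        l (orbitTangent EG G ι ψ (v p)) = l (orbitMap EG G ι ψ p) - l (ι p.2)) ∧
      (∀ᶠ p in 𝓝 (0, (0 : E)),
        l (orbitMap EG G ι ψ (A p, p.2)) = l (ι p.2) + l (orbitTangent EG G ι ψ p.1)) ∧
      ∃ ε > 0, ∀ z ∈ Metric.ball (0 : E) ε, ∀ v ∈ Metric.ball (0 : EG) ε,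
        ∀ v' ∈ Metric.ball (0 : EG) ε,
        l (orbitTangent EG G ι ψ v) = l (orbitTangent EG G ι ψ v') →
        (chartAt EG (1 : G)).symm (A (v, z)) • ψ.symm z =
          (chartAt EG (1 : G)).symm (A (v', z)) • ψ.symm z := by
  have : CompleteSpace EG := FiniteDimensional.complete ℝ EG
  have hrank := h.eventually_finrank_ker_eq hconj
  have htend := h.tendsto_smul
  have hdiff := h.differentiableAt_orbitMap_left
  have h1s := mem_chart_source EG (1 : G)
  have h1t := mem_chart_target EG (1 : G)
  have hfC : ContDiffAt ℝ 1 (orbitMap EG G ι ψ) (chartAt EG (1 : G) 1, 0) := h.contDiffAt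
  set D := orbitTangent EG G ι ψ with hD
  set f := orbitMap EG G ι ψ with hf
  set κ := chartAt EG (1 : G) with hκ
  set o := κ 1 with ho
  have hκ1 : κ.symm o = 1 := κ.left_inv h1s
  have hfo : ∀ z ∈ ψ.target, f (o, z) = ι z := by
    intro z hz
    simp only [hf, orbitMap, ← hκ, hκ1, one_smul, ψ.right_inv hz]
  have htgt : ∀ᶠ z in 𝓝 (0 : E), z ∈ ψ.target := ψ.open_target.mem_nhds h.zero_mem_target
  have hD0 : ∀ v, fderiv ℝ f (o, 0) (v, 0) = D v := fun v ↦ (hdiff.self_of_nhds.2 v).symm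
  -- the straightening map
  let Θ : EG × E → EG := fun p ↦ (p.1 - o) - l (D (p.1 - o)) + l (f p) - l (ι p.2)
  have hΘ : ContDiffAt ℝ 1 Θ (o, 0) := by
    have h1 : ContDiffAt ℝ 1 (fun p : EG × E ↦ p.1 - o) (o, 0) := contDiffAt_fst.sub contDiffAt_const
    exact ((h1.sub (l.contDiff.contDiffAt.comp (o, (0 : E)) (D.contDiff.contDiffAt.comp (o, (0 : E)) h1))).add
      (l.contDiff.contDiffAt.comp (o, (0 : E)) hfC)).sub
      (l.contDiff.contDiffAt.comp (o, (0 : E)) (ι.contDiff.contDiffAt.comp (o, (0 : E)) contDiffAt_snd))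
  -- The derivative in the group variable is `1 - l D + l D = 1`: the correction `1 - l D` fills the
  -- directions in which `l ∘ f` is degenerate.
  have hΘd : ∀ v, fderiv ℝ Θ (o, 0) (v, 0) = v := by
    intro v
    have h1 : HasFDerivAt (fun p : EG × E ↦ p.1 - o) (ContinuousLinearMap.fst ℝ EG E) (o, 0) :=
      hasFDerivAt_fst.sub_const o
    have h2 : HasFDerivAt f (fderiv ℝ f (o, 0)) (o, 0) :=
      (hfC.differentiableAt (by simp)).hasFDerivAt
    have h3 := ((h1.sub (l.hasFDerivAt.comp (o, (0 : E)) (D.hasFDerivAt.comp (o, (0 : E)) h1))).add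
      (l.hasFDerivAt.comp (o, (0 : E)) h2)).sub
      (l.hasFDerivAt.comp (o, (0 : E)) (ι.hasFDerivAt.comp (o, (0 : E)) hasFDerivAt_snd))
    have h4 : fderiv ℝ Θ (o, 0) = _ := HasFDerivAt.fderiv h3
    rw [h4]
    simp [hD0]
  have hΘo : ∀ z ∈ ψ.target, Θ (o, z) = 0 := by
    intro z hz
    simp [Θ, hfo z hz]
  -- `l D` is a projection and kills the correction, so in the coordinate `Θ` the function `l ∘ f`
  -- is affine along the orbit.
  have hlΘ : ∀ p, l (D (Θ p)) = l (f p) - l (ι p.2) := by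
    intro p
    simp only [Θ, map_sub, map_add, hl, hl']
    abel
  obtain ⟨A, hA, hA0, hAΘ, hΘA⟩ := exists_parametric_inverse hΘ hΘd
  rw [hΘo 0 h.zero_mem_target] at hA hA0 hΘA
  simp only at hA hA0 hΘA
  have hAlim : Tendsto (fun p : EG × E ↦ (A p, p.2)) (𝓝 (0, 0)) (𝓝 (o, 0)) := by
    have := hA.continuousAt.tendsto
    rw [hA0] at this
    exact this.prodMk_nhds (continuous_snd.tendsto _)
  have hlA : ∀ᶠ p in 𝓝 (0, (0 : E)), l (f (A p, p.2)) = l (ι p.2) + l (D p.1) := by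
    filter_upwards [hΘA] with p hp
    have := hlΘ (A p, p.2)
    rw [hp] at this
    rw [this]
    abel
  -- Constant rank enters here. With `L` the partial derivative, semicontinuity gives `dim ker (l L)
  -- ≤ dim ker (l D) = dim ker D = dim ker L`, while `ker L ≤ ker (l L)`; the two kernels coincide.
  have hkerf : ∀ᶠ p in 𝓝 (o, (0 : E)), ∀ ξ, l (fderiv ℝ (fun a ↦ f (a, p.2)) p.1 ξ) = 0 →
      fderiv ℝ (fun a ↦ f (a, p.2)) p.1 ξ = 0 := by
    have h1 : Tendsto (fun p ↦ l.comp ((fderiv ℝ f p).comp (ContinuousLinearMap.inl ℝ EG E)))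
        (𝓝 (o, 0)) (𝓝 (l.comp D)) := by
      have h2 : ContinuousAt (fderiv ℝ f) (o, 0) :=
        (hfC.fderiv_right (m := 0) (by norm_num)).continuousAt
      have h3 : l.comp D = l.comp ((fderiv ℝ f (o, 0)).comp (ContinuousLinearMap.inl ℝ EG E)) := by
        ext v
        simp [hD0]
      rw [h3]
      exact (continuousAt_const.clm_comp (h2.clm_comp continuousAt_const)).tendsto
    filter_upwards [h1.eventually (eventually_finrank_ker_le (l.comp D)), hrank, hdiff]
      with p h2 h3 h4
    set L := fderiv ℝ (fun a ↦ f (a, p.2)) p.1 with hL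
    have h5 : (fderiv ℝ f p).comp (ContinuousLinearMap.inl ℝ EG E) = L := by
      ext v
      simp [h4.2]
    rw [h5] at h2
    have h6 : (l.comp D : EG →ₗ[ℝ] EG).ker = (D : EG →ₗ[ℝ] F).ker := by
      ext v
      simp only [LinearMap.mem_ker, ContinuousLinearMap.coe_coe, ContinuousLinearMap.comp_apply]
      exact ⟨fun hv ↦ by rw [← hl, hv, map_zero], fun hv ↦ by rw [hv, map_zero]⟩
    have h7 : (L : EG →ₗ[ℝ] F).ker ≤ (l.comp L : EG →ₗ[ℝ] EG).ker := by
      intro v hv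
      simp only [LinearMap.mem_ker, ContinuousLinearMap.coe_coe, ContinuousLinearMap.comp_apply]
        at hv ⊢
      rw [hv, map_zero]
    have h8 := Submodule.eq_of_le_of_finrank_le h7 (by rw [h3, ← h6]; exact h2)
    intro ξ hξ
    have : ξ ∈ (l.comp L : EG →ₗ[ℝ] EG).ker := hξ
    rw [← h8] at this
    exact this
  refine ⟨A, Θ, ?_, ?_, ?_, ?_, hlA, ?_⟩
  · filter_upwards [hA.eventually (by simp)] with p hp using hp.continuousAt
  · have h1 : Tendsto (fun z : E ↦ (o, z)) (𝓝 0) (𝓝 (o, 0)) :=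
      Continuous.tendsto' (by fun_prop) _ _ rfl
    filter_upwards [h1.eventually hAΘ, htgt] with z hz hzt
    rwa [hΘo z hzt] at hz
  · have := hΘ.continuousAt.tendsto
    rwa [hΘo 0 h.zero_mem_target] at this
  · filter_upwards [hAΘ] with p hp using ⟨hp, hlΘ p⟩
  -- points with the same component along the orbit
  have hgood := ((hA.eventually (by simp)).and ((hAlim.eventually hkerf).and
    ((hAlim.eventually hdiff).and (hlA.and (hAlim.eventually
      (htend.eventually (ψ.open_source.mem_nhds h.mem_source)))))))
  obtain ⟨ε, hε, hball⟩ := Metric.eventually_nhds_iff_ball.1 hgood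
  refine ⟨ε, hε, fun z hz v hv v' hv' hvv ↦ ?_⟩
  have hmem : ∀ w ∈ Metric.ball (0 : EG) ε, (w, z) ∈ Metric.ball ((0 : EG), (0 : E)) ε := by
    intro w hw
    rw [← ball_prod_same]
    exact ⟨hw, hz⟩
  -- On the segment from `v` to `v'` the value of `l ∘ f` is constant. As `l` detects every motion
  -- along the orbit, `f` is constant as well.
  let c : ℝ → EG := fun t ↦ v + t • (v' - v)
  have hc : ∀ t, HasDerivAt c (v' - v) t := by
    intro t
    have := ((hasDerivAt_id' t).smul_const (v' - v)).const_add v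
    rwa [one_smul] at this
  let s : Set ℝ := c ⁻¹' Metric.ball 0 ε
  have hso : IsOpen s := Metric.isOpen_ball.preimage (by fun_prop)
  have hsc : Convex ℝ s := by
    have : c = AffineMap.lineMap v v' := by
      ext t
      simp [c, AffineMap.lineMap_apply, add_comm]
    simp only [s, this]
    exact (convex_ball _ _).affine_preimage _
  have hder : ∀ t ∈ s, HasDerivAt (fun t ↦ f (A (c t, z), z)) 0 t := by
    intro t ht
    obtain ⟨g1, g2, g3, -, -⟩ := hball _ (hmem _ ht)
    have d1 : HasDerivAt (fun t ↦ A (c t, z))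
        (fderiv ℝ A (c t, z) (v' - v, 0)) t :=
      HasFDerivAt.comp_hasDerivAt t (l := A) (f := fun t ↦ (c t, z))
        (g1.differentiableAt (by simp)).hasFDerivAt ((hc t).prodMk (hasDerivAt_const t z))
    have d2 : HasDerivAt (fun t ↦ f (A (c t, z), z))
        (fderiv ℝ (fun a ↦ f (a, z)) (A (c t, z)) (fderiv ℝ A (c t, z) (v' - v, 0))) t := by
      refine HasFDerivAt.comp_hasDerivAt t (l := fun a ↦ f (a, z)) (f := fun t ↦ A (c t, z)) ?_ d1
      exact (DifferentiableAt.comp (𝕜 := ℝ) _ (g := f) (f := fun a ↦ (a, z)) g3.1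
        (by fun_prop)).hasFDerivAt
    have d3 : HasDerivAt (fun t ↦ l (f (A (c t, z), z))) (l (fderiv ℝ (fun a ↦ f (a, z))
        (A (c t, z)) (fderiv ℝ A (c t, z) (v' - v, 0)))) t := l.hasFDerivAt.comp_hasDerivAt t d2
    have d4 : HasDerivAt (fun t ↦ l (f (A (c t, z), z))) 0 t := by
      refine (hasDerivAt_const t (l (ι z) + l (D v))).congr_of_eventuallyEq ?_
      filter_upwards [hso.mem_nhds ht] with t' ht'
      rw [(hball _ (hmem _ ht')).2.2.2.1]
      simp only [c, map_add, map_smul, map_sub, hvv, sub_self, smul_zero, add_zero]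
    rwa [g2 _ (d3.unique d4)] at d2
  have hconst := hso.is_const_of_fderiv_eq_zero (𝕜 := ℝ) (f := fun t ↦ f (A (c t, z), z))
    hsc.isPreconnected
    (fun t ht ↦ (hder t ht).differentiableAt.differentiableWithinAt) (fun t ht ↦ by
      rw [(hder t ht).hasFDerivAt.fderiv]; simp) (x := 0) (y := 1)
    (by simpa [s, c] using hv) (by simpa [s, c] using hv')
  simp only [c, zero_smul, add_zero, one_smul, add_sub_cancel] at hconst
  exact ψ.injOn (hball _ (hmem _ hv)).2.2.2.2 (hball _ (hmem _ hv')).2.2.2.2 (h.injective hconst)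

end IsOrbitChart

end BanachChains

/-! ### Germs of isotropy groups and local slices -/

namespace BanachChains

set_option linter.unusedSectionVars false

section Germ

variable {G : Type*} [TopologicalSpace G] [Group G]

/-- The subgroup of the elements of `K` which are products of arbitrarily small elements of `K`. -/
def germ (K : Subgroup G) : Subgroup G :=
  ⨅ O ∈ 𝓝 (1 : G), Subgroup.closure ((K : Set G) ∩ O)

theorem mem_germ {K : Subgroup G} {g : G} :
    g ∈ germ K ↔ ∀ O ∈ 𝓝 (1 : G), g ∈ Subgroup.closure ((K : Set G) ∩ O) := by
  simp [germ, Subgroup.mem_iInf]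

theorem germ_le (K : Subgroup G) : germ K ≤ K := fun g hg ↦ by
  simpa using mem_germ.1 hg univ univ_mem

variable [IsTopologicalGroup G]

theorem conj_mem_germ {K : Subgroup G} {g x : G} (hx : x ∈ germ K) :
    g * x * g⁻¹ ∈ germ (K.map (MulAut.conj g).toMonoidHom) := by
  rw [mem_germ]
  intro O hO
  have hcont : Tendsto (fun y : G ↦ g * y * g⁻¹) (𝓝 1) (𝓝 1) :=
    Continuous.tendsto' (by fun_prop) _ _ (by simp)
  have h1 := mem_germ.1 hx _ (hcont hO)
  have h2 : Subgroup.closure ((K : Set G) ∩ (fun y : G ↦ g * y * g⁻¹) ⁻¹' O) ≤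
      (Subgroup.closure (((K.map (MulAut.conj g).toMonoidHom : Subgroup G) : Set G) ∩ O)).comap
        (MulAut.conj g).toMonoidHom := by
    rw [Subgroup.closure_le]
    rintro y ⟨hy, hyO⟩
    exact Subgroup.subset_closure ⟨⟨y, hy, rfl⟩, hyO⟩
  exact h2 h1

/-- Modulo the subgroup generated by `K ∩ O` the path is locally constant, since `(c t')⁻¹ * c t` is
a small element of `K`; the interval is connected. -/
theorem mem_germ_of_path {K : Subgroup G} {c : ℝ → G} (hc : ContinuousOn c (Icc 0 1))
    (h0 : c 0 = 1) (hK : ∀ t ∈ Icc (0 : ℝ) 1, c t ∈ K) : c 1 ∈ germ K := by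
  rw [mem_germ]
  intro O hO
  set H := Subgroup.closure ((K : Set G) ∩ O)
  let f : Icc (0 : ℝ) 1 → G ⧸ H := fun t ↦ (c t : G)
  have hf : IsLocallyConstant f := by
    rw [IsLocallyConstant.iff_eventually_eq]
    intro t
    have h1 : Tendsto (fun t' : Icc (0 : ℝ) 1 ↦ (c t')⁻¹ * c t) (𝓝 t) (𝓝 1) := by
      have h2 : Tendsto (fun t' : Icc (0 : ℝ) 1 ↦ c t') (𝓝 t) (𝓝 (c t)) :=
        (continuousOn_iff_continuous_domRestrict.1 hc).tendsto t
      simpa using h2.inv.mul_const (c t)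
    filter_upwards [h1 hO] with t' ht'
    rw [QuotientGroup.eq]
    exact Subgroup.subset_closure ⟨K.mul_mem (K.inv_mem (hK _ t'.2)) (hK _ t.2), ht'⟩
  have h := hf.apply_eq_of_preconnectedSpace ⟨0, by simp⟩ ⟨1, by simp⟩
  simp only [f, h0] at h
  simpa [QuotientGroup.eq] using h

end Germ

variable {EG : Type*} [NormedAddCommGroup EG] [NormedSpace ℝ EG] [FiniteDimensional ℝ EG]
  {G : Type*} [TopologicalSpace G] [ChartedSpace EG G] [Group G] [LieGroup 𝓘(ℝ, EG) ∞ G]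
  {X : Type*} [TopologicalSpace X] [MulAction G X] [ContinuousSMul G X]
  {E F : Type*} [NormedAddCommGroup E] [NormedSpace ℝ E] [CompleteSpace E]
  [NormedAddCommGroup F] [NormedSpace ℝ F]
  {ι : E →L[ℝ] F} {q : X} {ψ : OpenPartialHomeomorph X E}

/-- `S` is a slice at `q` for the orbits of the points near `q` under the elements near `1`. -/
structure IsSlice (G : Type*) [TopologicalSpace G] [Group G] {X : Type*} [TopologicalSpace X]
    [MulAction G X] (q : X) (S : Set X) : Prop where
  mem_germ : ∃ O ∈ 𝓝 (1 : G), ∀ᶠ r in 𝓝 q, ∀ g ∈ O, g • r = r → g ∈ germ (MulAction.stabilizer G r)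
  exists_germ : ∃ O ∈ 𝓝 (1 : G), ∀ k ∈ O, k • q = q → ∀ U ∈ 𝓝 k, ∀ᶠ r in 𝓝 q,
    ∃ g ∈ germ (MulAction.stabilizer G r), g ∈ U
  eq_of_mem : ∃ O ∈ 𝓝 (1 : G), ∀ᶠ r in 𝓝 q, ∀ g ∈ O, ∀ g' ∈ O, g • r ∈ S → g' • r ∈ S →
    g • r = g' • r
  exists_retraction : ∃ b : X → X, b q = q ∧ ∀ᶠ r in 𝓝 q, ContinuousAt b r ∧ b r ∈ S ∧
    (∃ g : G, b r = g • r) ∧ (r ∈ S → b r = r)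

/-- In the straightened coordinate `v` of a group element, `l f = l ι z + l D v`, and `l D v`
determines the moved point. The slice condition prescribes `l D v`, whence uniqueness; `v = -l ι z`
satisfies it, whence the retraction. Isotropy elements satisfy the linear condition `l D v = 0`, so
they can be contracted to the unit along a segment, which puts them in the germ. -/
theorem IsOrbitChart.isSlice (h : IsOrbitChart EG G ι q ψ)
    (hconj : ∀ x y : X, ∃ g : G, MulAction.stabilizer G y =
      (MulAction.stabilizer G x).map (MulAut.conj g).toMonoidHom)
    {l : F →L[ℝ] EG}
    (hl : ∀ v, orbitTangent EG G ι ψ (l (orbitTangent EG G ι ψ v)) = orbitTangent EG G ι ψ v)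
    (hl' : ∀ y, l (orbitTangent EG G ι ψ (l y)) = l y) :
    IsSlice G q {r | l (ι (ψ r)) = 0} := by
  have : IsTopologicalGroup G := topologicalGroup_of_lieGroup 𝓘(ℝ, EG) ∞
  obtain ⟨A, v, hAc, hA0, hv, hAv, hlA, ε, hε, hPL⟩ := h.exists_straightening hconj hl hl'
  have h1s := mem_chart_source EG (1 : G)
  have h1t := mem_chart_target EG (1 : G)
  have ht1 := tendsto_chart_one (EG := EG) (G := G)
  set D := orbitTangent EG G ι ψ with hD
  set f := orbitMap EG G ι ψ with hf
  set κ := chartAt EG (1 : G) with hκ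
  set o := κ 1 with ho
  have hκ1 : κ.symm o = 1 := κ.left_inv h1s
  have hAo : A (0, 0) = o := hA0.self_of_nhds
  -- a ball where everything is under control
  have hgood : ∀ᶠ p : EG × E in 𝓝 (0, 0), ContinuousAt (fun p ↦ κ.symm (A p)) p ∧
      A (0, p.2) = o ∧ l (f (A p, p.2)) = l (ι p.2) + l (D p.1) := by
    have h1 : ∀ᶠ p in 𝓝 (0, (0 : E)), A p ∈ κ.target := by
      have := hAc.self_of_nhds.tendsto
      rw [hAo] at this
      exact this.eventually (κ.open_target.mem_nhds h1t)
    filter_upwards [hAc, h1, (continuous_snd.tendsto ((0 : EG), (0 : E))).eventually hA0, hlA]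
      with p h2 h3 h4 h5
    exact ⟨(κ.symm.continuousAt h3).comp h2, h4, h5⟩
  obtain ⟨δ', hδ', hball'⟩ := Metric.eventually_nhds_iff_ball.1 hgood
  obtain ⟨δ, hδ, hδε, hδδ⟩ : ∃ δ > 0, δ ≤ ε ∧ δ ≤ δ' :=
    ⟨min ε δ', lt_min hε hδ', min_le_left _ _, min_le_right _ _⟩
  have hball : ∀ w ∈ Metric.ball (0 : EG) δ, ∀ z ∈ Metric.ball (0 : E) δ,
      ContinuousAt (fun p ↦ κ.symm (A p)) (w, z) ∧ A (0, z) = o ∧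
        l (f (A (w, z), z)) = l (ι z) + l (D w) := by
    intro w hw z hz
    refine hball' (w, z) ?_
    rw [← ball_prod_same]
    exact ⟨Metric.ball_subset_ball hδδ hw, Metric.ball_subset_ball hδδ hz⟩
  have hPL' : ∀ z ∈ Metric.ball (0 : E) δ, ∀ w ∈ Metric.ball (0 : EG) δ,
      ∀ w' ∈ Metric.ball (0 : EG) δ, l (D w) = l (D w') →
        κ.symm (A (w, z)) • ψ.symm z = κ.symm (A (w', z)) • ψ.symm z :=
    fun z hz w hw w' hw' ↦ hPL z (Metric.ball_subset_ball hδε hz) w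
      (Metric.ball_subset_ball hδε hw) w' (Metric.ball_subset_ball hδε hw')
  have hgerm : ∀ z ∈ Metric.ball (0 : E) δ, ∀ w ∈ Metric.ball (0 : EG) δ, l (D w) = 0 →
      κ.symm (A (w, z)) ∈ germ (MulAction.stabilizer G (ψ.symm z)) := by
    intro z hz w hw hlw
    have hsw : ∀ t ∈ Icc (0 : ℝ) 1, t • w ∈ Metric.ball (0 : EG) δ := by
      intro t ht
      rw [mem_ball_zero_iff] at hw ⊢
      refine lt_of_le_of_lt ?_ hw
      rw [norm_smul, Real.norm_of_nonneg ht.1]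
      exact mul_le_of_le_one_left (norm_nonneg _) ht.2
    have h0 := (hball 0 (Metric.mem_ball_self hδ) z hz).2.1
    have key := mem_germ_of_path (K := MulAction.stabilizer G (ψ.symm z))
      (c := fun t ↦ κ.symm (A (t • w, z))) ?_ ?_ ?_
    · simpa using key
    · intro t ht
      exact (ContinuousAt.comp (g := fun p ↦ κ.symm (A p)) (f := fun t : ℝ ↦ (t • w, z))
        (hball _ (hsw t ht) z hz).1 (by fun_prop)).continuousWithinAt
    · simp [h0, hκ1]
    · intro t ht
      rw [MulAction.mem_stabilizer_iff, hPL' z hz _ (hsw t ht) 0 (Metric.mem_ball_self hδ)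
        (by rw [map_smul, map_smul, hlw, smul_zero, map_zero, map_zero]), h0, hκ1, one_smul]
  -- coordinates of the group elements
  have hcoord : ∀ᶠ p : G × X in 𝓝 (1, q), p.2 ∈ ψ.source ∧ ψ p.2 ∈ Metric.ball (0 : E) δ ∧
      v (κ p.1, ψ p.2) ∈ Metric.ball (0 : EG) δ ∧ κ.symm (A (v (κ p.1, ψ p.2), ψ p.2)) = p.1 ∧
      l (D (v (κ p.1, ψ p.2))) = l (ι (ψ (p.1 • p.2))) - l (ι (ψ p.2)) := by
    have e1 : Tendsto (fun p : G × X ↦ p.1) (𝓝 (1, q)) (𝓝 1) := continuous_fst.tendsto _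
    have e2 : Tendsto (fun p : G × X ↦ p.2) (𝓝 (1, q)) (𝓝 q) := continuous_snd.tendsto _
    have e3 : Tendsto (fun p : G × X ↦ (κ p.1, ψ p.2)) (𝓝 (1, q)) (𝓝 (o, 0)) :=
      (ht1.comp e1).prodMk_nhds (h.tendsto_chart.comp e2)
    filter_upwards [e1.eventually (κ.open_source.mem_nhds h1s),
      e2.eventually (ψ.open_source.mem_nhds h.mem_source),
      (h.tendsto_chart.comp e2).eventually (Metric.ball_mem_nhds 0 hδ),
      (hv.comp e3).eventually (Metric.ball_mem_nhds 0 hδ), e3.eventually hAv] with p h1 h2 h3 h4 h5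
    refine ⟨h2, h3, h4, ?_, ?_⟩
    · rw [h5.1, κ.left_inv h1]
    · rw [h5.2]
      simp only [hf, orbitMap, ← hκ]
      rw [κ.left_inv h1, ψ.left_inv h2]
  rw [nhds_prod_eq] at hcoord
  obtain ⟨O, hO, W, hW, hOW⟩ := mem_prod_iff.1 hcoord
  replace hOW : ∀ g ∈ O, ∀ r ∈ W, _ := fun g hg r hr ↦ hOW (mk_mem_prod hg hr)
  have hqW : q ∈ W := mem_of_mem_nhds hW
  refine ⟨⟨O, hO, ?_⟩, ⟨O, hO, ?_⟩, ⟨O, hO, ?_⟩, ?_⟩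
  · filter_upwards [hW] with r hr g hg hgr
    obtain ⟨h1, h2, h3, h4, h5⟩ := hOW g hg r hr
    simp only at h1 h2 h3 h4 h5
    rw [hgr, sub_self] at h5
    have := hgerm _ h2 _ h3 h5
    rwa [h4, ψ.left_inv h1] at this
  · intro k hk hkq U hU
    obtain ⟨h1, h2, h3, h4, h5⟩ := hOW k hk q hqW
    simp only at h1 h2 h3 h4 h5
    rw [hkq, sub_self] at h5
    set w := v (κ k, ψ q)
    -- The coordinate `w` of `k` is kept while the base point moves. The condition `l D w = 0` does
    -- not mention the base point, so `w` still represents an isotropy element of `r`.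
    have hlim : Tendsto (fun r ↦ κ.symm (A (w, ψ r))) (𝓝 q) (𝓝 k) := by
      have e1 := (hball w h3 _ h2).1.tendsto
      rw [h4] at e1
      exact e1.comp (tendsto_const_nhds.prodMk_nhds (ψ.continuousAt h.mem_source))
    filter_upwards [hlim hU, ψ.open_source.mem_nhds h.mem_source,
      h.tendsto_chart.eventually (Metric.ball_mem_nhds 0 hδ)] with r hr hrs hrb
    refine ⟨_, ?_, hr⟩
    have := hgerm _ hrb _ h3 h5
    rwa [ψ.left_inv hrs] at this
  · filter_upwards [hW] with r hr g hg g' hg' hgS hgS'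
    obtain ⟨h1, h2, h3, h4, h5⟩ := hOW g hg r hr
    obtain ⟨-, -, h3', h4', h5'⟩ := hOW g' hg' r hr
    simp only at h1 h2 h3 h4 h5 h3' h4' h5'
    have hgS1 : l (ι (ψ (g • r))) = 0 := hgS
    have hgS2 : l (ι (ψ (g' • r))) = 0 := hgS'
    rw [hgS1] at h5
    rw [hgS2] at h5'
    have := hPL' _ h2 _ h3 _ h3' (h5.trans h5'.symm)
    rwa [h4, h4', ψ.left_inv h1] at this
  · have e1 : Tendsto (fun r ↦ -l (ι (ψ r))) (𝓝 q) (𝓝 0) := by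
      have := ((l.continuous.comp ι.continuous).tendsto (0 : E)).comp h.tendsto_chart
      simpa using this.neg
    -- By `l D l = l`, the coordinate `-l ι z` cancels the term `l ι z`; it vanishes on the slice,
    -- where the retraction is therefore the identity.
    refine ⟨fun r ↦ κ.symm (A (-l (ι (ψ r)), ψ r)) • r, ?_, ?_⟩
    · simp [h.map_eq_zero, hAo, hκ1]
    · filter_upwards [ψ.open_source.mem_nhds h.mem_source,
        h.tendsto_chart.eventually (Metric.ball_mem_nhds 0 hδ),
        e1.eventually (Metric.ball_mem_nhds 0 hδ)] with r h1 h2 h3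
      obtain ⟨h4, h5, h6⟩ := hball _ h3 _ h2
      refine ⟨?_, ?_, ⟨_, rfl⟩, ?_⟩
      · have hψr := ψ.continuousAt h1
        have e2 : ContinuousAt (fun r ↦ (-l (ι (ψ r)), ψ r)) r :=
          ((l.continuous.comp ι.continuous).continuousAt.comp hψr).neg.prodMk hψr
        exact (ContinuousAt.comp (g := fun p ↦ κ.symm (A p)) (f := fun r ↦ (-l (ι (ψ r)), ψ r))
          h4 e2).smul continuousAt_id
      · rw [map_neg, map_neg, hl', add_neg_cancel] at h6
        simp only [hf, orbitMap, ← hκ, ψ.left_inv h1] at h6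
        exact h6
      · intro hr
        have hr' : l (ι (ψ r)) = 0 := hr
        simp only [hr', neg_zero, h5, hκ1, one_smul]

end BanachChains

/-! ### Properness: slice points near `q` on one orbit coincide -/

namespace BanachChains

set_option linter.unusedSectionVars false

theorem exists_common_subseq {ι Y : Type*} [Finite ι] [TopologicalSpace Y] (u : ι → ℕ → Y)
    (h : ∀ i, ∀ φ : ℕ → ℕ, StrictMono φ → ∃ c, ∃ k : ℕ → ℕ, StrictMono k ∧
      Tendsto (fun n ↦ u i (φ (k n))) atTop (𝓝 c)) :
    ∃ φ : ℕ → ℕ, StrictMono φ ∧ ∃ c : ι → Y, ∀ i, Tendsto (fun n ↦ u i (φ n)) atTop (𝓝 (c i)) := by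
  classical
  have : Fintype ι := Fintype.ofFinite ι
  have key : ∀ s : Finset ι, ∃ φ : ℕ → ℕ, StrictMono φ ∧
      ∀ i ∈ s, ∃ c, Tendsto (fun n ↦ u i (φ n)) atTop (𝓝 c) := by
    intro s
    induction s using Finset.induction_on with
    | empty => exact ⟨id, strictMono_id, by simp⟩
    | insert i s _ ih =>
      obtain ⟨φ, hφ, hs⟩ := ih
      obtain ⟨c, k, hk, hc⟩ := h i φ hφ
      refine ⟨φ ∘ k, hφ.comp hk, fun j hj ↦ ?_⟩
      rcases Finset.mem_insert.1 hj with rfl | hj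
      · exact ⟨c, hc⟩
      · obtain ⟨c', hc'⟩ := hs j hj
        exact ⟨c', hc'.comp hk.tendsto_atTop⟩
  obtain ⟨φ, hφ, hc⟩ := key Finset.univ
  choose c hc using fun i ↦ hc i (Finset.mem_univ i)
  exact ⟨φ, hφ, c, hc⟩

section Proper

variable {G : Type*} [TopologicalSpace G] [Group G] [IsTopologicalGroup G]
  {X : Type*} [TopologicalSpace X] [T2Space X] [FirstCountableTopology X]
  [MulAction G X] [ContinuousSMul G X] {q : X} {S : Set X}

variable (G X) in
/-- Sequential properness of an action. -/
def IsSeqProper : Prop :=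
  ∀ (g : ℕ → G) (x : ℕ → X) (a b : X), Tendsto x atTop (𝓝 a) →
    Tendsto (fun n ↦ g n • x n) atTop (𝓝 b) →
    ∃ (c : G) (k : ℕ → ℕ), StrictMono k ∧ Tendsto (g ∘ k) atTop (𝓝 c)

/-- Infinitely many coset representatives would, by properness at the fixed point `q`, have a
convergent subsequence. Quotients of consecutive terms are then small isotropy elements, which lie
in the germ, so two cosets coincide. -/
theorem IsSlice.finite_quotient (hS : IsSlice G q S) (hprop : IsSeqProper G X) :
    Finite (MulAction.stabilizer G q ⧸
      (germ (MulAction.stabilizer G q)).subgroupOf (MulAction.stabilizer G q)) := by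
  set K := MulAction.stabilizer G q with hK
  by_contra hinf
  rw [not_finite_iff_infinite] at hinf
  let f := Infinite.natEmbedding (K ⧸ (germ K).subgroupOf K)
  let k : ℕ → K := fun n ↦ (f n).out
  obtain ⟨O, hO, hev⟩ := hS.mem_germ
  have hfix : ∀ n, (k n : G) • q = q := fun n ↦ (k n).2
  obtain ⟨c, φ, hφ, hc⟩ := hprop (fun n ↦ (k n : G)) (fun _ ↦ q) q q tendsto_const_nhds
    (by simp only [hfix]; exact tendsto_const_nhds)
  have hc' : Tendsto (fun n ↦ ((k (φ n) : G))⁻¹ * k (φ (n + 1))) atTop (𝓝 1) := by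
    have := (hc.inv).mul (hc.comp (tendsto_add_atTop_nat 1))
    simpa using this
  obtain ⟨n, hn⟩ := (hc'.eventually hO).exists
  have hg : ((k (φ n) : G))⁻¹ * k (φ (n + 1)) ∈ germ K := by
    refine hev.self_of_nhds _ hn ?_
    exact (K.mul_mem (K.inv_mem (k (φ n)).2) (k (φ (n + 1))).2)
  have heq : f (φ n) = f (φ (n + 1)) := by
    rw [← Quotient.out_eq (f (φ n)), ← Quotient.out_eq (f (φ (n + 1)))]
    exact QuotientGroup.eq.2 (Subgroup.mem_subgroupOf.2 hg)
  have := hφ (Nat.lt_succ_self n)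
  exact this.ne (f.injective heq)

/-- The germ is generated by elements as small as desired, for which the slice provides the
approximation; it persists under products and inverses by continuity. -/
theorem IsSlice.eventually_exists_germ (hS : IsSlice G q S) {g : G}
    (hg : g ∈ germ (MulAction.stabilizer G q)) :
    ∀ U ∈ 𝓝 g, ∀ᶠ r in 𝓝 q, ∃ x ∈ germ (MulAction.stabilizer G r), x ∈ U := by
  obtain ⟨O, hO, h⟩ := hS.exists_germ
  have hg' := BanachChains.mem_germ.1 hg O hO
  clear hg
  induction hg' using Subgroup.closure_induction with
  | mem x hx => exact h x hx.2 hx.1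
  | one => exact fun U hU ↦ Eventually.of_forall fun r ↦ ⟨1, one_mem _, mem_of_mem_nhds hU⟩
  | mul x y hx hy ihx ihy =>
    intro U hU
    have h1 : Tendsto (fun p : G × G ↦ p.1 * p.2) (𝓝 x ×ˢ 𝓝 y) (𝓝 (x * y)) := by
      rw [← nhds_prod_eq]
      exact continuous_mul.tendsto (x, y)
    obtain ⟨U₁, hU₁, U₂, hU₂, hU₁₂⟩ := mem_prod_iff.1 (h1 hU)
    filter_upwards [ihx U₁ hU₁, ihy U₂ hU₂] with r h2 h3
    obtain ⟨x', hx', hxU⟩ := h2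
    obtain ⟨y', hy', hyU⟩ := h3
    exact ⟨x' * y', mul_mem hx' hy', hU₁₂ (mk_mem_prod hxU hyU)⟩
  | inv x hx ih =>
    intro U hU
    filter_upwards [ih _ ((continuous_inv.tendsto x) hU)] with r h2
    obtain ⟨x', hx', hxU⟩ := h2
    exact ⟨x'⁻¹, inv_mem hx', hxU⟩

/-- If all isotropy groups are conjugate, each element of the isotropy group of `q` is a limit of
elements of the isotropy groups of the points tending to `q`. -/
theorem IsSlice.eventually_exists_stabilizer (hS : IsSlice G q S) (hprop : IsSeqProper G X)
    (hconj : ∀ x y : X, ∃ g : G, MulAction.stabilizer G y =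
      (MulAction.stabilizer G x).map (MulAut.conj g).toMonoidHom) {k : G} (hk : k • q = q) :
    ∀ U ∈ 𝓝 k, ∀ᶠ r in 𝓝 q, ∃ g ∈ U, g • r = r := by
  intro U hU
  by_contra hcon
  obtain ⟨r, hr, hrU⟩ := exists_seq_forall_of_frequently (not_eventually.1 hcon)
  have := hS.finite_quotient hprop
  set K := MulAction.stabilizer G q with hK
  let rep : K ⧸ (germ K).subgroupOf K → G := fun i ↦ (i.out : G)
  have hrep : ∀ i, rep i ∈ K := fun i ↦ (i.out).2
  choose a ha using fun n ↦ hconj q (r n)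
  have hmem : ∀ n, ∀ x ∈ K, (a n * x * (a n)⁻¹) • r n = r n := by
    intro n x hx
    rw [← MulAction.mem_stabilizer_iff, ha n]
    exact ⟨x, hx, rfl⟩
  -- The conjugated representatives fix `r n`, which tends to `q`. Properness yields limits along
  -- one subsequence, and these limits fix `q`.
  obtain ⟨φ, hφ, c, hc⟩ := exists_common_subseq (fun i n ↦ a n * rep i * (a n)⁻¹) (by
    intro i φ hφ
    have h1 : Tendsto (fun n ↦ r (φ n)) atTop (𝓝 q) := hr.comp hφ.tendsto_atTop
    obtain ⟨c, k, hk, hc⟩ := hprop (fun n ↦ a (φ n) * rep i * (a (φ n))⁻¹) (fun n ↦ r (φ n)) q q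
      h1 (by simpa only [hmem _ _ (hrep i)] using h1)
    exact ⟨c, k, hk, hc⟩)
  have hr' : Tendsto (fun n ↦ r (φ n)) atTop (𝓝 q) := hr.comp hφ.tendsto_atTop
  have hcK : ∀ i, c i ∈ K := by
    intro i
    have h1 := (hc i).smul hr'
    simp only [hmem _ _ (hrep i)] at h1
    exact tendsto_nhds_unique h1 hr'
  obtain ⟨O, hO, hOg⟩ := hS.mem_germ
  -- The limits `c i` define a self-map of the finite quotient. Injectivity will force surjectivity,
  -- so every coset of the germ in `K` contains some `c i`.
  let Ψ : K ⧸ (germ K).subgroupOf K → K ⧸ (germ K).subgroupOf K :=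
    fun i ↦ QuotientGroup.mk (⟨c i, hcK i⟩ : K)
  have hΨ : Function.Injective Ψ := by
    intro i j hij
    have h1 : (c i)⁻¹ * c j ∈ germ K := Subgroup.mem_subgroupOf.1 (QuotientGroup.eq.1 hij)
    have h2 : Tendsto (fun p : G × G ↦ p.1⁻¹ * p.2)
        (𝓝 ((c i)⁻¹ * c j) ×ˢ 𝓝 ((c i)⁻¹ * c j)) (𝓝 1) := by
      rw [← nhds_prod_eq]
      exact Continuous.tendsto' (by fun_prop) _ _ (by simp)
    obtain ⟨U₁, hU₁, U₂, hU₂, hU₁₂⟩ := mem_prod_iff.1 (h2 hO)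
    have h3 : Tendsto (fun n ↦ (a (φ n) * rep i * (a (φ n))⁻¹)⁻¹ * (a (φ n) * rep j * (a (φ n))⁻¹))
        atTop (𝓝 ((c i)⁻¹ * c j)) := (hc i).inv.mul (hc j)
    -- For large `n` the conjugate of `(rep i)⁻¹ * rep j` is close to an element `x` of the germ of
    -- the isotropy group of `r (φ n)`. Their quotient is a small isotropy element, hence also in
    -- the germ; conjugating back, `rep i` and `rep j` lie in one coset.
    obtain ⟨n, h4, ⟨x, hx, hxU⟩, h6⟩ := ((h3.eventually hU₂).and
      ((hr'.eventually (hS.eventually_exists_germ h1 U₁ hU₁)).and (hr'.eventually hOg))).exists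
    have h7 : (a (φ n) * rep i * (a (φ n))⁻¹)⁻¹ * (a (φ n) * rep j * (a (φ n))⁻¹) =
        a (φ n) * ((rep i)⁻¹ * rep j) * (a (φ n))⁻¹ := by group
    rw [h7] at h4
    have h8 : (rep i)⁻¹ * rep j ∈ K := K.mul_mem (K.inv_mem (hrep i)) (hrep j)
    have h9 : x⁻¹ * (a (φ n) * ((rep i)⁻¹ * rep j) * (a (φ n))⁻¹) ∈
        germ (MulAction.stabilizer G (r (φ n))) := by
      refine h6 _ (hU₁₂ (mk_mem_prod hxU h4)) ?_
      exact (MulAction.stabilizer G (r (φ n))).mul_mem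
        (inv_mem (germ_le _ hx)) (hmem _ _ h8)
    have h10 : a (φ n) * ((rep i)⁻¹ * rep j) * (a (φ n))⁻¹ ∈
        germ (MulAction.stabilizer G (r (φ n))) := by
      simpa using mul_mem hx h9
    have h11 := conj_mem_germ (g := (a (φ n))⁻¹) h10
    have h12 : (MulAction.stabilizer G (r (φ n))).map (MulAut.conj (a (φ n))⁻¹).toMonoidHom = K := by
      rw [ha (φ n), Subgroup.map_map]
      ext y
      simp [Subgroup.mem_map, mul_assoc, hK]
    rw [h12] at h11
    have h13 : (rep i)⁻¹ * rep j ∈ germ K := by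
      convert h11 using 1
      group
    rw [← Quotient.out_eq i, ← Quotient.out_eq j]
    exact QuotientGroup.eq.2 (Subgroup.mem_subgroupOf.2 h13)
  obtain ⟨i, hi⟩ := Finite.injective_iff_surjective.1 hΨ (QuotientGroup.mk (⟨k, hk⟩ : K))
  have h1 : (c i)⁻¹ * k ∈ germ K := Subgroup.mem_subgroupOf.1 (QuotientGroup.eq.1 hi)
  have h2 : Tendsto (fun p : G × G ↦ p.1 * p.2) (𝓝 (c i) ×ˢ 𝓝 ((c i)⁻¹ * k)) (𝓝 k) := by
    rw [← nhds_prod_eq]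
    exact Continuous.tendsto' (by fun_prop) _ _ (by simp)
  obtain ⟨U₁, hU₁, U₂, hU₂, hU₁₂⟩ := mem_prod_iff.1 (h2 hU)
  obtain ⟨n, h3, x, hx, hxU⟩ := (((hc i).eventually hU₁).and
    (hr'.eventually (hS.eventually_exists_germ h1 U₂ hU₂))).exists
  refine hrU (φ n) ⟨_, hU₁₂ (mk_mem_prod h3 hxU), ?_⟩
  exact (MulAction.stabilizer G (r (φ n))).mul_mem (hmem _ _ (hrep i)) (germ_le _ hx)

/-- Different points of the slice lie on different orbits. -/
theorem IsSlice.eventually_eq_of_smul (hS : IsSlice G q S) (hprop : IsSeqProper G X)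
    (hconj : ∀ x y : X, ∃ g : G, MulAction.stabilizer G y =
      (MulAction.stabilizer G x).map (MulAut.conj g).toMonoidHom) :
    ∃ W, IsOpen W ∧ q ∈ W ∧ ∀ p ∈ W ∩ S, ∀ p' ∈ W ∩ S, (∃ g : G, p' = g • p) → p = p' := by
  suffices h : ∀ᶠ p : X × X in 𝓝 q ×ˢ 𝓝 q, p.1 ∈ S → p.2 ∈ S → (∃ g : G, p.2 = g • p.1) →
      p.1 = p.2 by
    obtain ⟨W₁, hW₁, W₂, hW₂, hW⟩ := mem_prod_iff.1 h
    obtain ⟨W, hWs, hWo, hqW⟩ := mem_nhds_iff.1 (inter_mem hW₁ hW₂)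
    exact ⟨W, hWo, hqW, fun p hp p' hp' hg ↦
      hW (mk_mem_prod (hWs hp.1).1 (hWs hp'.1).2) hp.2 hp'.2 hg⟩
  by_contra hcon
  obtain ⟨x, hx, hxS⟩ := exists_seq_forall_of_frequently (not_eventually.1 hcon)
  push Not at hxS
  choose h1 h2 h3 h4 using hxS
  choose g hg using h3
  have hx1 : Tendsto (fun n ↦ (x n).1) atTop (𝓝 q) := tendsto_fst.comp hx
  have hx2 : Tendsto (fun n ↦ (x n).2) atTop (𝓝 q) := tendsto_snd.comp hx
  obtain ⟨c, φ, hφ, hc⟩ := hprop g (fun n ↦ (x n).1) q q hx1 (by simpa only [← hg] using hx2)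
  have hx1' := hx1.comp hφ.tendsto_atTop
  have hcq : c • q = q := by
    have h5 := hc.smul hx1'
    simp only [Function.comp_apply, ← hg] at h5
    exact tendsto_nhds_unique h5 (hx2.comp hφ.tendsto_atTop)
  obtain ⟨O, hO, hOR⟩ := hS.eq_of_mem
  have h6 : Tendsto (fun p : G × G ↦ p.1 * p.2⁻¹) (𝓝 c ×ˢ 𝓝 c) (𝓝 1) := by
    rw [← nhds_prod_eq]
    exact Continuous.tendsto' (by fun_prop) _ _ (by simp)
  obtain ⟨U₁, hU₁, U₂, hU₂, hU₁₂⟩ := mem_prod_iff.1 (h6 hO)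
  -- The limit `c` fixes `q`, so it is approximated by some `k` fixing the point `(x (φ n)).1`. Then
  -- `g (φ n) * k⁻¹` is small and still joins the two slice points, so local uniqueness applies.
  obtain ⟨n, h7, h8, k, hk, hkx⟩ := ((hc.eventually hU₁).and ((hx1'.eventually hOR).and
    (hx1'.eventually (hS.eventually_exists_stabilizer hprop hconj hcq U₂ hU₂)))).exists
  simp only [Function.comp_apply] at h7 h8 hkx
  have h9 : (g (φ n) * k⁻¹) • (x (φ n)).1 = (x (φ n)).2 := by
    rw [mul_smul, inv_smul_eq_iff.2 hkx.symm, ← hg]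
  have h10 := h8 1 (mem_of_mem_nhds hO) (g (φ n) * k⁻¹) (hU₁₂ (mk_mem_prod h7 hk))
    (by simpa using h1 _) (by rw [h9]; exact h2 _)
  rw [one_smul, h9] at h10
  exact h4 _ h10

end Proper

end BanachChains

/-! ### Charts of the orbit space -/

namespace BanachChains

set_option linter.unusedSectionVars false

section OrbitSpace

variable {G : Type*} [Group G] {X : Type*} [TopologicalSpace X] [MulAction G X]

theorem orbitProj_eq_iff {x y : X} : orbitProj G x = orbitProj G y ↔ ∃ g : G, y = g • x := by
  rw [eq_comm]
  refine Quotient.eq.trans ?_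
  change y ∈ MulAction.orbit G x ↔ _
  simp only [MulAction.mem_orbit_iff, eq_comm]

theorem surjective_orbitProj : Function.Surjective (orbitProj G : X → _) :=
  Quotient.mk_surjective

theorem continuous_orbitProj : Continuous (orbitProj G : X → _) := continuous_quotient_mk'

variable [TopologicalSpace G] [ContinuousSMul G X]

theorem isOpenMap_orbitProj : IsOpenMap (orbitProj G : X → _) :=
  isOpenMap_quotient_mk'_mul

theorem map_nhds_orbitProj (x : X) : map (orbitProj G) (𝓝 x) = 𝓝 (orbitProj G x) :=
  isOpenMap_orbitProj.map_nhds_eq continuous_orbitProj.continuousAt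

/-- The orbit space of a proper action is Hausdorff. -/
theorem IsSeqProper.t2Space_quotient [T2Space X] [FirstCountableTopology X]
    (hprop : IsSeqProper G X) : T2Space (MulAction.orbitRel.Quotient G X) := by
  have ho : IsOpenQuotientMap (orbitProj G : X → _) :=
    ⟨surjective_orbitProj, continuous_orbitProj, isOpenMap_orbitProj⟩
  rw [t2Space_iff_of_isOpenQuotientMap ho]
  -- Properness makes the orbit relation sequentially closed, which is enough by first countability.
  refine IsSeqClosed.isClosed fun u p hu hp ↦ ?_
  have h1 : Tendsto (fun n ↦ (u n).1) atTop (𝓝 p.1) := (continuous_fst.tendsto p).comp hp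
  have h2 : Tendsto (fun n ↦ (u n).2) atTop (𝓝 p.2) := (continuous_snd.tendsto p).comp hp
  choose g hg using fun n ↦ orbitProj_eq_iff.1 (hu n)
  obtain ⟨c, φ, hφ, hc⟩ := hprop g _ _ _ h1 (by simpa only [← hg] using h2)
  have h3 := hc.smul (h1.comp hφ.tendsto_atTop)
  simp only [Function.comp_apply, ← hg] at h3
  exact orbitProj_eq_iff.2 ⟨c, tendsto_nhds_unique (h2.comp hφ.tendsto_atTop) h3⟩

variable [IsTopologicalGroup G] [T2Space X] [FirstCountableTopology X]
  {E : Type*} [NormedAddCommGroup E] [NormedSpace ℝ E] {q : X} {S : Set X}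
  {N : Submodule ℝ E} {ψ : OpenPartialHomeomorph X E}

open Classical in
/-- A linear slice is a chart of the orbit space. -/
theorem IsSlice.exists_chart (hS : IsSlice G q S) (hprop : IsSeqProper G X)
    (hconj : ∀ x y : X, ∃ g : G, MulAction.stabilizer G y =
      (MulAction.stabilizer G x).map (MulAut.conj g).toMonoidHom)
    (hq : q ∈ ψ.source) (hSN : ∀ r, r ∈ S ↔ ψ r ∈ N) :
    ∃ (W X₀ : Set X) (B : OpenPartialHomeomorph (MulAction.orbitRel.Quotient G X) N),
      IsOpen W ∧ q ∈ W ∧ W ⊆ ψ.source ∧ IsOpen X₀ ∧ q ∈ X₀ ∧ B.source = orbitProj G '' X₀ ∧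
      (∀ r ∈ X₀, ∀ p ∈ W, ψ p ∈ N → (∃ g : G, p = g • r) → (B (orbitProj G r) : E) = ψ p) ∧
      ∀ n ∈ B.target, (n : E) ∈ ψ.target ∧ B.symm n = orbitProj G (ψ.symm n) := by
  obtain ⟨W', hW'o, hqW', hW'⟩ := hS.eventually_eq_of_smul hprop hconj
  obtain ⟨b, hbq, hb⟩ := hS.exists_retraction
  obtain ⟨V, hV, hVo, hqV⟩ := mem_nhds_iff.1 hb
  replace hV : ∀ r ∈ V, _ := hV
  set W := W' ∩ ψ.source with hWdef
  have hWo : IsOpen W := hW'o.inter ψ.open_source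
  have hW : ∀ p ∈ W, p ∈ S → ∀ p' ∈ W, p' ∈ S → (∃ g : G, p' = g • p) → p = p' :=
    fun p hp hpS p' hp' hpS' ↦ hW' p ⟨hp.1, hpS⟩ p' ⟨hp'.1, hpS'⟩
  -- Requiring both `r` and `b r` to lie in `W ∩ V` makes `X₀` stable under `b`, because `b` fixes
  -- the slice points of `V`.
  set X₀ := (W ∩ V) ∩ b ⁻¹' (W ∩ V) with hX₀
  have hX₀o : IsOpen X₀ := by
    refine ContinuousOn.isOpen_inter_preimage (fun r hr ↦ ?_) (hWo.inter hVo) (hWo.inter hVo)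
    exact (hV r hr.2).1.continuousWithinAt
  have hqX₀ : q ∈ X₀ := by
    have : q ∈ W ∩ V := ⟨⟨hqW', hq⟩, hqV⟩
    exact ⟨this, by rwa [mem_preimage, hbq]⟩
  have hbS : ∀ r ∈ X₀, b r ∈ S := fun r hr ↦ (hV r hr.1.2).2.1
  have hbg : ∀ r ∈ X₀, ∃ g : G, b r = g • r := fun r hr ↦ (hV r hr.1.2).2.2.1
  have hbX : ∀ r ∈ X₀, b r ∈ X₀ := by
    intro r hr
    refine ⟨hr.2, ?_⟩
    rw [mem_preimage, (hV _ hr.2.2).2.2.2 (hbS r hr)]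
    exact hr.2
  have hbeq : ∀ r ∈ X₀, ∀ p ∈ W, p ∈ S → (∃ g : G, p = g • r) → b r = p := by
    rintro r hr p hp hpS ⟨g, hg⟩
    refine hW _ hr.2.1 (hbS r hr) p hp hpS ?_
    obtain ⟨g', hg'⟩ := hbg r hr
    exact ⟨g * g'⁻¹, by rw [hg', smul_smul, inv_mul_cancel_right, hg]⟩
  -- The choice of representative is harmless, as `b r` is the only slice point of `W` on the orbit
  -- of `r`. The value `0` outside the image of `X₀` is irrelevant.
  let B₀ : MulAction.orbitRel.Quotient G X → N := fun y ↦
    if h : ∃ r ∈ X₀, orbitProj G r = y then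
      ⟨ψ (b h.choose), (hSN _).1 (hbS _ h.choose_spec.1)⟩ else 0
  have hB₀ : ∀ r ∈ X₀, (B₀ (orbitProj G r) : E) = ψ (b r) := by
    intro r hr
    have h : ∃ r' ∈ X₀, orbitProj G r' = orbitProj G r := ⟨r, hr, rfl⟩
    simp only [B₀, dif_pos h]
    obtain ⟨h1, h2⟩ := h.choose_spec
    congr 1
    refine hbeq _ h1 _ hr.2.1 (hbS r hr) ?_
    obtain ⟨g, hg⟩ := orbitProj_eq_iff.1 h2
    obtain ⟨g', hg'⟩ := hbg r hr
    exact ⟨g' * g, by rw [hg', mul_smul, ← hg]⟩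
  have hπb : ∀ r ∈ X₀, orbitProj G (b r) = orbitProj G r := fun r hr ↦
    (orbitProj_eq_iff.2 (hbg r hr)).symm
  let B : OpenPartialHomeomorph (MulAction.orbitRel.Quotient G X) N :=
    { toFun := B₀
      invFun := fun n ↦ orbitProj G (ψ.symm n)
      source := orbitProj G '' X₀
      target := {n | (n : E) ∈ ψ.target ∩ ψ.symm ⁻¹' X₀}
      map_source' := by
        rintro _ ⟨r, hr, rfl⟩
        have h1 := (hbX r hr).1.1.2
        simp only [mem_ofPred_eq, hB₀ r hr]
        exact ⟨ψ.map_source h1, by rw [mem_preimage, ψ.left_inv h1]; exact hbX r hr⟩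
      map_target' := fun n hn ↦ ⟨_, hn.2, rfl⟩
      left_inv' := by
        rintro _ ⟨r, hr, rfl⟩
        rw [hB₀ r hr, ψ.left_inv (hbX r hr).1.1.2, hπb r hr]
      right_inv' := by
        intro n hn
        refine Subtype.ext ?_
        have h1 : ψ.symm n ∈ S := by rw [hSN, ψ.right_inv hn.1]; exact n.2
        rw [hB₀ _ hn.2, hbeq _ hn.2 _ hn.2.1.1 h1 ⟨1, (one_smul _ _).symm⟩, ψ.right_inv hn.1]
      open_source := isOpenMap_orbitProj _ hX₀o
      open_target := (ψ.symm.isOpen_inter_preimage hX₀o).preimage continuous_subtype_val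
      continuousOn_toFun := by
        rintro _ ⟨r, hr, rfl⟩
        refine ContinuousAt.continuousWithinAt ?_
        rw [ContinuousAt, ← map_nhds_orbitProj, tendsto_map'_iff, tendsto_subtype_rng]
        simp only [Function.comp_def]
        rw [hB₀ r hr]
        have h1 : ContinuousAt (fun r ↦ ψ (b r)) r :=
          ContinuousAt.comp (ψ.continuousAt hr.2.1.2) (hV r hr.1.2).1
        refine h1.tendsto.congr' ?_
        filter_upwards [hX₀o.mem_nhds hr] with r' hr' using (hB₀ r' hr').symm
      continuousOn_invFun := fun n hn ↦
        (continuous_orbitProj.continuousAt.comp ((ψ.symm.continuousAt hn.1).comp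
          continuous_subtype_val.continuousAt)).continuousWithinAt }
  refine ⟨W, X₀, B, hWo, ⟨hqW', hq⟩, inter_subset_right, hX₀o, hqX₀, rfl, ?_, ?_⟩
  · intro r hr p hp hpN hg
    exact (hB₀ r hr).trans (by rw [hbeq r hr p hp ((hSN p).2 hpN) hg])
  · exact fun n hn ↦ ⟨hn.1, rfl⟩

end OrbitSpace

end BanachChains

/-! ### Existence of the slicing map -/

namespace BanachChains

set_option linter.unusedSectionVars false

variable {s₀ : ℝ} {E : Ioi s₀ → Type*} [∀ s, NormedAddCommGroup (E s)] [∀ s, NormedSpace ℝ (E s)]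
  [∀ s, CompleteSpace (E s)]
  {Q : Ioi s₀ → Type*} [∀ s, TopologicalSpace (Q s)] [∀ s, ChartedSpace (E s) (Q s)]
  [∀ s, IsManifold 𝓘(ℝ, E s) ∞ (Q s)]
  {EG : Type*} [NormedAddCommGroup EG] [NormedSpace ℝ EG] [FiniteDimensional ℝ EG]
  {G : Type*} [TopologicalSpace G] [ChartedSpace EG G] [Group G]
  [LieGroup 𝓘(ℝ, EG) ∞ G] [∀ s, MulAction G (Q s)]
  {F : Type*} [NormedAddCommGroup F] [NormedSpace ℝ F]

/-- With `g₁` the value of the section at `[e]`, which need not be `1`, right translation by `g₁⁻¹`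
makes the section pass through the unit. -/
theorem IsLocalSection.contMDiffAt_retraction {H : Subgroup G} {V₀ : Set (G ⧸ H)}
    {χ : G ⧸ H → G} (hχ : IsLocalSection EG H V₀ χ) {g₁ : G} (hg₁ : (g₁ : G ⧸ H) ∈ V₀) :
    ContMDiffAt 𝓘(ℝ, EG) 𝓘(ℝ, EG) ∞ (fun g : G ↦ χ ((g * g₁ : G) : G ⧸ H) * g₁⁻¹) 1 := by
  have : IsTopologicalGroup G := topologicalGroup_of_lieGroup 𝓘(ℝ, EG) ∞
  have h1 : ContMDiffAt 𝓘(ℝ, EG) 𝓘(ℝ, EG) ∞ (fun g : G ↦ χ (g : G ⧸ H)) (1 * g₁) := by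
    refine hχ.contMDiffOn.contMDiffAt
      ((hχ.isOpen.preimage QuotientGroup.continuous_mk).mem_nhds ?_)
    rwa [one_mul]
  have h2 : ContMDiffAt 𝓘(ℝ, EG) 𝓘(ℝ, EG) ∞ (fun g : G ↦ g * g₁) 1 :=
    contMDiffAt_id.mul contMDiffAt_const
  exact (ContMDiffAt.comp (x := (1 : G)) h1 h2).mul contMDiffAt_const

/-- The problem is lifted from `G / G_q` to `G`: near `1` the translated section is the fixed-point
set of the retraction `ρ`. One solves `η a = a` and `l (f (a, z)) = 0` together. They are
transversal because the derivative `P` of `η` is a projection with the same kernel as `D`. Conjugacy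
of isotropy groups is not needed. -/
theorem IsOrbitChart.exists_isSlicingMap {s : Ioi s₀} {q : Q s} [ContinuousSMul G (Q s)]
    (hsm : ∀ g : G, ContMDiff 𝓘(ℝ, E s) 𝓘(ℝ, E s) ∞ (fun x : Q s ↦ g • x))
    {ι : E s →L[ℝ] F} {ψ : OpenPartialHomeomorph (Q s) (E s)} (h : IsOrbitChart EG G ι q ψ)
    (hψ : ψ ∈ IsManifold.maximalAtlas 𝓘(ℝ, E s) ∞ (Q s)) {l : F →L[ℝ] EG}
    (hl : ∀ v, orbitTangent EG G ι ψ (l (orbitTangent EG G ι ψ v)) = orbitTangent EG G ι ψ v)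
    (hl' : ∀ y, l (orbitTangent EG G ι ψ (l y)) = l y)
    {N : Submodule ℝ (TangentSpace 𝓘(ℝ, E s) q)}
    (hN : ∀ v : E s, (v : TangentSpace 𝓘(ℝ, E s) q) ∈ N ↔ l (ι v) = 0)
    {V₀ : Set (G ⧸ MulAction.stabilizer G q)} {χ : G ⧸ MulAction.stabilizer G q → G}
    (hχ : IsLocalSection EG (MulAction.stabilizer G q) V₀ χ) :
    ∃ V U β, IsSlicingMap EG N ψ V₀ χ V U β := by
  have : IsTopologicalGroup G := topologicalGroup_of_lieGroup 𝓘(ℝ, EG) ∞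
  have : CompleteSpace EG := FiniteDimensional.complete ℝ EG
  have h1s := mem_chart_source EG (1 : G)
  have h1t := mem_chart_target EG (1 : G)
  have ht1s := tendsto_chart_symm_one (EG := EG) (G := G)
  have htend := h.tendsto_smul
  have hker := h.ker_eq.self_of_nhds
  rw [h.symm_zero] at hker
  have hdiff := h.differentiableAt_orbitMap_left
  have hfC : ContDiffAt ℝ 1 (orbitMap EG G ι ψ) (chartAt EG (1 : G) 1, 0) := h.contDiffAt
  have hκm : chartAt EG (1 : G) ∈ IsManifold.maximalAtlas 𝓘(ℝ, EG) ∞ G :=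
    IsManifold.chart_mem_maximalAtlas 1
  set D := orbitTangent EG G ι ψ with hD
  set f := orbitMap EG G ι ψ with hf
  set κ := chartAt EG (1 : G) with hκ
  set o := κ 1 with ho
  have hκ1 : κ.symm o = 1 := κ.left_inv h1s
  have hD0 : ∀ v, fderiv ℝ f (o, 0) (v, 0) = D v := fun v ↦ (hdiff.self_of_nhds.2 v).symm
  have hfD : HasFDerivAt (fun a ↦ f (a, 0)) D o :=
    (DifferentiableAt.comp (𝕜 := ℝ) o (g := f) (f := fun a ↦ (a, (0 : E s)))
      hdiff.self_of_nhds.1 (by fun_prop)).hasFDerivAt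
  -- the local retraction of `G` onto the translated section
  set g₁ := χ ((1 : G) : G ⧸ MulAction.stabilizer G q) with hg₁
  have hg₁K : ((g₁ : G) : G ⧸ MulAction.stabilizer G q) = ((1 : G) : G ⧸ MulAction.stabilizer G q) := hχ.mk_section _ hχ.one_mem
  have hg₁q : g₁ • q = q := by
    have h1 : g₁⁻¹ ∈ MulAction.stabilizer G q := by simpa using QuotientGroup.eq.1 hg₁K
    exact inv_mem_iff.1 h1
  let ρ : G → G := fun g ↦ χ ((g * g₁ : G) : G ⧸ MulAction.stabilizer G q) * g₁⁻¹
  have hρ1 : ρ 1 = 1 := by simp [ρ, hg₁K, ← hg₁]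
  have hρC : ContMDiffAt 𝓘(ℝ, EG) 𝓘(ℝ, EG) ∞ ρ 1 :=
    hχ.contMDiffAt_retraction (by rw [hg₁K]; exact hχ.one_mem)
  have hmk : ∀ g : G, ((g * g₁ : G) : G ⧸ MulAction.stabilizer G q) ∈ V₀ →
      ((ρ g * g₁ : G) : G ⧸ MulAction.stabilizer G q) = ((g * g₁ : G) : G ⧸ MulAction.stabilizer G q) := by
    intro g hg
    simp only [ρ, inv_mul_cancel_right]
    exact hχ.mk_section _ hg
  have hρρ : ∀ g : G, ((g * g₁ : G) : G ⧸ MulAction.stabilizer G q) ∈ V₀ → ρ (ρ g) = ρ g := by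
    intro g hg
    change χ ((ρ g * g₁ : G) : G ⧸ MulAction.stabilizer G q) * g₁⁻¹ = ρ g
    rw [hmk g hg]
  have hρq : ∀ g : G, ((g * g₁ : G) : G ⧸ MulAction.stabilizer G q) ∈ V₀ → ρ g • q = g • q := by
    intro g hg
    have h1 : (g * g₁)⁻¹ * (ρ g * g₁) ∈ MulAction.stabilizer G q := QuotientGroup.eq.1 (hmk g hg).symm
    have h2 : ((g * g₁)⁻¹ * (ρ g * g₁)) • q = q := h1
    rwa [mul_smul, inv_smul_eq_iff, mul_smul (ρ g), mul_smul g, hg₁q] at h2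
  have hρK : ∀ g ∈ MulAction.stabilizer G q, ρ g = 1 := by
    intro g hg
    have h1 : ((g * g₁ : G) : G ⧸ MulAction.stabilizer G q) = ((1 : G) : G ⧸ MulAction.stabilizer G q) := by
      refine QuotientGroup.eq.2 ?_
      rw [mul_one]
      exact inv_mem (mul_mem hg hg₁q)
    simp only [ρ, h1, ← hg₁, mul_inv_cancel]
  have hV₀ : ∀ᶠ g in 𝓝 (1 : G), ((g * g₁ : G) : G ⧸ MulAction.stabilizer G q) ∈ V₀ := by
    have h1 : Tendsto (fun g : G ↦ ((g * g₁ : G) : G ⧸ MulAction.stabilizer G q)) (𝓝 1) (𝓝 ((1 : G) : G ⧸ MulAction.stabilizer G q)) :=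
      Continuous.tendsto' (QuotientGroup.continuous_mk.comp (by fun_prop)) _ _ (by simpa using hg₁K)
    exact h1.eventually (hχ.isOpen.mem_nhds hχ.one_mem)
  have hρt : Tendsto ρ (𝓝 1) (𝓝 1) := by
    have := hρC.continuousAt.tendsto
    rwa [hρ1] at this
  -- the retraction in the chart
  let η : EG → EG := fun a ↦ κ (ρ (κ.symm a))
  have hηo : η o = o := by simp only [η, hκ1, hρ1, ← ho]
  have hηC : ContDiffAt ℝ 1 η o := by
    rw [← contMDiffAt_iff_contDiffAt]
    have e1 : ContMDiffAt 𝓘(ℝ, EG) 𝓘(ℝ, EG) ∞ κ.symm o := contMDiffAt_chart_symm hκm h1t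
    have e2 : ContMDiffAt 𝓘(ℝ, EG) 𝓘(ℝ, EG) ∞ ρ (κ.symm o) := by rwa [hκ1]
    have e3 : ContMDiffAt 𝓘(ℝ, EG) 𝓘(ℝ, EG) ∞ (fun a ↦ ρ (κ.symm a)) o :=
      ContMDiffAt.comp (x := o) e2 e1
    have e4 : ContMDiffAt 𝓘(ℝ, EG) 𝓘(ℝ, EG) ∞ κ (ρ (κ.symm o)) := by
      rw [hκ1, hρ1]
      exact contMDiffAt_chart hκm h1s
    exact (ContMDiffAt.comp (x := o) e4 e3).of_le (by norm_cast)
  set P := fderiv ℝ η o with hP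
  have hηd : HasFDerivAt η P o := (hηC.differentiableAt (by simp)).hasFDerivAt
  have hηs : HasStrictFDerivAt η P o := hηC.hasStrictFDerivAt (by simp)
  have hηev : ∀ᶠ a in 𝓝 o, a ∈ κ.target ∧ ρ (κ.symm a) ∈ κ.source ∧
      ((κ.symm a * g₁ : G) : G ⧸ MulAction.stabilizer G q) ∈ V₀ ∧ η (η a) = η a ∧ f (η a, 0) = f (a, 0) := by
    filter_upwards [κ.open_target.mem_nhds h1t,
      (hρt.comp ht1s).eventually (κ.open_source.mem_nhds h1s), ht1s.eventually hV₀] with a h1 h2 h3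
    replace h2 : ρ (κ.symm a) ∈ κ.source := h2
    refine ⟨h1, h2, h3, ?_, ?_⟩
    · simp only [η]
      rw [κ.left_inv h2, hρρ _ h3]
    · simp only [η, hf, orbitMap, ← hκ]
      rw [κ.left_inv h2, h.symm_zero, hρq _ h3]
  have hPP : ∀ v, P (P v) = P v := by
    have h1 : HasFDerivAt (fun a ↦ η (η a)) (P.comp P) o := by
      refine HasFDerivAt.comp (g := η) o ?_ hηd
      rwa [hηo]
    have h2 : HasFDerivAt (fun a ↦ η (η a)) P o := by
      refine hηd.congr_of_eventuallyEq ?_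
      filter_upwards [hηev] with a ha using ha.2.2.2.1
    exact fun v ↦ congrArg (fun L : EG →L[ℝ] EG ↦ L v) (h1.unique h2)
  have hDP : ∀ v, D (P v) = D v := by
    have h1 : HasFDerivAt (fun a ↦ f (η a, 0)) (D.comp P) o := by
      refine HasFDerivAt.comp (g := fun a ↦ f (a, 0)) o ?_ hηd
      rwa [hηo]
    have h2 : HasFDerivAt (fun a ↦ f (η a, 0)) D o := by
      refine hfD.congr_of_eventuallyEq ?_
      filter_upwards [hηev] with a ha using ha.2.2.2.2
    exact fun v ↦ congrArg (fun L : EG →L[ℝ] F ↦ L v) (h1.unique h2)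
  -- A vector killed by `D` is the velocity of a curve in `G_q`, and `ρ` sends `G_q` to `1`.
  have hkerP : ∀ v, D v = 0 → P v = 0 := by
    intro v hv
    obtain ⟨c, hc0, hcd, hcK⟩ := (hker v).1 (by
      rw [← hv, hD, orbitTangent]
      simp only [orbitMap, h.symm_zero, ← hκ, ← ho])
    have h1 : HasDerivAt (fun t ↦ η (c t)) (P v) 0 := by
      refine HasFDerivAt.comp_hasDerivAt (0 : ℝ) (f := c) (l := η) ?_ hcd
      rwa [hc0]
    refine h1.unique ((hasDerivAt_const (0 : ℝ) o).congr_of_eventuallyEq ?_)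
    filter_upwards [hcK] with t ht
    have h2 : ρ (κ.symm (c t)) = 1 := hρK _ ht
    simp only [η, h2, ← ho]
  have hPlD : ∀ v, P (l (D v)) = P v := by
    intro v
    have h1 : P (l (D v) - v) = 0 := hkerP _ (by rw [map_sub, hl, sub_self])
    rwa [map_sub, sub_eq_zero] at h1
  -- the equation for the slicing map
  let Θ : EG × E s → EG := fun p ↦ (p.1 - η p.1) - P (p.1 - η p.1) + P (l (f p))
  have hΘ : ContDiffAt ℝ 1 Θ (o, 0) := by
    have h1 : ContDiffAt ℝ 1 (fun p : EG × E s ↦ p.1 - η p.1) (o, 0) :=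
      contDiffAt_fst.sub (ContDiffAt.comp (o, (0 : E s)) (g := η) (f := Prod.fst) hηC contDiffAt_fst)
    exact (h1.sub (P.contDiff.contDiffAt.comp (o, (0 : E s)) h1)).add
      (P.contDiff.contDiffAt.comp (o, (0 : E s)) (l.contDiff.contDiffAt.comp (o, (0 : E s)) hfC))
  -- The derivative is `(1 - P) - P (1 - P) + P l D = 1`, from `P P = P` and `P l D = P`.
  have hΘd : ∀ v, fderiv ℝ Θ (o, 0) (v, 0) = v := by
    intro v
    have h0 : HasFDerivAt (fun p : EG × E s ↦ η p.1) (P.comp (ContinuousLinearMap.fst ℝ EG (E s)))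
        (o, 0) := HasFDerivAt.comp (g := η) (o, (0 : E s)) hηd hasFDerivAt_fst
    have h1 := (hasFDerivAt_fst (𝕜 := ℝ) (p := (o, (0 : E s)))).sub h0
    have h2 : HasFDerivAt f (fderiv ℝ f (o, 0)) (o, 0) :=
      (hfC.differentiableAt (by simp)).hasFDerivAt
    have h3 := (h1.sub (P.hasFDerivAt.comp (o, (0 : E s)) h1)).add
      (P.hasFDerivAt.comp (o, (0 : E s)) (l.hasFDerivAt.comp (o, (0 : E s)) h2))
    have h4 : fderiv ℝ Θ (o, 0) = _ := HasFDerivAt.fderiv h3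
    rw [h4]
    simp [hD0, hPlD, hPP]
  have hf0 : f (o, 0) = 0 := by
    simp only [hf, orbitMap, ← hκ, hκ1, one_smul, h.symm_zero, h.map_eq_zero, map_zero]
  have hΘo : Θ (o, 0) = 0 := by simp [Θ, hηo, hf0]
  obtain ⟨A, hA, hA0, hAΘ, hΘA⟩ := exists_parametric_inverse hΘ hΘd
  rw [hΘo] at hA hA0 hΘA
  simp only at hA hA0 hΘA
  let α : E s → EG := fun z ↦ A (0, z)
  have hz0 : Tendsto (fun z : E s ↦ ((0 : EG), z)) (𝓝 0) (𝓝 (0, 0)) :=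
    Continuous.tendsto' (by fun_prop) _ _ rfl
  have hα : ContDiffAt ℝ 1 α 0 :=
    ContDiffAt.comp (0 : E s) (g := A) (f := fun z : E s ↦ ((0 : EG), z)) hA
      (contDiffAt_const.prodMk contDiffAt_id)
  have hα0 : α 0 = o := hA0
  have hαt : Tendsto α (𝓝 0) (𝓝 o) := by
    have := hα.continuousAt.tendsto
    rwa [hα0] at this
  -- Applying `P` to `Θ = 0` gives `P (l f) = 0`, whence `l f = l D (l f) = l D P (l f) = 0`. What
  -- remains is `P (a - η a) = a - η a`. Since `η (η a) = η a`, strict differentiability bounds its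
  -- norm by half of itself, so `η a = a`.
  have hsol : ∀ᶠ a in 𝓝 o, ∀ z, Θ (a, z) = 0 → η a = a ∧ l (f (a, z)) = 0 := by
    have h1 : Tendsto (fun a ↦ (a, η a)) (𝓝 o) (𝓝 (o, o)) := by
      have := hηC.continuousAt.tendsto
      rw [hηo] at this
      exact tendsto_id.prodMk_nhds this
    have h2 := h1.eventually (hηs.isLittleO.def (show (0 : ℝ) < 1 / 2 by norm_num))
    filter_upwards [h2, hηev] with a h3 h4 z hz
    have h5 : P (l (f (a, z))) = 0 := by
      have := congrArg P hz
      simpa only [Θ, map_add, map_sub, hPP, sub_self, zero_add, map_zero] using this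
    have h6 : P (a - η a) = a - η a := by
      have : (a - η a) - P (a - η a) + P (l (f (a, z))) = 0 := hz
      rw [h5, add_zero, sub_eq_zero] at this
      exact this.symm
    refine ⟨?_, ?_⟩
    · rw [h4.2.2.2.1, sub_self, zero_sub, norm_neg, h6] at h3
      have h7 : ‖a - η a‖ = 0 := by
        have := norm_nonneg (a - η a)
        linarith
      exact (sub_eq_zero.1 (norm_eq_zero.1 h7)).symm
    · have := hDP (l (f (a, z)))
      rw [h5, map_zero] at this
      rw [← hl', ← this, map_zero]
  have hmain : ∀ᶠ p in 𝓝 (o, (0 : E s)),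
      ((η p.1 = p.1 ∧ l (f p) = 0) ↔ p.1 = α p.2) ∧ κ.symm p.1 • ψ.symm p.2 ∈ ψ.source := by
    have e1 : Tendsto (fun p : EG × E s ↦ p.1) (𝓝 (o, 0)) (𝓝 o) := continuous_fst.tendsto _
    have e2 : Tendsto (fun p : EG × E s ↦ p.2) (𝓝 (o, 0)) (𝓝 0) := continuous_snd.tendsto _
    filter_upwards [hAΘ, e1.eventually hsol, (hz0.comp e2).eventually hΘA,
      htend.eventually (ψ.open_source.mem_nhds h.mem_source)] with p h1 h2 h3 h4
    refine ⟨⟨fun h5 ↦ ?_, fun h5 ↦ ?_⟩, h4⟩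
    · have h6 : Θ p = 0 := by simp [Θ, h5.1, h5.2]
      rw [← h1, h6]
    · refine h2 p.2 ?_
      rw [h5]
      exact h3
  rw [nhds_prod_eq] at hmain
  obtain ⟨O', hO', Z, hZ, hOZ⟩ := mem_prod_iff.1 hmain
  obtain ⟨O, hOO', hO, hoO⟩ := mem_nhds_iff.1 hO'
  replace hOZ : ∀ a ∈ O, ∀ z ∈ Z, _ := fun a ha z hz ↦ hOZ (mk_mem_prod (hOO' ha) hz)
  have hzs : ∀ᶠ z in 𝓝 (0 : E s), z ∈ Z ∧ α z ∈ O ∧ ContDiffAt ℝ 1 α z ∧ α z ∈ κ.target ∧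
      ρ (κ.symm (α z)) ∈ κ.source ∧ ((κ.symm (α z) * g₁ : G) : G ⧸ MulAction.stabilizer G q) ∈ V₀ := by
    filter_upwards [hZ, hαt (hO.mem_nhds hoO), hα.eventually (by simp), hαt.eventually hηev]
      with z h1 h2 h3 h4 using ⟨h1, h2, h3, h4.1, h4.2.1, h4.2.2.1⟩
  -- The equation is used at `g₁ • r`, since `χ x • r = (χ x * g₁⁻¹) • (g₁ • r)` and `g₁` fixes `q`.
  have hqt : Tendsto (fun r : Q s ↦ g₁ • r) (𝓝 q) (𝓝 q) :=
    (continuous_const_smul g₁).tendsto' _ _ hg₁q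
  have hUev : ∀ᶠ r in 𝓝 q, g₁ • r ∈ ψ.source ∧ _ :=
    (hqt.eventually (ψ.open_source.mem_nhds h.mem_source)).and
      ((h.tendsto_chart.comp hqt).eventually hzs)
  obtain ⟨U, hUs, hUo, hqU⟩ := mem_nhds_iff.1 hUev
  replace hUs : ∀ r ∈ U, _ := hUs
  let V : Set (G ⧸ MulAction.stabilizer G q) := {x | x ∈ V₀ ∧ χ x * g₁⁻¹ ∈ κ.source ∩ κ ⁻¹' O}
  let β : Q s → G ⧸ MulAction.stabilizer G q := fun r ↦ ((κ.symm (α (ψ (g₁ • r))) * g₁ : G) : G ⧸ MulAction.stabilizer G q)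
  have hχβ : ∀ r ∈ U, χ (β r) = κ.symm (α (ψ (g₁ • r))) * g₁ := by
    intro r hr
    obtain ⟨h1, h2, h3, h4, h5, h6, h7⟩ := hUs r hr
    simp only [Function.comp_apply] at h1 h2 h3 h4 h5 h6 h7
    have h8 : η (α (ψ (g₁ • r))) = α (ψ (g₁ • r)) := ((hOZ _ h3 _ h2).1.2 rfl).1
    have h9 : ρ (κ.symm (α (ψ (g₁ • r)))) = κ.symm (α (ψ (g₁ • r))) := by
      rw [← κ.left_inv h6]
      exact congrArg κ.symm h8
    rw [← h9]
    simp only [ρ, β, inv_mul_cancel_right]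
  refine ⟨V, U, β, ?_, ?_, fun x hx ↦ hx.1, hUo, hqU, ?_, ?_, ?_, ?_⟩
  · rw [← isQuotientMap_quotient_mk'.isOpen_preimage]
    have h1 : ContinuousOn (fun g : G ↦ χ (g : G ⧸ MulAction.stabilizer G q) * g₁⁻¹) ((fun g : G ↦ (g : G ⧸ MulAction.stabilizer G q)) ⁻¹' V₀) :=
      hχ.contMDiffOn.continuousOn.mul continuousOn_const
    exact h1.isOpen_inter_preimage (hχ.isOpen.preimage QuotientGroup.continuous_mk)
      (κ.isOpen_inter_preimage hO)
  · refine ⟨hχ.one_mem, ?_⟩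
    rw [← hg₁, mul_inv_cancel]
    exact ⟨h1s, hoO⟩
  · intro r hr
    obtain ⟨h1, h2, h3, h4, h5, h6, h7⟩ := hUs r hr
    simp only [Function.comp_apply] at h1 h2 h3 h4 h5 h6 h7
    refine ⟨h7, ?_⟩
    rw [hχβ r hr, mul_inv_cancel_right]
    exact ⟨κ.map_target h5, by rwa [mem_preimage, κ.right_inv h5]⟩
  · intro x hx r hr
    obtain ⟨h1, h2, -⟩ := hUs r hr
    simp only [Function.comp_apply] at h1 h2
    have h3 := (hOZ _ hx.2.2 _ h2).2
    rwa [κ.left_inv hx.2.1, ψ.left_inv h1, smul_smul, inv_mul_cancel_right] at h3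
  · intro r hr
    obtain ⟨h1, h2, h3, h4, h5, h6, h7⟩ := hUs r hr
    simp only [Function.comp_apply] at h1 h2 h3 h4 h5 h6 h7
    have e1 : ContMDiffAt 𝓘(ℝ, E s) 𝓘(ℝ, E s) 1 (fun r : Q s ↦ ψ (g₁ • r)) r :=
      (ContMDiffAt.comp (x := r) (contMDiffAt_chart hψ h1) (hsm g₁).contMDiffAt).of_le
        (by norm_cast)
    have e2 : ContMDiffAt 𝓘(ℝ, E s) 𝓘(ℝ, EG) 1 (fun r : Q s ↦ α (ψ (g₁ • r))) r :=
      ContMDiffAt.comp (x := r) (g := α) (f := fun r : Q s ↦ ψ (g₁ • r)) h4.contMDiffAt e1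
    have e3 : ContMDiffAt 𝓘(ℝ, E s) 𝓘(ℝ, EG) 1 (fun r : Q s ↦ κ.symm (α (ψ (g₁ • r)))) r :=
      ContMDiffAt.comp (x := r) ((contMDiffAt_chart_symm hκm h5).of_le (by norm_cast)) e2
    have e4 : ContMDiffAt 𝓘(ℝ, EG) 𝓘(ℝ, EG) 1 (fun g : G ↦ g * g₁) (κ.symm (α (ψ (g₁ • r)))) := by
      have : ContMDiffAt 𝓘(ℝ, EG) 𝓘(ℝ, EG) ∞ (fun g : G ↦ g * g₁) (κ.symm (α (ψ (g₁ • r)))) :=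
        contMDiffAt_id.mul contMDiffAt_const
      exact this.of_le (by norm_cast)
    have e5 : ContMDiffAt 𝓘(ℝ, E s) 𝓘(ℝ, EG) 1
        (fun r : Q s ↦ κ.symm (α (ψ (g₁ • r))) * g₁) r := ContMDiffAt.comp (x := r) e4 e3
    refine (e5.congr_of_eventuallyEq ?_).contMDiffWithinAt
    filter_upwards [hUo.mem_nhds hr] with r' hr' using hχβ r' hr'
  · intro x hx r hr
    obtain ⟨h1, h2, h3, h4, h5, h6, h7⟩ := hUs r hr
    simp only [Function.comp_apply] at h1 h2 h3 h4 h5 h6 h7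
    have h8 := (hOZ _ hx.2.2 _ h2).1
    have h9 : f (κ (χ x * g₁⁻¹), ψ (g₁ • r)) = ι (ψ (χ x • r)) := by
      simp only [hf, orbitMap, ← hκ]
      rw [κ.left_inv hx.2.1, ψ.left_inv h1, smul_smul, inv_mul_cancel_right]
    have h10 : η (κ (χ x * g₁⁻¹)) = κ (χ x * g₁⁻¹) := by
      simp only [η, ρ]
      rw [κ.left_inv hx.2.1, inv_mul_cancel_right, hχ.mk_section x hx.1]
    simp only [h9, h10, true_and] at h8
    rw [hN, h8]
    constructor
    · intro h11
      have h12 : χ x * g₁⁻¹ = κ.symm (α (ψ (g₁ • r))) := by rw [← h11, κ.left_inv hx.2.1]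
      rw [← hχ.mk_section x hx.1, mul_inv_eq_iff_eq_mul.1 h12]
    · intro h11
      rw [h11, hχβ r hr, mul_inv_cancel_right, κ.right_inv h5]

end BanachChains

/-! ### Linear algebra of the normal spaces -/

namespace BanachChains

section Linear

variable {V F : Type*} [NormedAddCommGroup V] [NormedSpace ℝ V] [FiniteDimensional ℝ V]
  [NormedAddCommGroup F] [NormedSpace ℝ F]

/-- The orthogonal projection onto the range of `D`, followed by a right inverse of `D`. -/
theorem exists_orthogonal_pseudoinverse (β : F →L[ℝ] F →L[ℝ] ℝ) (hβ : ∀ v, v ≠ 0 → 0 < β v v)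
    (D : V →L[ℝ] F) : ∃ l : F →L[ℝ] V, (∀ v, D (l (D v)) = D v) ∧ (∀ y, l (D (l y)) = l y) ∧
      ∀ y, l y = 0 ↔ ∀ v, β y (D v) = 0 := by
  let R : Submodule ℝ F := (D : V →ₗ[ℝ] F).range
  let ρ : F →L[ℝ] R →L[ℝ] ℝ := ((ContinuousLinearMap.compL ℝ R F ℝ).flip R.subtypeL).comp β
  have hρ : ∀ y (r : R), ρ y r = β y r := fun y r ↦ rfl
  let B : R →ₗ[ℝ] R →L[ℝ] ℝ := (ρ : F →ₗ[ℝ] R →L[ℝ] ℝ).comp R.subtype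
  have hB : Function.Injective B := by
    rw [injective_iff_map_eq_zero]
    intro r hr
    by_contra hne
    have h1 : β (r : F) (r : F) = 0 := congrArg (fun L : R →L[ℝ] ℝ ↦ L r) hr
    exact (hβ r (fun h ↦ hne (Subtype.ext h))).ne' h1
  have hdim : Module.finrank ℝ R = Module.finrank ℝ (R →L[ℝ] ℝ) := by
    rw [← (LinearMap.toContinuousLinearMap (𝕜 := ℝ) (E := R) (F' := ℝ)).finrank_eq]
    exact Subspace.dual_finrank_eq.symm
  -- On the finite-dimensional range positive definiteness alone represents all functionals, so
  -- orthogonal projection onto it exists even for a weak inner product: it is `y ↦ e.symm (ρ y)`.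
  let e := LinearMap.linearEquivOfInjective B hB hdim
  obtain ⟨σ, hσ⟩ := (D : V →ₗ[ℝ] F).rangeRestrict.exists_rightInverse_of_surjective
    (LinearMap.range_rangeRestrict _)
  have hDσ : ∀ r : R, D (σ r) = r := fun r ↦
    congrArg Subtype.val (congrArg (fun L : R →ₗ[ℝ] R ↦ L r) hσ)
  let l : F →L[ℝ] V := (LinearMap.toContinuousLinearMap (σ ∘ₗ e.symm.toLinearMap)).comp ρ
  have hle : ∀ y, l y = σ (e.symm (ρ y)) := fun y ↦ rfl
  have hDl : ∀ y, D (l y) = e.symm (ρ y) := fun y ↦ by rw [hle, hDσ]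
  have heR : ∀ r : R, e.symm (ρ r) = r := by
    intro r
    rw [LinearEquiv.symm_apply_eq]
    rfl
  refine ⟨l, fun v ↦ ?_, fun y ↦ ?_, fun y ↦ ?_⟩
  · rw [hDl]
    exact congrArg Subtype.val (heR ⟨D v, v, rfl⟩)
  · rw [hle (D (l y)), hDl, heR, ← hle]
  · constructor
    · intro h v
      have h1 : (e.symm (ρ y) : F) = 0 := by rw [← hDl, h, map_zero]
      have h2 : ρ y = 0 := by
        have h3 : e.symm (ρ y) = 0 := Subtype.ext h1
        rwa [LinearEquiv.map_eq_zero_iff] at h3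
      exact (hρ y ⟨D v, v, rfl⟩).symm.trans (by rw [h2]; rfl)
    · intro h
      have h2 : ρ y = 0 := by
        ext ⟨_, v, rfl⟩
        exact h v
      rw [hle, h2, map_zero, map_zero]

/-- Each of the two maps carries the range of the other onto its own range. -/
theorem finrank_range_eq_of_pseudoinverse {D : V →L[ℝ] F} {l : F →L[ℝ] V}
    (hl : ∀ v, D (l (D v)) = D v) (hl' : ∀ y, l (D (l y)) = l y) :
    Module.finrank ℝ (l : F →ₗ[ℝ] V).range = Module.finrank ℝ (D : V →ₗ[ℝ] F).range := by
  refine le_antisymm ?_ ?_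
  · have h : (l : F →ₗ[ℝ] V).range ≤ (D : V →ₗ[ℝ] F).range.map (l : F →ₗ[ℝ] V) := by
      rintro _ ⟨y, rfl⟩
      exact ⟨D (l y), ⟨l y, rfl⟩, hl' y⟩
    exact (Submodule.finrank_mono h).trans (Submodule.finrank_map_le _ _)
  · have h : (D : V →ₗ[ℝ] F).range ≤ (l : F →ₗ[ℝ] V).range.map (D : V →ₗ[ℝ] F) := by
      rintro _ ⟨v, rfl⟩
      exact ⟨l (D v), ⟨D v, rfl⟩, hl v⟩
    exact (Submodule.finrank_mono h).trans (Submodule.finrank_map_le _ _)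

variable {E : Type*} [NormedAddCommGroup E] [NormedSpace ℝ E]

/-- A finite-dimensional range is closed, so a dense set of arguments already fills it. Hence
passing from `Q^{s-1}` to `Q^s` does not change the codimension of the normal space. -/
theorem range_comp_eq_of_denseRange {ι : E →L[ℝ] F} (hι : DenseRange ι) (l : F →L[ℝ] V) :
    (l.comp ι : E →ₗ[ℝ] V).range = (l : F →ₗ[ℝ] V).range := by
  refine le_antisymm ?_ ?_
  · rintro _ ⟨v, rfl⟩
    exact ⟨ι v, rfl⟩
  · rintro _ ⟨y, rfl⟩
    have hcl : IsClosed ((l.comp ι : E →ₗ[ℝ] V).range : Set V) :=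
      Submodule.closed_of_finiteDimensional _
    have h1 : y ∈ closure (range ι) := hι y
    have h2 : l y ∈ closure (l '' range ι) :=
      image_closure_subset_closure_image l.continuous ⟨y, h1, rfl⟩
    refine hcl.closure_subset_iff.2 ?_ h2
    rintro _ ⟨_, ⟨v, rfl⟩, rfl⟩
    exact ⟨v, rfl⟩

/-- Rank-nullity for the first projection restricted to the joint range: its kernel is the image of
`ker A` under `A'`. -/
theorem finrank_range_prod (A A' : E →L[ℝ] V) :
    Module.finrank ℝ (A.prod A' : E →ₗ[ℝ] V × V).range =
      Module.finrank ℝ (A : E →ₗ[ℝ] V).range +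
      Module.finrank ℝ (A'.comp (A : E →ₗ[ℝ] V).ker.subtypeL :
        (A : E →ₗ[ℝ] V).ker →ₗ[ℝ] V).range := by
  set T := (A.prod A' : E →ₗ[ℝ] V × V).range with hT
  let p : T →ₗ[ℝ] V := (LinearMap.fst ℝ V V).comp T.subtype
  have h1 := LinearMap.finrank_range_add_finrank_ker p
  have h2 : p.range = (A : E →ₗ[ℝ] V).range := by
    ext y
    constructor
    · rintro ⟨⟨_, x, rfl⟩, rfl⟩
      exact ⟨x, rfl⟩
    · rintro ⟨x, rfl⟩
      exact ⟨⟨_, x, rfl⟩, rfl⟩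
  let p' : p.ker →ₗ[ℝ] V := ((LinearMap.snd ℝ V V).comp T.subtype).comp p.ker.subtype
  have h3 : Function.Injective p' := by
    intro x y hxy
    refine Subtype.ext (Subtype.ext (Prod.ext ?_ hxy))
    exact (LinearMap.mem_ker.1 x.2).trans (LinearMap.mem_ker.1 y.2).symm
  have h4 : p'.range = (A'.comp (A : E →ₗ[ℝ] V).ker.subtypeL :
      (A : E →ₗ[ℝ] V).ker →ₗ[ℝ] V).range := by
    ext y
    constructor
    · rintro ⟨⟨⟨_, x, rfl⟩, hx⟩, rfl⟩
      exact ⟨⟨x, hx⟩, rfl⟩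
    · rintro ⟨⟨x, hx⟩, rfl⟩
      exact ⟨⟨⟨_, x, rfl⟩, hx⟩, rfl⟩
  rw [← h1, h2, ← h4, LinearMap.finrank_range_of_inj h3]

theorem nonempty_equiv_range_prod_ker (T : E →L[ℝ] V) :
    Nonempty (E ≃L[ℝ] (T : E →ₗ[ℝ] V).range × (T : E →ₗ[ℝ] V).ker) := by
  obtain ⟨σ, hσ⟩ := (T : E →ₗ[ℝ] V).rangeRestrict.exists_rightInverse_of_surjective
    (LinearMap.range_rangeRestrict _)
  let T' : E →L[ℝ] (T : E →ₗ[ℝ] V).range := T.codRestrict _ fun x ↦ ⟨x, rfl⟩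
  let e := ContinuousLinearEquiv.equivOfRightInverse T' (LinearMap.toContinuousLinearMap σ)
    (fun r ↦ congrArg (fun L : (T : E →ₗ[ℝ] V).range →ₗ[ℝ] (T : E →ₗ[ℝ] V).range ↦ L r) hσ)
  have hker : (T' : E →ₗ[ℝ] (T : E →ₗ[ℝ] V).range).ker = (T : E →ₗ[ℝ] V).ker := by
    ext x
    exact ⟨fun h ↦ congrArg Subtype.val h, fun h ↦ Subtype.ext h⟩
  rw [← hker]
  exact ⟨e⟩

/-- Both kernels split as the common part `ker A ∩ ker A'` times a finite-dimensional space, and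
`finrank_range_prod`, applied in both orders, equates the dimensions of the two extra factors. -/
theorem nonempty_homeomorph_ker {A A' : E →L[ℝ] V} (h : Module.finrank ℝ (A : E →ₗ[ℝ] V).range =
    Module.finrank ℝ (A' : E →ₗ[ℝ] V).range) :
    Nonempty ((A : E →ₗ[ℝ] V).ker ≃ₜ (A' : E →ₗ[ℝ] V).ker) := by
  let T := A'.comp (A : E →ₗ[ℝ] V).ker.subtypeL
  let T' := A.comp (A' : E →ₗ[ℝ] V).ker.subtypeL
  obtain ⟨e⟩ := nonempty_equiv_range_prod_ker T
  obtain ⟨e'⟩ := nonempty_equiv_range_prod_ker T'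
  have h1 := finrank_range_prod A A'
  have h2 := finrank_range_prod A' A
  have h3 : Module.finrank ℝ (A.prod A' : E →ₗ[ℝ] V × V).range =
      Module.finrank ℝ (A'.prod A : E →ₗ[ℝ] V × V).range := by
    rw [← LinearEquiv.finrank_map_eq (LinearEquiv.prodComm ℝ V V)
      (A.prod A' : E →ₗ[ℝ] V × V).range, ← LinearMap.range_comp]
    rfl
  have h4 : Module.finrank ℝ (T : (A : E →ₗ[ℝ] V).ker →ₗ[ℝ] V).range =
      Module.finrank ℝ (T' : (A' : E →ₗ[ℝ] V).ker →ₗ[ℝ] V).range := by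
    simp only [T, T']
    omega
  let f : (T : (A : E →ₗ[ℝ] V).ker →ₗ[ℝ] V).ker ≃ₜ (T' : (A' : E →ₗ[ℝ] V).ker →ₗ[ℝ] V).ker :=
    { toFun := fun x ↦ ⟨⟨x.1.1, x.2⟩, x.1.2⟩
      invFun := fun x ↦ ⟨⟨x.1.1, x.2⟩, x.1.2⟩
      left_inv := fun x ↦ rfl
      right_inv := fun x ↦ rfl
      continuous_toFun := by fun_prop
      continuous_invFun := by fun_prop }
  exact ⟨e.toHomeomorph.trans (((ContinuousLinearEquiv.ofFinrankEq h4).toHomeomorph.prodCongr f).trans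
    e'.toHomeomorph.symm)⟩

end Linear

end BanachChains

/-! ### Normal spaces of the chain and assembly of the theorem -/

namespace BanachChains

set_option linter.unusedSectionVars false

variable {s₀ : ℝ} {E : Ioi s₀ → Type*} [∀ s, NormedAddCommGroup (E s)] [∀ s, NormedSpace ℝ (E s)]
  [∀ s, CompleteSpace (E s)]
  {Q : Ioi s₀ → Type*} [∀ s, TopologicalSpace (Q s)] [∀ s, T2Space (Q s)]
  [∀ s, ChartedSpace (E s) (Q s)] [∀ s, IsManifold 𝓘(ℝ, E s) ∞ (Q s)]
  {C : Chain E Q} (γ : WeakMetric C)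
  {EG : Type*} [NormedAddCommGroup EG] [NormedSpace ℝ EG] [FiniteDimensional ℝ EG]
  {G : Type*} [TopologicalSpace G] [T2Space G] [ChartedSpace EG G] [Group G]
  [LieGroup 𝓘(ℝ, EG) ∞ G] [∀ s, MulAction G (Q s)]

/-- The infinitesimal generators at `q` are the values of the tangent map of the orbit map. -/
theorem IsRestrictedChart.exists_generator_eq (hΦ : IsChainAction EG G C) {s : Ioi s₀}
    {hs : s₀ + 1 < (s : ℝ)} {q : Q s} {ψ : OpenPartialHomeomorph (Q s) (E s)}
    (hψ : IsRestrictedChart C (pred_lt s hs) q ψ) :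
    ∃ L : EG → EG, Function.Surjective L ∧ ∀ ξ : EG,
      (generator EG G C s hs q ξ : E (pred s hs)) =
        orbitTangent EG G (inclTangent C s hs q) ψ (L ξ) := by
  have hO := hψ.isOrbitChart hΦ
  have hsmul : ContinuousSMul G (Q s) := ⟨hΦ.continuous_smul s⟩
  have hdiff := hO.differentiableAt_orbitMap_left.self_of_nhds.1
  obtain ⟨hψq, φ, hφ, hsub, hι⟩ := hψ
  set i := C.incl (pred_lt s hs) with hi
  set ι := inclTangent C s hs q with hιdef
  replace hι : ∀ x ∈ ψ.source, ι (ψ x) = φ (i x) := hι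
  set κ := chartAt EG (1 : G) with hκ
  have h1s : (1 : G) ∈ κ.source := mem_chart_source EG (1 : G)
  have hκd : κ.MDifferentiable 𝓘(ℝ, EG) 𝓘(ℝ, EG) := mdifferentiable_chart (1 : G)
  -- The reparametrization is the tangent map of the group chart at `1`. Only its surjectivity
  -- matters, because orthogonality is required against all generators.
  refine ⟨fun ξ ↦ mfderiv 𝓘(ℝ, EG) 𝓘(ℝ, EG) κ (1 : G) ξ, hκd.mfderiv_surjective h1s, fun ξ ↦ ?_⟩
  let h : G → Q (pred s hs) := fun g ↦ i (g • q)
  have hh : MDifferentiableAt 𝓘(ℝ, EG) 𝓘(ℝ, E (pred s hs)) h 1 :=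
    (hΦ.contMDiff_orbit s hs q).contMDiffAt.mdifferentiableAt (by simp)
  have hφ1 : HasMFDerivAt 𝓘(ℝ, E (pred s hs)) 𝓘(ℝ, E (pred s hs)) φ (h 1)
      (ContinuousLinearMap.id ℝ (E (pred s hs))) := by
    have h1 : h 1 = i q := by simp only [h, one_smul]
    rw [h1]
    have h2 := ((contMDiffAt_chart hφ.mem_maximalAtlas hφ.mem_source).mdifferentiableAt
      (by simp)).hasMFDerivAt
    have h3 : mfderiv 𝓘(ℝ, E (pred s hs)) 𝓘(ℝ, E (pred s hs)) φ (i q) =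
        ContinuousLinearMap.id ℝ (E (pred s hs)) := by
      ext v
      exact hφ.mfderiv_eq v
    rwa [h3] at h2
  have hcomp := hφ1.comp (1 : G) hh.hasMFDerivAt
  have hD : HasFDerivAt (fun a ↦ orbitMap EG G ι ψ (a, 0)) (orbitTangent EG G ι ψ) (κ 1) :=
    (DifferentiableAt.comp (𝕜 := ℝ) (κ 1) (g := orbitMap EG G ι ψ) (f := fun a ↦ (a, (0 : E s)))
      hdiff (by fun_prop)).hasFDerivAt
  have hcomp' := hD.hasMFDerivAt.comp (1 : G)
    (hκd.mdifferentiableAt h1s).hasMFDerivAt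
  have heq : φ ∘ h =ᶠ[𝓝 1] (fun a ↦ orbitMap EG G ι ψ (a, 0)) ∘ κ := by
    have h1 : Tendsto (fun g : G ↦ g • q) (𝓝 1) (𝓝 q) :=
      (continuous_id.smul continuous_const).tendsto' _ _ (one_smul _ _)
    filter_upwards [h1.eventually (ψ.open_source.mem_nhds hψq.mem_source),
      κ.open_source.mem_nhds h1s] with g hg hgκ
    simp only [Function.comp_apply, orbitMap, ← hκ, h]
    rw [κ.left_inv hgκ, hO.symm_zero, hι _ hg]
  have huniq := hasMFDerivAt_unique hcomp (hcomp'.congr_of_eventuallyEq heq)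
  exact congrArg (fun L : EG →L[ℝ] E (pred s hs) ↦ L ξ) huniq

/-- The normal space at `q` is the kernel of a continuous linear map into `EG`, composed with the
tangent map of the inclusion. -/
theorem IsRestrictedChart.exists_normalSpace (hΦ : IsChainAction EG G C) {s : Ioi s₀}
    {hs : s₀ + 1 < (s : ℝ)} {q : Q s} {ψ : OpenPartialHomeomorph (Q s) (E s)}
    (hψ : IsRestrictedChart C (pred_lt s hs) q ψ) :
    ∃ l : E (pred s hs) →L[ℝ] EG,
      (∀ v, orbitTangent EG G (inclTangent C s hs q) ψ
        (l (orbitTangent EG G (inclTangent C s hs q) ψ v)) =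
          orbitTangent EG G (inclTangent C s hs q) ψ v) ∧
      (∀ y, l (orbitTangent EG G (inclTangent C s hs q) ψ (l y)) = l y) ∧
      ∀ v : E s, (v : TangentSpace 𝓘(ℝ, E s) q) ∈ normalSpace EG G C γ s hs q ↔
        l (inclTangent C s hs q v) = 0 := by
  obtain ⟨L, hL, hgen⟩ := hψ.exists_generator_eq hΦ
  let b : E (pred s hs) →L[ℝ] E (pred s hs) →L[ℝ] ℝ :=
    γ.form (pred s hs) (C.incl (pred_lt s hs) q)
  obtain ⟨l, hl, hl', hl0⟩ := exists_orthogonal_pseudoinverse b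
    (γ.pos (pred s hs) (C.incl (pred_lt s hs) q)) (orbitTangent EG G (inclTangent C s hs q) ψ)
  refine ⟨l, hl, hl', fun v ↦ ?_⟩
  rw [hl0]
  constructor
  · intro hv w
    obtain ⟨ξ, rfl⟩ := hL w
    rw [← hgen]
    exact hv ξ
  · intro hv ξ
    exact (congrArg (b (inclTangent C s hs q v)) (hgen ξ)).trans (hv (L ξ))

theorem IsChainAction.isSeqProper (hΦ : IsChainAction EG G C) (s : Ioi s₀) :
    IsSeqProper G (Q s) := hΦ.proper s

theorem Chain.exists_isRestrictedChart (C : Chain E Q) {r s : Ioi s₀} (h : s < r) (q : Q r) :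
    ∃ ψ, IsRestrictedChart C h q ψ := by
  obtain ⟨φ, ψ, hφ, hψ, hs, hι⟩ := C.exists_chart h q
  exact ⟨ψ, hψ, φ, hφ, hs.le, hι⟩

theorem exists_conj_of_conj {X : Type*} [MulAction G X] {H : Subgroup G}
    (hH : ∀ q : X, ∃ g : G, MulAction.stabilizer G q = H.map (MulAut.conj g).toMonoidHom)
    (x y : X) : ∃ g : G, MulAction.stabilizer G y =
      (MulAction.stabilizer G x).map (MulAut.conj g).toMonoidHom := by
  obtain ⟨a, ha⟩ := hH x
  obtain ⟨b, hb⟩ := hH y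
  refine ⟨b * a⁻¹, ?_⟩
  rw [ha, hb, Subgroup.map_map]
  congr 1
  ext g
  simp [mul_assoc]

theorem isClosed_normalSpace (hΦ : IsChainAction EG G C) {s : Ioi s₀} (hs : s₀ + 1 < (s : ℝ))
    (q : Q s) :
    IsClosed (normalSpace EG G C γ s hs q : Set (TangentSpace 𝓘(ℝ, E s) q)) := by
  obtain ⟨ψ, hψ⟩ := C.exists_isRestrictedChart (pred_lt s hs) q
  obtain ⟨l, -, -, hN⟩ := hψ.exists_normalSpace γ hΦ
  have h : IsClosed {v : E s | l (inclTangent C s hs q v) = 0} :=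
    isClosed_eq (l.continuous.comp (inclTangent C s hs q).continuous) continuous_const
  have heq : (normalSpace EG G C γ s hs q : Set (TangentSpace 𝓘(ℝ, E s) q)) =
      {v : E s | l (inclTangent C s hs q v) = 0} := Set.ext hN
  rw [heq]
  exact h

/-- The normal spaces have the same codimension. -/
theorem nonempty_homeomorph_normalSpace (hΦ : IsChainAction EG G C) {s : Ioi s₀}
    (hs : s₀ + 1 < (s : ℝ))
    (hconj : ∀ x y : Q s, ∃ g : G, MulAction.stabilizer G y =
      (MulAction.stabilizer G x).map (MulAut.conj g).toMonoidHom) (q q' : Q s) :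
    Nonempty (normalSpace EG G C γ s hs q ≃ₜ normalSpace EG G C γ s hs q') := by
  obtain ⟨ψ, hψ⟩ := C.exists_isRestrictedChart (pred_lt s hs) q
  obtain ⟨l, hl, hl', hN⟩ := hψ.exists_normalSpace γ hΦ
  obtain ⟨ψ', hψ'⟩ := C.exists_isRestrictedChart (pred_lt s hs) q'
  obtain ⟨m, hm, hm', hN'⟩ := hψ'.exists_normalSpace γ hΦ
  have hker : Module.finrank ℝ (orbitTangent EG G (inclTangent C s hs q) ψ :
      EG →ₗ[ℝ] E (pred s hs)).ker = Module.finrank ℝ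
      (orbitTangent EG G (inclTangent C s hs q') ψ' : EG →ₗ[ℝ] E (pred s hs)).ker := by
    have hO := hψ.isOrbitChart hΦ
    have hO' := hψ'.isOrbitChart hΦ
    obtain ⟨g, hg⟩ := hconj (ψ.symm 0) (ψ'.symm 0)
    exact finrank_ker_eq_of_lieSet hg hO.ker_eq.self_of_nhds hO'.ker_eq.self_of_nhds
  have h1 := LinearMap.finrank_range_add_finrank_ker
    (orbitTangent EG G (inclTangent C s hs q) ψ : EG →ₗ[ℝ] E (pred s hs))
  have h2 := LinearMap.finrank_range_add_finrank_ker
    (orbitTangent EG G (inclTangent C s hs q') ψ' : EG →ₗ[ℝ] E (pred s hs))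
  -- The codimension of a normal space is the rank of the orbit map at its base point, and conjugate
  -- isotropy groups give equal ranks.
  have h3 : Module.finrank ℝ (l.comp (inclTangent C s hs q) : E s →ₗ[ℝ] EG).range =
      Module.finrank ℝ (m.comp (inclTangent C s hs q') : E s →ₗ[ℝ] EG).range := by
    have hd : ∀ x : Q s, DenseRange (inclTangent C s hs x) := C.denseRange_mfderiv (pred_lt s hs)
    rw [range_comp_eq_of_denseRange (hd q) l, range_comp_eq_of_denseRange (hd q') m,
      finrank_range_eq_of_pseudoinverse hl hl', finrank_range_eq_of_pseudoinverse hm hm']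
    omega
  obtain ⟨e⟩ := nonempty_homeomorph_ker h3
  have k : normalSpace EG G C γ s hs q =
      (l.comp (inclTangent C s hs q) : E s →ₗ[ℝ] EG).ker := SetLike.ext hN
  have k' : normalSpace EG G C γ s hs q' =
      (m.comp (inclTangent C s hs q') : E s →ₗ[ℝ] EG).ker := SetLike.ext hN'
  exact ⟨(Homeomorph.setCongr (congrArg (fun N : Submodule ℝ (E s) ↦ (N : Set (E s))) k)).trans
    (e.trans (Homeomorph.setCongr
      (congrArg (fun N : Submodule ℝ (E s) ↦ (N : Set (E s))) k'.symm)))⟩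

/-- The charts of the orbit space with values in the normal spaces. -/
theorem IsRestrictedChart.exists_orbitSpace_chart (hΦ : IsChainAction EG G C) {s : Ioi s₀}
    {hs : s₀ + 1 < (s : ℝ)}
    (hconj : ∀ x y : Q s, ∃ g : G, MulAction.stabilizer G y =
      (MulAction.stabilizer G x).map (MulAut.conj g).toMonoidHom) {q : Q s}
    {ψ : OpenPartialHomeomorph (Q s) (E s)} (hψ : IsRestrictedChart C (pred_lt s hs) q ψ) :
    ∃ (W X₀ : Set (Q s)) (B : OpenPartialHomeomorph (MulAction.orbitRel.Quotient G (Q s))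
      (normalSpace EG G C γ s hs q)),
      IsOpen W ∧ q ∈ W ∧ W ⊆ ψ.source ∧ IsOpen X₀ ∧ q ∈ X₀ ∧ B.source = orbitProj G '' X₀ ∧
      (∀ r ∈ X₀, ∀ p ∈ W, (ψ p : TangentSpace 𝓘(ℝ, E s) q) ∈ normalSpace EG G C γ s hs q →
        (∃ g : G, p = g • r) →
        ((B (orbitProj G r) : TangentSpace 𝓘(ℝ, E s) q) : E s) = ψ p) ∧
      ∀ n ∈ B.target, ((n : TangentSpace 𝓘(ℝ, E s) q) : E s) ∈ ψ.target ∧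
        B.symm n = orbitProj G (ψ.symm (n : TangentSpace 𝓘(ℝ, E s) q)) := by
  have : IsTopologicalGroup G := topologicalGroup_of_lieGroup 𝓘(ℝ, EG) ∞
  have : ContinuousSMul G (Q s) := ⟨hΦ.continuous_smul s⟩
  have : FirstCountableTopology (Q s) := firstCountableTopology_of_chartedSpace (E s) (Q s)
  obtain ⟨l, hl, hl', hN⟩ := hψ.exists_normalSpace γ hΦ
  exact ((hψ.isOrbitChart hΦ).isSlice hconj hl hl').exists_chart
    (E := E s) (N := normalSpace EG G C γ s hs q) (hΦ.isSeqProper s) hconj hψ.1.mem_source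
    fun r ↦ (hN (ψ r)).symm

theorem IsRestrictedChart.exists_isSlicingMap (hΦ : IsChainAction EG G C) {s : Ioi s₀}
    {hs : s₀ + 1 < (s : ℝ)} {q : Q s}
    {ψ : OpenPartialHomeomorph (Q s) (E s)} (hψ : IsRestrictedChart C (pred_lt s hs) q ψ)
    {V₀ : Set (G ⧸ MulAction.stabilizer G q)} {χ : G ⧸ MulAction.stabilizer G q → G}
    (hχ : IsLocalSection EG (MulAction.stabilizer G q) V₀ χ) :
    ∃ V U β, IsSlicingMap EG (normalSpace EG G C γ s hs q) ψ V₀ χ V U β := by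
  have : ContinuousSMul G (Q s) := ⟨hΦ.continuous_smul s⟩
  obtain ⟨l, hl, hl', hN⟩ := hψ.exists_normalSpace γ hΦ
  exact (hψ.isOrbitChart hΦ).exists_isSlicingMap (hΦ.contMDiff_smul s) hψ.1.mem_maximalAtlas
    hl hl' hN hχ

/-- The slicing map moves `r` along its orbit into the slice. As long as the moved point stays in
`W`, uniqueness of slice points forces it to be the value of the chart already constructed, which
only has to be restricted. -/
theorem IsSlicingMap.exists_orbitSpace_chart (hΦ : IsChainAction EG G C) {s : Ioi s₀}
    {hs : s₀ + 1 < (s : ℝ)}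
    (hconj : ∀ x y : Q s, ∃ g : G, MulAction.stabilizer G y =
      (MulAction.stabilizer G x).map (MulAut.conj g).toMonoidHom) {q : Q s}
    {ψ : OpenPartialHomeomorph (Q s) (E s)} (hψ : IsRestrictedChart C (pred_lt s hs) q ψ)
    {V₀ : Set (G ⧸ MulAction.stabilizer G q)} {χ : G ⧸ MulAction.stabilizer G q → G}
    (hχ : IsLocalSection EG (MulAction.stabilizer G q) V₀ χ)
    {V : Set (G ⧸ MulAction.stabilizer G q)} {U : Set (Q s)}
    {β : Q s → G ⧸ MulAction.stabilizer G q}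
    (h : IsSlicingMap EG (normalSpace EG G C γ s hs q) ψ V₀ χ V U β) :
    ∃ (U' : Set (Q s))
      (B : OpenPartialHomeomorph (MulAction.orbitRel.Quotient G (Q s))
        (normalSpace EG G C γ s hs q)),
      IsOpen U' ∧ q ∈ U' ∧ U' ⊆ U ∧ B.source = orbitProj G '' U' ∧
      (∀ r ∈ U', ((B (orbitProj G r) : TangentSpace 𝓘(ℝ, E s) q) : E s) = ψ (χ (β r) • r)) ∧
      ∀ n ∈ B.target, ((n : TangentSpace 𝓘(ℝ, E s) q) : E s) ∈ ψ.target ∧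
        B.symm n = orbitProj G (ψ.symm (n : TangentSpace 𝓘(ℝ, E s) q)) := by
  have hsmul : ContinuousSMul G (Q s) := ⟨hΦ.continuous_smul s⟩
  obtain ⟨W, X₀, B, hW, hqW, hWψ, hX₀, hqX₀, hBs, hB, hBt⟩ :=
    hψ.exists_orbitSpace_chart γ hΦ hconj
  have hcc : ContinuousOn (fun r ↦ χ (β r) • r) (U ∩ X₀) :=
    (h.contMDiffOn.continuousOn.smul continuousOn_id).mono inter_subset_left
  -- Since `ψ q = 0` lies in the normal space, `[e]` solves the defining equation at `q`, so `β q =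
  -- [e]` although the slicing map is arbitrary.
  have hβq : χ (β q) • q = q := by
    have h1 : χ ((1 : G) : G ⧸ MulAction.stabilizer G q) • q = q := by
      have h2 := QuotientGroup.eq.1 (hχ.mk_section _ hχ.one_mem)
      rw [mul_one] at h2
      exact inv_mem_iff.1 h2
    have h3 : ((1 : G) : G ⧸ MulAction.stabilizer G q) = β q := by
      rw [← h.mem_iff _ h.one_mem q h.mem_U, h1, hψ.1.map_eq_zero]
      exact zero_mem _
    rw [← h3, h1]
  set U' := (U ∩ X₀) ∩ (fun r ↦ χ (β r) • r) ⁻¹' W with hU'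
  have hU'o : IsOpen U' := hcc.isOpen_inter_preimage (h.isOpen_U.inter hX₀) hW
  have hopen : IsOpen (orbitProj G '' U') := isOpenMap_orbitProj _ hU'o
  refine ⟨U', B.restrOpen _ hopen, hU'o, ⟨⟨h.mem_U, hqX₀⟩, ?_⟩, fun r hr ↦ hr.1.1, ?_, ?_, ?_⟩
  · rw [mem_preimage, hβq]
    exact hqW
  · rw [B.restrOpen_source, hBs]
    exact inter_eq_right.2 (image_mono fun r hr ↦ hr.1.2)
  · intro r hr
    exact hB r hr.1.2 _ hr.2 ((h.mem_iff _ (h.mapsTo hr.1.1) r hr.1.1).2 rfl) ⟨_, rfl⟩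
  · intro n hn
    refine hBt n ?_
    have h1 := (B.restrOpen _ hopen).map_target hn
    rw [B.restrOpen_source] at h1
    have h2 := (B.restrOpen _ hopen).right_inv hn
    have h3 := B.map_source h1.1
    rwa [← h2]

/-- The chart near the orbit of `p` takes values in the normal space at `p`; a homeomorphism of
normal spaces moves all charts to the single model at `q`. -/
theorem nonempty_chartedSpace_orbitSpace (hΦ : IsChainAction EG G C) {s : Ioi s₀}
    (hs : s₀ + 1 < (s : ℝ))
    (hconj : ∀ x y : Q s, ∃ g : G, MulAction.stabilizer G y =
      (MulAction.stabilizer G x).map (MulAut.conj g).toMonoidHom) (q : Q s) :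
    Nonempty (ChartedSpace (normalSpace EG G C γ s hs q)
      (MulAction.orbitRel.Quotient G (Q s))) := by
  have key : ∀ x : MulAction.orbitRel.Quotient G (Q s),
      ∃ B : OpenPartialHomeomorph (MulAction.orbitRel.Quotient G (Q s))
        (normalSpace EG G C γ s hs q), x ∈ B.source := by
    intro x
    obtain ⟨p, rfl⟩ := surjective_orbitProj x
    obtain ⟨ψ, hψ⟩ := C.exists_isRestrictedChart (pred_lt s hs) p
    obtain ⟨-, X₀, B, -, -, -, -, hp, hBs, -, -⟩ := hψ.exists_orbitSpace_chart γ hΦ hconj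
    obtain ⟨e⟩ := nonempty_homeomorph_normalSpace γ hΦ hs hconj p q
    refine ⟨B.transHomeomorph e, ?_⟩
    rw [OpenPartialHomeomorph.transHomeomorph_source, hBs]
    exact ⟨p, hp, rfl⟩
  choose c hc using key
  exact ⟨{ atlas := range c
           chartAt := c
           mem_chart_source := hc
           chart_mem_atlas := fun x ↦ ⟨x, rfl⟩ }⟩

end BanachChains

theorem theorem4p3 {s₀ : ℝ}
    {E : Set.Ioi s₀ → Type*} [∀ s, NormedAddCommGroup (E s)] [∀ s, NormedSpace ℝ (E s)]
    [∀ s, CompleteSpace (E s)]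
    {Q : Set.Ioi s₀ → Type*} [∀ s, TopologicalSpace (Q s)] [∀ s, T2Space (Q s)]
    [∀ s, ChartedSpace (E s) (Q s)] [∀ s, IsManifold 𝓘(ℝ, E s) ∞ (Q s)]
    (C : BanachChains.Chain E Q) (γ : BanachChains.WeakMetric C)
    {EG : Type*} [NormedAddCommGroup EG] [NormedSpace ℝ EG] [FiniteDimensional ℝ EG]
    {G : Type*} [TopologicalSpace G] [T2Space G] [ChartedSpace EG G] [Group G]
    [LieGroup 𝓘(ℝ, EG) ∞ G]
    [∀ s, MulAction G (Q s)] (hΦ : BanachChains.IsChainAction EG G C)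
    (s : Set.Ioi s₀) (hs : s₀ + 1 < (s : ℝ))
    (H : Subgroup G)
    (hH : ∀ q : Q s, ∃ g : G, MulAction.stabilizer G q = H.map (MulAut.conj g).toMonoidHom) :
    (∀ (q : Q s) (ψ : OpenPartialHomeomorph (Q s) (E s)),
      BanachChains.IsRestrictedChart C (BanachChains.pred_lt s hs) q ψ →
      ∀ (V₀ : Set (G ⧸ MulAction.stabilizer G q)) (χ : G ⧸ MulAction.stabilizer G q → G),
      BanachChains.IsLocalSection EG (MulAction.stabilizer G q) V₀ χ →
      (∃ V U β, BanachChains.IsSlicingMap EG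
        (BanachChains.normalSpace EG G C γ s hs q) ψ V₀ χ V U β) ∧
      ∀ V U β, BanachChains.IsSlicingMap EG
        (BanachChains.normalSpace EG G C γ s hs q) ψ V₀ χ V U β →
        ∃ (U' : Set (Q s))
          (B : OpenPartialHomeomorph (MulAction.orbitRel.Quotient G (Q s))
            (BanachChains.normalSpace EG G C γ s hs q)),
          IsOpen U' ∧ q ∈ U' ∧ U' ⊆ U ∧
          B.source = BanachChains.orbitProj G '' U' ∧
          (∀ r ∈ U', ((B (BanachChains.orbitProj G r) : TangentSpace 𝓘(ℝ, E s) q) : E s)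
            = ψ (χ (β r) • r)) ∧
          ∀ n ∈ B.target, ((n : TangentSpace 𝓘(ℝ, E s) q) : E s) ∈ ψ.target ∧
            B.symm n = BanachChains.orbitProj G (ψ.symm (n : TangentSpace 𝓘(ℝ, E s) q))) ∧
    T2Space (MulAction.orbitRel.Quotient G (Q s)) ∧
    ∀ q : Q s,
      IsClosed (BanachChains.normalSpace EG G C γ s hs q : Set (TangentSpace 𝓘(ℝ, E s) q)) ∧
      Nonempty (ChartedSpace (BanachChains.normalSpace EG G C γ s hs q)
        (MulAction.orbitRel.Quotient G (Q s))) := by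
  have hconj := BanachChains.exists_conj_of_conj hH
  have : ContinuousSMul G (Q s) := ⟨hΦ.continuous_smul s⟩
  have : FirstCountableTopology (Q s) :=
    BanachChains.firstCountableTopology_of_chartedSpace (E s) (Q s)
  exact ⟨fun q ψ hψ V₀ χ hχ ↦ ⟨hψ.exists_isSlicingMap γ hΦ hχ,
      fun V U β h ↦ h.exists_orbitSpace_chart γ hΦ hconj hψ hχ⟩,
    (hΦ.isSeqProper s).t2Space_quotient,
    fun q ↦ ⟨BanachChains.isClosed_normalSpace γ hΦ hs q,
      BanachChains.nonempty_chartedSpace_orbitSpace γ hΦ hs hconj q⟩⟩
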